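/- **Setting.** Let $\alpha\ge 0$ and let $\sigma\in\mathbb R$, with $\sigma>0$ if $\alpha>0$ (if $\alpha=0$, $\sigma$ is an arbitrary real number). For $\delta\ge 0$ put $Q^\sigma_\delta(x)=(x+\sigma)^2+2\delta\log\frac1{|x+\sigma|}$ on $\mathbb R_+=[0,\infty)$, with values in $(-\infty,+\infty]$ (so $Q^\sigma_0(x)=(x+\sigma)^2$), and for a compactly supported probability measure $m$ on $\mathbb R_+$ let $$E_{\delta,\sigma}(m)=\int_{\mathbb R_+^2}\log\frac1{|s-t|}\,m(ds)\,m(dt)+\int_{\mathbb R_+}Q^\sigma_\delta(s)\,m(ds),\qquad E^*_{\delta,\sigma}=\inf_m E_{\delta,\sigma}(m).$$ Let $\varphi_\alpha(x,a)=x+a-\frac{2\alpha}{\sqrt{ax}}$ and $\psi_\alpha(x,a)=\frac34(x-a)^2+a(x-a)+2\alpha\frac{\sqrt a}{\sqrt x}-2\alpha-2$ (for $\alpha=0$ the terms containing $\alpha$ are absent). Let $E_\alpha$ be the set of all $a$ (with $a>0$ if $\alpha>0$, and $a\in\mathbb R$ if $\alpha=0$) for which there is $x>a$ with $\varphi_\alpha(x,a)\ge0$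 and $\psi_\alpha(x,a)=0$. For $a<b$ let $\nu^a_\alpha$ be the measure on $(a,b]$ with density $$\frac1{2\pi}\sqrt{\frac{b-x}{x-a}}\Big(2x+b-a-2\alpha\sqrt{\frac ab}\,\frac1x\Big)$$ (again without the term containing $\alpha$ if $\alpha=0$), and let $\tilde\nu^a_\alpha$ be its image under $x\mapsto x-\sigma$. For a sequence $(\mu_n)$ of nonnegative reals put $\alpha_n=\mu_n/n$ and, on $\mathbb R_+^n$, $$K_n^\sigma(x)=\sum_{i\ne j}\log\frac1{|x_i-x_j|}+(n-1)\sum_{i=1}^nQ^\sigma_{\alpha_n}(x_i)\in(-\infty,+\infty],\qquad \tau_n^\sigma=\frac1{n(n-1)}\inf_{\mathbb R_+^n}K_n^\sigma\quad(n\ge2),$$ and, for $\beta>0$, with $\Delta(x)=\prod_{i<j}(x_i-x_j)$, $$Z_n=\int_{\mathbb R_+^n}\prod_{i=1}^n|x_i+\sigma|^{\beta\mu_n}\,e^{-n\frac\beta2\sum_{i=1}^n(x_i+\sigma)^2}\,|\Delta(x)|^\beta\,dx_1\cdots dx_n .$$ **Proposition 5.2.** The minimum $a_c=\min E_\alpha$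 exists, and with $a=\max(\sigma,a_c)$ there is $b>a$, depending only on $\alpha$ and $\sigma$, with $\varphi_\alpha(b,a)\ge0$ and $\psi_\alpha(b,a)=0$, such that $\nu^a_\alpha$ is a probability measure, $E^*_{\alpha,\sigma}$ is finite, and for every sequence $(\mu_n)$ of nonnegative reals with $\mu_n/n\to\alpha$ the following hold. 1. $\displaystyle\lim_{n\to\infty}\tau_n^\sigma=E^*_{\alpha,\sigma}=E_{\alpha,\sigma}(\tilde\nu^a_\alpha)$. 2. For every $n\ge2$, $K_n^\sigma$ attains its minimum on $\mathbb R_+^n$; and for every choice of minimizers $x^{(n)}=(x^{(n)}_1,\dots,x^{(n)}_n)$, $n\ge 2$, the measures $\rho_n^\sigma=\frac1n\sum_{i=1}^n\delta_{x_i^{(n)}}$ converge to $\tilde\nu^a_\alpha$ for the tight topology, that is, $\int f\,d\rho^\sigma_n\to\int f\,d\tilde\nu^a_\alpha$ for every bounded continuous function $f$. 3. For every $\beta>0$, $\displaystyle\lim_{n\to\infty}-\frac1{n^2}\log Z_n=\frac\beta2E^*_{\alpha,\sigma}$. -/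

import Mathlib

open Filter Topology MeasureTheory

namespace RestrictedEnsemble

noncomputable section

/-- `log (1 / |r|)` with values in `(-∞, +∞]`; the value at `r = 0` is `+∞`. -/
def logInv (r : ℝ) : EReal :=
  if r = 0 then ⊤ else ((Real.log (1 / |r|) : ℝ) : EReal)

/-- The shifted external field `Q_δ^σ(x) = (x + σ)² + 2 δ log (1 / |x + σ|)`, with values in
`(-∞, +∞]` (for `δ = 0` it is `(x + σ)²` everywhere, since `0 * ⊤ = 0` in `EReal`). -/
def field (δ σ x : ℝ) : EReal :=
  (((x + σ) ^ 2 : ℝ) : EReal) + ((2 * δ : ℝ) : EReal) * logInv (x + σ)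

/-- The Lebesgue integral of an extended real function: integral of the positive part minus
integral of the negative part. -/
def erealIntegral {X : Type*} [MeasurableSpace X] (f : X → EReal) (m : Measure X) : EReal :=
  ((∫⁻ x, (f x).toENNReal ∂m : ENNReal) : EReal) -
    ((∫⁻ x, (-f x).toENNReal ∂m : ENNReal) : EReal)

/-- The logarithmic energy `E_{δ,σ}(m)` of a measure `m` in the external field `Q_δ^σ`. For the
compactly supported probability measures on `[0, ∞)` that occur below both integrands are bounded
below on the support, so the energy is a well-defined element of `(-∞, +∞]`. -/
def energy (δ σ : ℝ) (m : Measure ℝ) : EReal :=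
  erealIntegral (fun p : ℝ × ℝ => logInv (p.1 - p.2)) (m.prod m) +
    erealIntegral (field δ σ) m

/-- Probability measures with compact support contained in `[0, ∞)`. -/
def admissibleMeasures : Set (Measure ℝ) :=
  {m | IsProbabilityMeasure m ∧ ∃ K : Set ℝ, IsCompact K ∧ K ⊆ Set.Ici 0 ∧ m Kᶜ = 0}

/-- The minimal energy `E*_{δ,σ}`. -/
def minEnergy (δ σ : ℝ) : EReal :=
  ⨅ m ∈ admissibleMeasures, energy δ σ m

/-- The function `φ_α(x, a)`. -/
def phi (α x a : ℝ) : ℝ :=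
  x + a - 2 * α / √(a * x)

/-- The function `ψ_α(x, a)`. -/
def psi (α x a : ℝ) : ℝ :=
  3 / 4 * (x - a) ^ 2 + a * (x - a) + 2 * α * (√a / √x) - 2 * α - 2

/-- The set `E_α` of admissible left end points: `a` ranges over the positive reals if `α > 0`
and over all reals if `α = 0`. -/
def leftEnds (α : ℝ) : Set ℝ :=
  {a | (α = 0 ∨ 0 < a) ∧ ∃ x, a < x ∧ 0 ≤ phi α x a ∧ psi α x a = 0}

/-- The density of `ν_α^a` on `(a, b]`. -/
def nuDensity (α a b x : ℝ) : ℝ :=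
  1 / (2 * Real.pi) * √((b - x) / (x - a)) *
    (2 * x + b - a - 2 * α * √(a / b) * (1 / x))

/-- The measure `ν_α^a`, carried by `(a, b]`. -/
def nu (α a b : ℝ) : Measure ℝ :=
  (volume.restrict (Set.Ioc a b)).withDensity fun x => ENNReal.ofReal (nuDensity α a b x)

/-- The measure `ν_α^a` seen in the shifted coordinate `x - σ`, in which the half-line `[σ, ∞)`
becomes `[0, ∞)`. -/
def nuShifted (σ α a b : ℝ) : Measure ℝ :=
  (nu α a b).map fun x => x - σ

/-- The closed orthant of `ℝⁿ`. -/
def orthant (n : ℕ) : Set (Fin n → ℝ) :=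
  {x | ∀ i, 0 ≤ x i}

/-- The discrete energy `K_n^σ(x) = ∑_{i ≠ j} log (1 / |x_i - x_j|) + (n - 1) ∑_i Q_δ^σ(x_i)`,
which is `+∞` when two coordinates agree. -/
def discreteEnergy (δ σ : ℝ) (n : ℕ) (x : Fin n → ℝ) : EReal :=
  (∑ i, ∑ j ∈ Finset.univ.erase i, logInv (x i - x j)) +
    (((n : ℝ) - 1 : ℝ) : EReal) * ∑ i, field δ σ (x i)

/-- The normalized minimal discrete energy `τ_n^σ`. -/
def tau (δ σ : ℝ) (n : ℕ) : EReal :=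
  ((1 / ((n : ℝ) * ((n : ℝ) - 1)) : ℝ) : EReal) * ⨅ x ∈ orthant n, discreteEnergy δ σ n x

/-- `x` is a minimizing configuration of the discrete energy on the closed orthant. -/
def IsMinimizingConfig (δ σ : ℝ) (n : ℕ) (x : Fin n → ℝ) : Prop :=
  x ∈ orthant n ∧ IsMinOn (discreteEnergy δ σ n) (orthant n) x

/-- The empirical measure `(1 / n) ∑_i δ_{x_i}`. -/
def empirical (n : ℕ) (x : Fin n → ℝ) : Measure ℝ :=
  (n : ENNReal)⁻¹ • ∑ i, Measure.dirac (x i)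

/-- The Vandermonde product `Δ(x) = ∏_{i < j} (x_i - x_j)`. -/
def vandermonde (n : ℕ) (x : Fin n → ℝ) : ℝ :=
  ∏ i, ∏ j ∈ Finset.Ioi i, (x i - x j)

/-- The normalizing constant `Z_n`, with parameter `M` in the role of `μ_n`. -/
def partitionFunction (β σ M : ℝ) (n : ℕ) : ENNReal :=
  ∫⁻ x in orthant n, ENNReal.ofReal
    ((∏ i, |x i + σ| ^ (β * M)) * Real.exp (-((n : ℝ) * (β / 2) * ∑ i, (x i + σ) ^ 2)) *
      |vandermonde n x| ^ β)

end

end RestrictedEnsemble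

namespace RestrictedEnsemble

noncomputable section

/-! The theorem splits into a general principle and an explicit computation. The principle: if a
probability measure `ν` on the half-line satisfies Frostman's conditions (`IsEquilibrium`: `2U + Q ≥
C` everywhere, with equality `ν`-almost everywhere) and has a mildly regular density, then all three
assertions hold with limit measure `ν`. The computation: the shifted measure `nuShifted` does
satisfy these conditions.

For the principle, write the energy of `ρ` as that of `ν`, plus the excess of the total potential
integrated against `ρ`, plus the logarithmic energy of `ρ - ν`. The last term is not merely
nonnegative. Since `w / (w² + s²)` is the cosine transform of `exp (-w t)` and is the `w`-derivative
of `log √(s² + w²)`, the energy of a neutral signed measure is an integral over `w` of weighted `L²`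
norms of its Fourier transform (`charDist_le_mutualEnergy`). This gives
`IsEquilibrium.exists_energy_lower_bound`, a lower bound with the explicit gain `charDist 2 ρ ν`. It
is stated for the kernel smoothed at scale `ε`, so that it applies to empirical measures; the
smoothing costs `O(ε ^ (1/4))` because the Riesz potentials of `ν` of order `1/4` are bounded. With
`ε = 1/n` this bounds the discrete energy from below. The matching upper bound is the average of the
discrete energy over independent points drawn from `ν` (`IsEquilibrium.iInf_discreteEnergy_le`).
Comparing the two yields the limit of `tau` and forces `charDist 2 ρ_n ν → 0` for minimizers
(`IsEquilibrium.exists_tau_bounds`); together with bounded moments, this is weak convergence. For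
`Z_n`, the integrand is `exp (-(β/2) (K_n + ∑ Q))`: the lower bound for `K_n` gives one inequality,
Jensen's inequality under `ν^n` the other, with an entropy term of order only `n`.

For the computation, the substitution `x = (a+b)/2 + ((b-a)/2) cos θ` turns `nu` into a
trigonometric polynomial plus a Poisson kernel whose pole corresponds to `x = 0`. Averages of `log
|1 - z e^{iθ}|` against it follow from Cauchy's and Poisson's formulas, so the potential is explicit
in the Joukowski coordinate `z`. The condition `psi = 0` makes the weight vanish at `b`
(`IsArc.weight_factor`). The remaining factor is an increasing force whose value at `a` is `phi /
2`. Its sign gives positivity of the density and the inequality to the right of `b`; the inequality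
to the left of `a`, relevant only if `σ < a`, needs `phi = 0`. This holds at the minimum of
`leftEnds` (`phi_eq_zero_of_isLeast`), while `leftEnds_upward` lets `a = σ` be used when `σ` exceeds
that minimum. -/

/-- The regularized logarithmic kernel `-log √(s² + ε²)`. -/
def logKernel (ε s : ℝ) : ℝ := -(1 / 2) * Real.log (s ^ 2 + ε ^ 2)

/-- The mutual energy of two measures for a difference kernel. -/
def mutualEnergy (g : ℝ → ℝ) (p q : Measure ℝ) : ℝ := ∫ z, g (z.1 - z.2) ∂(p.prod q)

/-- A weighted `L²` distance between characteristic functions. -/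
def charDist (w : ℝ) (p q : Measure ℝ) : ℝ :=
  ∫ t in Set.Ioi (0 : ℝ), Real.exp (-(w * t)) * ‖charFun p t - charFun q t‖ ^ 2

/-! ### Logarithmic energy as a weighted Fourier distance -/

lemma logKernel_zero (s : ℝ) : logKernel 0 s = -Real.log s := by
  simp [logKernel]

@[fun_prop]
lemma continuous_logKernel {ε : ℝ} (hε : 0 < ε) : Continuous (logKernel ε) := by
  unfold logKernel
  refine continuous_const.mul (Continuous.log (by fun_prop) fun x => by positivity)

@[fun_prop]
lemma measurable_logKernel {ε : ℝ} : Measurable (logKernel ε) := by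
  unfold logKernel
  fun_prop

lemma integrableOn_exp_neg_mul {w : ℝ} (hw : 0 < w) :
    IntegrableOn (fun t : ℝ => Real.exp (-(w * t))) (Set.Ioi 0) := by
  simpa [neg_mul] using integrableOn_exp_mul_Ioi (a := -w) (by linarith) 0

lemma integral_exp_mul_cos {w : ℝ} (hw : 0 < w) (s : ℝ) :
    ∫ t in Set.Ioi (0 : ℝ), Real.exp (-(w * t)) * Real.cos (s * t) = w / (w ^ 2 + s ^ 2) := by
  have ha : (-(w : ℂ) + s * Complex.I).re < 0 := by simpa using hw
  have h1 := integral_exp_mul_complex_Ioi ha 0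
  have hI : IntegrableOn (fun t : ℝ => Complex.exp ((-(w : ℂ) + s * Complex.I) * t))
      (Set.Ioi 0) := integrableOn_exp_mul_complex_Ioi ha 0
  have h2 := congrArg Complex.re h1
  rw [← RCLike.re_to_complex, ← integral_re hI] at h2
  have h3 : ∀ t : ℝ, RCLike.re (Complex.exp ((-(w : ℂ) + s * Complex.I) * t)) =
      Real.exp (-(w * t)) * Real.cos (s * t) := by
    intro t
    rw [RCLike.re_to_complex, Complex.exp_re]
    simp
  simp_rw [h3] at h2
  rw [h2]
  simp only [Complex.ofReal_zero, mul_zero, Complex.exp_zero, Complex.div_re, Complex.neg_re, Complex.one_re, Complex.normSq_apply]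
  simp
  field_simp

lemma charFun_mul_conj_re (p q : Measure ℝ) [IsProbabilityMeasure p] [IsProbabilityMeasure q]
    (t : ℝ) : (charFun p t * (starRingEnd ℂ) (charFun q t)).re =
      ∫ z, Real.cos ((z.1 - z.2) * t) ∂(p.prod q) := by
  rw [← charFun_neg, charFun_apply_real, charFun_apply_real,
    ← integral_prod_mul (fun x : ℝ => Complex.exp (t * x * Complex.I))
      (fun y : ℝ => Complex.exp ((-t : ℝ) * y * Complex.I)), ← RCLike.re_to_complex, ← integral_re]
  · refine integral_congr_ae (ae_of_all _ fun z => ?_)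
    simp only [RCLike.re_to_complex]
    rw [← Complex.exp_add, Complex.exp_re]
    simp [mul_add, mul_comm, sub_eq_add_neg]
  · refine Integrable.of_bound (C := 1) (by fun_prop) (ae_of_all _ fun z => ?_)
    rw [← Complex.exp_add, Complex.norm_exp]
    simp

/-- The Cauchy kernel is a positive superposition of cosines, and Fubini turns each cosine into a
product of characteristic functions. This is the source of positivity. -/
lemma mutualEnergy_cauchy {w : ℝ} (hw : 0 < w) (p q : Measure ℝ) [IsProbabilityMeasure p]
    [IsProbabilityMeasure q] :
    mutualEnergy (fun s => w / (w ^ 2 + s ^ 2)) p q = ∫ t in Set.Ioi (0 : ℝ),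
      Real.exp (-(w * t)) * (charFun p t * (starRingEnd ℂ) (charFun q t)).re := by
  unfold mutualEnergy
  simp_rw [← integral_exp_mul_cos hw]
  rw [integral_integral_swap]
  · simp_rw [integral_const_mul, ← charFun_mul_conj_re]
  · have h1 : Integrable (fun x : (ℝ × ℝ) × ℝ => (1 : ℝ) * Real.exp (-(w * x.2)))
        ((p.prod q).prod (volume.restrict (Set.Ioi 0))) :=
      (integrable_const (1 : ℝ)).mul_prod (integrableOn_exp_neg_mul hw)
    refine h1.mono (by fun_prop) (ae_of_all _ fun z => ?_)
    simp only [Function.uncurry, norm_mul, one_mul]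
    exact mul_le_of_le_one_right (norm_nonneg _) (Real.abs_cos_le_one _)

lemma integrableOn_exp_mul_bounded {w : ℝ} (hw : 0 < w) {g : ℝ → ℝ} (hg : Measurable g) {C : ℝ}
    (hC : ∀ t, |g t| ≤ C) :
    IntegrableOn (fun t : ℝ => Real.exp (-(w * t)) * g t) (Set.Ioi 0) :=
  Integrable.mul_bdd (c := C) (integrableOn_exp_neg_mul hw) hg.aestronglyMeasurable
    (ae_of_all _ hC)

lemma charDist_eq {w : ℝ} (hw : 0 < w) (p q : Measure ℝ) [IsProbabilityMeasure p]
    [IsProbabilityMeasure q] :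
    charDist w p q = mutualEnergy (fun s => w / (w ^ 2 + s ^ 2)) p p -
      2 * mutualEnergy (fun s => w / (w ^ 2 + s ^ 2)) p q +
      mutualEnergy (fun s => w / (w ^ 2 + s ^ 2)) q q := by
  have key : ∀ (p q : Measure ℝ) [IsProbabilityMeasure p] [IsProbabilityMeasure q],
      IntegrableOn (fun t : ℝ => Real.exp (-(w * t)) *
        (charFun p t * (starRingEnd ℂ) (charFun q t)).re) (Set.Ioi 0) := by
    intro p q _ _
    refine integrableOn_exp_mul_bounded hw (C := 1) ?_ fun t => ?_
    · have := measurable_charFun (μ := p)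
      have := measurable_charFun (μ := q)
      have : Measurable fun t => charFun p t * (starRingEnd ℂ) (charFun q t) := by fun_prop
      exact Complex.measurable_re.comp this
    · refine (Complex.abs_re_le_norm _).trans ?_
      rw [norm_mul, RCLike.norm_conj]
      exact mul_le_one₀ (norm_charFun_le_one _) (norm_nonneg _) (norm_charFun_le_one _)
  rw [mutualEnergy_cauchy hw, mutualEnergy_cauchy hw, mutualEnergy_cauchy hw, ← integral_const_mul,
    ← integral_sub (key p p) ((key p q).const_mul 2), ← integral_add _ (key q q)]
  · unfold charDist
    refine integral_congr_ae (ae_of_all _ fun t => ?_)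
    simp only
    rw [← Complex.normSq_eq_norm_sq, Complex.normSq_sub, Complex.mul_conj, Complex.mul_conj]
    simp only [Complex.ofReal_re]
    ring
  · exact (key p p).sub ((key p q).const_mul 2)

lemma integrable_charDist {w : ℝ} (hw : 0 < w) (p q : Measure ℝ) [IsProbabilityMeasure p]
    [IsProbabilityMeasure q] :
    IntegrableOn (fun t : ℝ => Real.exp (-(w * t)) * ‖charFun p t - charFun q t‖ ^ 2)
      (Set.Ioi 0) := by
  refine integrableOn_exp_mul_bounded hw (C := 4) ?_ fun t => ?_
  · have := measurable_charFun (μ := p)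
    have := measurable_charFun (μ := q)
    fun_prop
  · rw [abs_of_nonneg (by positivity)]
    have : ‖charFun p t - charFun q t‖ ≤ 2 := by
      refine (norm_sub_le _ _).trans ?_
      have := norm_charFun_le_one (μ := p) t
      have := norm_charFun_le_one (μ := q) t
      linarith
    nlinarith [norm_nonneg (charFun p t - charFun q t)]

lemma charDist_nonneg (w : ℝ) (p q : Measure ℝ) : 0 ≤ charDist w p q :=
  integral_nonneg fun t => by positivity

lemma charDist_anti {v w : ℝ} (hv : 0 < v) (hvw : v ≤ w) (p q : Measure ℝ)
    [IsProbabilityMeasure p] [IsProbabilityMeasure q] : charDist w p q ≤ charDist v p q := by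
  refine setIntegral_mono_on (integrable_charDist (hv.trans_le hvw) p q)
    (integrable_charDist hv p q) measurableSet_Ioi fun t ht => ?_
  have ht : 0 < t := ht
  gcongr

/-- Integration of the `w`-derivative of `log √(s² + w²)`. The smoothed logarithm thus becomes a
superposition of Cauchy kernels, up to the kernel at the large scale `R`. -/
lemma logKernel_sub {ε R : ℝ} (hε : 0 < ε) (hR : ε ≤ R) (s : ℝ) :
    logKernel ε s - logKernel R s = ∫ w in Set.Ioc ε R, w / (w ^ 2 + s ^ 2) := by
  rw [← intervalIntegral.integral_of_le hR,
    intervalIntegral.integral_eq_sub_of_hasDerivAt (f := fun w => -logKernel w s)]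
  · ring
  · intro w hw
    rw [Set.uIcc_of_le hR] at hw
    have hw0 : 0 < w := hε.trans_le hw.1
    have h1 : HasDerivAt (fun w : ℝ => s ^ 2 + w ^ 2) (2 * w) w := by
      simpa using (hasDerivAt_pow 2 w).const_add (s ^ 2)
    have h2 := ((h1.log (by positivity)).const_mul (-(1 / 2))).neg
    refine h2.congr_deriv ?_
    field_simp
    ring
  · refine ContinuousOn.intervalIntegrable ?_
    rw [Set.uIcc_of_le hR]
    refine ContinuousOn.div (by fun_prop) (by fun_prop) fun w hw => ?_
    have hw0 : 0 < w := hε.trans_le hw.1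
    positivity

lemma cauchy_kernel_le {w : ℝ} (hw : 0 < w) (s : ℝ) : |w / (w ^ 2 + s ^ 2)| ≤ 1 / w := by
  rw [abs_of_nonneg (by positivity), div_le_div_iff₀ (by positivity) hw]
  nlinarith [sq_nonneg s]

lemma integrable_cauchy_prod {ε R : ℝ} (hε : 0 < ε) (p q : Measure ℝ)
    [IsProbabilityMeasure p] [IsProbabilityMeasure q] :
    Integrable (Function.uncurry fun (z : ℝ × ℝ) (w : ℝ) => w / (w ^ 2 + (z.1 - z.2) ^ 2))
      ((p.prod q).prod (volume.restrict (Set.Ioc ε R))) := by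
  refine Integrable.of_bound (C := 1 / ε) (Measurable.aestronglyMeasurable
    (by unfold Function.uncurry; fun_prop)) ?_
  have : ∀ᵐ w ∂(volume.restrict (Set.Ioc ε R)), w ∈ Set.Ioc ε R :=
    ae_restrict_mem measurableSet_Ioc
  have h2 := Measure.quasiMeasurePreserving_snd (μ := p.prod q)
    (ν := volume.restrict (Set.Ioc ε R)) |>.ae this
  filter_upwards [h2] with z hz
  refine (cauchy_kernel_le (hε.trans hz.1) _).trans ?_
  exact one_div_le_one_div_of_le hε hz.1.le

lemma mutualEnergy_logKernel_sub {ε R : ℝ} (hε : 0 < ε) (hR : ε ≤ R) (p q : Measure ℝ)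
    [IsProbabilityMeasure p] [IsProbabilityMeasure q] :
    mutualEnergy (fun s => logKernel ε s - logKernel R s) p q =
      ∫ w in Set.Ioc ε R, mutualEnergy (fun s => w / (w ^ 2 + s ^ 2)) p q := by
  unfold mutualEnergy
  simp_rw [logKernel_sub hε hR]
  exact integral_integral_swap (integrable_cauchy_prod hε p q)

lemma integrableOn_mutualEnergy_cauchy {ε R : ℝ} (hε : 0 < ε) (p q : Measure ℝ)
    [IsProbabilityMeasure p] [IsProbabilityMeasure q] :
    IntegrableOn (fun w => mutualEnergy (fun s => w / (w ^ 2 + s ^ 2)) p q) (Set.Ioc ε R) :=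
  (integrable_cauchy_prod hε p q).integral_prod_right

lemma integral_charDist_eq {ε R : ℝ} (hε : 0 < ε) (hR : ε ≤ R) (p q : Measure ℝ)
    [IsProbabilityMeasure p] [IsProbabilityMeasure q] :
    IntegrableOn (fun w => charDist w p q) (Set.Ioc ε R) ∧
    mutualEnergy (fun s => logKernel ε s - logKernel R s) p p -
      2 * mutualEnergy (fun s => logKernel ε s - logKernel R s) p q +
      mutualEnergy (fun s => logKernel ε s - logKernel R s) q q =
      ∫ w in Set.Ioc ε R, charDist w p q := by
  have h1 := integrableOn_mutualEnergy_cauchy (R := R) hε p p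
  have h2 := integrableOn_mutualEnergy_cauchy (R := R) hε p q
  have h3 := integrableOn_mutualEnergy_cauchy (R := R) hε q q
  have hc : Set.EqOn (fun w => charDist w p q) (fun w =>
      mutualEnergy (fun s => w / (w ^ 2 + s ^ 2)) p p -
      2 * mutualEnergy (fun s => w / (w ^ 2 + s ^ 2)) p q +
      mutualEnergy (fun s => w / (w ^ 2 + s ^ 2)) q q) (Set.Ioc ε R) :=
    fun w hw => charDist_eq (hε.trans hw.1) p q
  constructor
  · exact (integrableOn_congr_fun hc measurableSet_Ioc).2 ((h1.sub (h2.const_mul 2)).add h3)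
  · have h12 : IntegrableOn (fun w => mutualEnergy (fun s => w / (w ^ 2 + s ^ 2)) p p -
        2 * mutualEnergy (fun s => w / (w ^ 2 + s ^ 2)) p q) (Set.Ioc ε R) :=
      h1.sub (h2.const_mul 2)
    rw [setIntegral_congr_fun measurableSet_Ioc hc, integral_add h12 h3,
      integral_sub h1 (h2.const_mul 2), integral_const_mul, mutualEnergy_logKernel_sub hε hR,
      mutualEnergy_logKernel_sub hε hR, mutualEnergy_logKernel_sub hε hR]

lemma integrable_comp_sub {g : ℝ → ℝ} (hg : Continuous g) {K : Set ℝ} (hK : IsCompact K)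
    {p q : Measure ℝ} [IsProbabilityMeasure p] [IsProbabilityMeasure q] (hp : p Kᶜ = 0)
    (hq : q Kᶜ = 0) : Integrable (fun z : ℝ × ℝ => g (z.1 - z.2)) (p.prod q) := by
  obtain ⟨C, hC⟩ := (hK.prod hK).exists_bound_of_continuousOn
    (f := fun z : ℝ × ℝ => g (z.1 - z.2)) (by fun_prop)
  refine Integrable.of_bound (C := C) (by fun_prop) ?_
  have h1 := Measure.quasiMeasurePreserving_fst (μ := p) (ν := q) |>.ae
    (show ∀ᵐ x ∂p, x ∈ K from hp)
  have h2 := Measure.quasiMeasurePreserving_snd (μ := p) (ν := q) |>.ae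
    (show ∀ᵐ x ∂q, x ∈ K from hq)
  filter_upwards [h1, h2] with z hz1 hz2
  exact hC z ⟨hz1, hz2⟩

/-- Conditional positivity of the regularized logarithmic kernel. -/
lemma charDist_le_mutualEnergy {ε : ℝ} (hε : 0 < ε) (hε1 : ε ≤ 1) {K : Set ℝ} (hK : IsCompact K)
    {p q : Measure ℝ} [IsProbabilityMeasure p] [IsProbabilityMeasure q] (hp : p Kᶜ = 0)
    (hq : q Kᶜ = 0) :
    charDist 2 p q ≤ mutualEnergy (logKernel ε) p p - 2 * mutualEnergy (logKernel ε) p q +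
      mutualEnergy (logKernel ε) q q := by
  obtain ⟨B, hB⟩ := (hK.prod hK).exists_bound_of_continuousOn
    (f := fun z : ℝ × ℝ => z.1 - z.2) (by fun_prop)
  -- the kernel with parameter `R`, up to a constant, is small
  have hsmall : ∀ R : ℝ, 2 ≤ R → ∀ (p q : Measure ℝ) [IsProbabilityMeasure p]
      [IsProbabilityMeasure q], p Kᶜ = 0 → q Kᶜ = 0 →
      -(Real.log R) - B ^ 2 / R ^ 2 ≤ mutualEnergy (logKernel R) p q ∧
        mutualEnergy (logKernel R) p q ≤ -(Real.log R) := by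
    intro R hR p q _ _ hp hq
    have hR0 : 0 < R := by linarith
    have hi := integrable_comp_sub (continuous_logKernel hR0) hK hp hq
    have h1 := Measure.quasiMeasurePreserving_fst (μ := p) (ν := q) |>.ae
      (show ∀ᵐ x ∂p, x ∈ K from hp)
    have h2 := Measure.quasiMeasurePreserving_snd (μ := p) (ν := q) |>.ae
      (show ∀ᵐ x ∂q, x ∈ K from hq)
    have hk : ∀ s : ℝ, logKernel R s = -Real.log R - 1 / 2 * Real.log (1 + s ^ 2 / R ^ 2) := by
      intro s
      have : s ^ 2 + R ^ 2 = R ^ 2 * (1 + s ^ 2 / R ^ 2) := by field_simp; ring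
      rw [logKernel, this, Real.log_mul (by positivity) (by positivity), Real.log_pow]
      push_cast
      ring
    constructor
    · have : ∫ z, (-(Real.log R) - B ^ 2 / R ^ 2) ∂(p.prod q) ≤ mutualEnergy (logKernel R) p q := by
        refine integral_mono_ae (integrable_const _) hi ?_
        filter_upwards [h1, h2] with z hz1 hz2
        have hb : |z.1 - z.2| ≤ B := hB z ⟨hz1, hz2⟩
        have hb2 : (z.1 - z.2) ^ 2 ≤ B ^ 2 := sq_le_sq' (by linarith [neg_abs_le (z.1 - z.2)])
          (by linarith [le_abs_self (z.1 - z.2)])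
        rw [hk]
        have h3 : Real.log (1 + (z.1 - z.2) ^ 2 / R ^ 2) ≤ (z.1 - z.2) ^ 2 / R ^ 2 := by
          have := Real.log_le_sub_one_of_pos
            (show 0 < 1 + (z.1 - z.2) ^ 2 / R ^ 2 by positivity)
          linarith
        have h4 : (z.1 - z.2) ^ 2 / R ^ 2 ≤ B ^ 2 / R ^ 2 := by gcongr
        have h5 : 0 ≤ (z.1 - z.2) ^ 2 / R ^ 2 := by positivity
        linarith
      simpa using this
    · have : mutualEnergy (logKernel R) p q ≤ ∫ z, -(Real.log R) ∂(p.prod q) := by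
        refine integral_mono hi (integrable_const _) fun z => ?_
        simp only
        rw [hk]
        have := Real.log_nonneg (show 1 ≤ 1 + (z.1 - z.2) ^ 2 / R ^ 2 by
          have : 0 ≤ (z.1 - z.2) ^ 2 / R ^ 2 := by positivity
          linarith)
        linarith
      simpa using this
  -- On a compact set the kernel at scale `R` is `-log R` up to `O(1/R²)`. The constant cancels
  -- because `p - q` has total mass zero.
  have hmain : ∀ R : ℝ, 2 ≤ R → charDist 2 p q - 2 * (B ^ 2 / R ^ 2) ≤
      mutualEnergy (logKernel ε) p p - 2 * mutualEnergy (logKernel ε) p q + mutualEnergy (logKernel ε) q q := by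
    intro R hR
    have hR0 : 0 < R := by linarith
    have hεR : ε ≤ R := by linarith
    obtain ⟨hI, heq⟩ := integral_charDist_eq hε hεR p q
    have hsub : ∀ (p q : Measure ℝ) [IsProbabilityMeasure p]
        [IsProbabilityMeasure q], p Kᶜ = 0 → q Kᶜ = 0 →
        mutualEnergy (fun s => logKernel ε s - logKernel R s) p q =
          mutualEnergy (logKernel ε) p q - mutualEnergy (logKernel R) p q := by
      intro p q _ _ hp hq
      exact integral_sub (integrable_comp_sub (continuous_logKernel hε) hK hp hq)
        (integrable_comp_sub (continuous_logKernel hR0) hK hp hq)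
    rw [hsub p p hp hp, hsub p q hp hq, hsub q q hq hq] at heq
    -- Only `w ∈ (1, 2]` is kept: this interval has length one, lies in `(ε, R]`, and `charDist`
    -- decreases in `w`.
    have hJ : charDist 2 p q ≤ ∫ w in Set.Ioc ε R, charDist w p q := by
      calc charDist 2 p q = ∫ w in Set.Ioc (1 : ℝ) 2, charDist 2 p q := by simp; ring
        _ ≤ ∫ w in Set.Ioc (1 : ℝ) 2, charDist w p q := by
          refine setIntegral_mono_on (integrableOn_const (by simp)) (hI.mono_set ?_)
            measurableSet_Ioc fun w hw => ?_
          · exact Set.Ioc_subset_Ioc hε1 hR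
          · exact charDist_anti (by linarith [hw.1]) hw.2 p q
        _ ≤ _ := by
          refine setIntegral_mono_set hI (ae_of_all _ fun w => charDist_nonneg w p q) ?_
          exact (Set.Ioc_subset_Ioc hε1 hR).eventuallyLE
    have a1 := hsmall R hR p p hp hp
    have a2 := hsmall R hR p q hp hq
    have a3 := hsmall R hR q q hq hq
    linarith
  have hlim : Tendsto (fun R : ℝ => charDist 2 p q - 2 * (B ^ 2 / R ^ 2)) atTop
      (𝓝 (charDist 2 p q - 2 * 0)) := by
    refine tendsto_const_nhds.sub (Tendsto.const_mul 2 ?_)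
    exact tendsto_const_nhds.div_atTop (tendsto_pow_atTop two_ne_zero)
  simp only [mul_zero, sub_zero] at hlim
  exact le_of_tendsto hlim ((eventually_ge_atTop 2).mono hmain)

/-! ### From the Fourier distance to weak convergence -/

lemma norm_charFun_sub_le {p : Measure ℝ} [IsProbabilityMeasure p]
    (hp : Integrable (fun x : ℝ => |x|) p) (t s : ℝ) :
    ‖charFun p t - charFun p s‖ ≤ |t - s| * ∫ x, |x| ∂p := by
  have hi : ∀ t : ℝ, Integrable (fun x : ℝ => Complex.exp (t * x * Complex.I)) p := fun t =>
    Integrable.of_bound (C := 1) (by fun_prop) (ae_of_all _ fun x => by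
      rw [← Complex.ofReal_mul, Complex.norm_exp_ofReal_mul_I])
  rw [charFun_apply_real, charFun_apply_real, ← integral_sub (hi t) (hi s), ← integral_const_mul]
  refine norm_integral_le_of_norm_le (hp.const_mul _) (ae_of_all _ fun x => ?_)
  have h1 : Complex.exp (t * x * Complex.I) - Complex.exp (s * x * Complex.I) =
      Complex.exp ((s * x : ℝ) * Complex.I) *
        (Complex.exp (Complex.I * ((t - s) * x : ℝ)) - 1) := by
    rw [mul_sub, ← Complex.exp_add, mul_one]
    push_cast
    ring_nf
  rw [h1, norm_mul, Complex.norm_exp_ofReal_mul_I, one_mul, ← abs_mul]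
  exact Real.norm_exp_I_mul_ofReal_sub_one_le

/-- The first moments bound the Lipschitz constant of the difference of characteristic functions by
`L`. A value `η` at `t` therefore persists at size `η / 2` on an interval of length `η / (2L)`,
which contributes order `η³` to the integral. -/
lemma norm_charFun_sub_pow_le {p q : Measure ℝ} [IsProbabilityMeasure p]
    [IsProbabilityMeasure q] (hp : Integrable (fun x : ℝ => |x|) p)
    (hq : Integrable (fun x : ℝ => |x|) q) {L : ℝ} (hL : 0 < L)
    (hpq : ∫ x, |x| ∂p + ∫ x, |x| ∂q ≤ L) {t : ℝ} (ht : 0 ≤ t) :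
    ‖charFun p t - charFun q t‖ ^ 3 ≤
      8 * L * Real.exp (2 * (t + 1 / L)) * charDist 2 p q := by
  set η := ‖charFun p t - charFun q t‖ with hη
  have hη0 : 0 ≤ η := norm_nonneg _
  have hη2 : η ≤ 2 := by
    refine (norm_sub_le _ _).trans ?_
    have := norm_charFun_le_one (μ := p) t
    have := norm_charFun_le_one (μ := q) t
    linarith
  have hlow : ∀ s ∈ Set.Ioc t (t + η / (2 * L)), η / 2 ≤ ‖charFun p s - charFun q s‖ := by
    intro s hs
    have h1 := norm_charFun_sub_le hp t s
    have h2 := norm_charFun_sub_le hq t s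
    have h3 : η ≤ ‖charFun p s - charFun q s‖ + ‖charFun p t - charFun p s‖ +
        ‖charFun q t - charFun q s‖ := by
      have : charFun p t - charFun q t = (charFun p s - charFun q s) +
        (charFun p t - charFun p s) - (charFun q t - charFun q s) := by ring
      rw [hη, this]
      exact (norm_sub_le _ _).trans (by gcongr; exact norm_add_le _ _)
    have h4 : |t - s| ≤ η / (2 * L) := by
      rw [abs_sub_comm, abs_of_nonneg (by linarith [hs.1])]
      linarith [hs.2]
    have h5 : |t - s| * (∫ x, |x| ∂p + ∫ x, |x| ∂q) ≤ η / (2 * L) * L := by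
      have : 0 ≤ ∫ x, |x| ∂p + ∫ x, |x| ∂q :=
        add_nonneg (integral_nonneg fun x => abs_nonneg x) (integral_nonneg fun x => abs_nonneg x)
      gcongr
    have h6 : η / (2 * L) * L = η / 2 := by field_simp
    linarith
  have hint := integrable_charDist (w := 2) (by norm_num) p q
  have hsub : Set.Ioc t (t + η / (2 * L)) ⊆ Set.Ioi 0 := fun s hs => ht.trans_lt hs.1
  have hmain : η / (2 * L) * (Real.exp (-(2 * (t + 1 / L))) * (η / 2) ^ 2) ≤ charDist 2 p q := by
    calc η / (2 * L) * (Real.exp (-(2 * (t + 1 / L))) * (η / 2) ^ 2)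
        = ∫ s in Set.Ioc t (t + η / (2 * L)),
            Real.exp (-(2 * (t + 1 / L))) * (η / 2) ^ 2 := by
          rw [setIntegral_const]
          simp [Measure.real, ENNReal.toReal_ofReal (show 0 ≤ η / (2 * L) by positivity)]
      _ ≤ ∫ s in Set.Ioc t (t + η / (2 * L)),
            Real.exp (-(2 * s)) * ‖charFun p s - charFun q s‖ ^ 2 := by
          refine setIntegral_mono_on (integrableOn_const (by simp)) (hint.mono_set hsub)
            measurableSet_Ioc fun s hs => ?_
          -- Since `η ≤ 2`, the interval has length at most `1 / L`, so the exponential weight has a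
          -- lower bound independent of `η`.
          have h1 : s ≤ t + 1 / L := by
            refine hs.2.trans ?_
            gcongr t + ?_
            rw [div_le_div_iff₀ (by positivity) hL]
            nlinarith
          gcongr
          exact hlow s hs
      _ ≤ _ := setIntegral_mono_set hint (ae_of_all _ fun s => by positivity) hsub.eventuallyLE
  have he : Real.exp (2 * (t + 1 / L)) * Real.exp (-(2 * (t + 1 / L))) = 1 := by
    rw [← Real.exp_add]; simp
  calc η ^ 3 = 8 * L * Real.exp (2 * (t + 1 / L)) *
        (η / (2 * L) * (Real.exp (-(2 * (t + 1 / L))) * (η / 2) ^ 2)) := by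
        generalize Real.exp (2 * (t + 1 / L)) = A at he
        generalize Real.exp (-(2 * (t + 1 / L))) = B at he
        have : 8 * L * A * (η / (2 * L) * (B * (η / 2) ^ 2)) = (A * B) * η ^ 3 := by
          field_simp
          ring
        rw [this, he, one_mul]
    _ ≤ _ := by gcongr

/-- Convergence in the weighted `L²` distance of characteristic functions, together with bounded
first moments, implies weak convergence. -/
lemma tendsto_integral_of_charDist {ρ : ℕ → Measure ℝ} {ν : Measure ℝ}
    [∀ n, IsProbabilityMeasure (ρ n)] [IsProbabilityMeasure ν] {M : ℝ}
    (hρ : ∀ n, Integrable (fun x : ℝ => |x|) (ρ n)) (hM : ∀ n, ∫ x, |x| ∂(ρ n) ≤ M)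
    (hν : Integrable (fun x : ℝ => |x|) ν)
    (h : Tendsto (fun n => charDist 2 (ρ n) ν) atTop (𝓝 0)) (f : BoundedContinuousFunction ℝ ℝ) :
    Tendsto (fun n => ∫ t, f t ∂(ρ n)) atTop (𝓝 (∫ t, f t ∂ν)) := by
  have hM0 : 0 ≤ M := (integral_nonneg fun x => abs_nonneg x).trans (hM 0)
  have hν0 : 0 ≤ ∫ x, |x| ∂ν := integral_nonneg fun x => abs_nonneg x
  set L := M + ∫ x, |x| ∂ν + 1 with hL
  have hL0 : 0 < L := by positivity
  have hpos : ∀ t : ℝ, 0 ≤ t →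
      Tendsto (fun n => charFun (ρ n) t) atTop (𝓝 (charFun ν t)) := by
    intro t ht
    rw [tendsto_iff_norm_sub_tendsto_zero]
    have h3 : Tendsto (fun n => ‖charFun (ρ n) t - charFun ν t‖ ^ 3) atTop (𝓝 0) := by
      refine squeeze_zero (fun n => by positivity) (fun n =>
        norm_charFun_sub_pow_le (hρ n) hν hL0 (by linarith [hM n]) ht) ?_
      simpa using h.const_mul (8 * L * Real.exp (2 * (t + 1 / L)))
    have h4 := (h3.rpow_const (p := 1 / 3) (Or.inr (by norm_num)))
    refine (h4.congr fun n => ?_).trans (by norm_num)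
    rw [← Real.rpow_natCast, ← Real.rpow_mul (norm_nonneg _)]
    norm_num
  have hall : ∀ t : ℝ, Tendsto (fun n => charFun (ρ n) t) atTop (𝓝 (charFun ν t)) := by
    intro t
    rcases le_total 0 t with ht | ht
    · exact hpos t ht
    · have h1 := hpos (-t) (by linarith)
      have h2 := (Complex.continuous_conj.tendsto _).comp h1
      simpa [Function.comp_def, charFun_neg] using h2
  let ρ' : ℕ → ProbabilityMeasure ℝ := fun n => ⟨ρ n, inferInstance⟩
  let ν' : ProbabilityMeasure ℝ := ⟨ν, inferInstance⟩
  have h5 : Tendsto ρ' atTop (𝓝 ν') := ProbabilityMeasure.tendsto_of_tendsto_charFun hall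
  exact (ProbabilityMeasure.tendsto_iff_forall_integral_tendsto.1 h5) f

/-! ### Passage between extended and real energies -/

/-- The external field as a real function (with the junk value of the logarithm at `0`). -/
def fieldReal (δ σ x : ℝ) : ℝ := (x + σ) ^ 2 - 2 * δ * Real.log (x + σ)

@[fun_prop]
lemma measurable_fieldReal {δ σ : ℝ} : Measurable (fieldReal δ σ) := by
  unfold fieldReal
  fun_prop

lemma logInv_of_ne {r : ℝ} (hr : r ≠ 0) : logInv r = ((-Real.log r : ℝ) : EReal) := by
  rw [logInv, if_neg hr]
  simp

lemma logInv_ne_bot (r : ℝ) : logInv r ≠ ⊥ := by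
  unfold logInv
  split_ifs <;> simp

lemma logInv_eq_log (r : ℝ) : logInv r = -ENNReal.log (ENNReal.ofReal |r|) := by
  by_cases hr : r = 0
  · simp [logInv, hr]
  · rw [logInv_of_ne hr, ENNReal.log_ofReal_of_pos (abs_pos.2 hr), Real.log_abs]
    rfl

@[fun_prop]
lemma continuous_logInv : Continuous logInv := by
  simp_rw [funext logInv_eq_log]
  exact continuous_neg.comp (ENNReal.continuous_log.comp
    (ENNReal.continuous_ofReal.comp continuous_abs))

lemma logKernel_le_logInv {ε : ℝ} (r : ℝ) : ((logKernel ε r : ℝ) : EReal) ≤ logInv r := by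
  by_cases hr : r = 0
  · simp [logInv, hr]
  · rw [logInv_of_ne hr, EReal.coe_le_coe_iff, ← logKernel_zero]
    unfold logKernel
    have : Real.log (r ^ 2 + 0 ^ 2) ≤ Real.log (r ^ 2 + ε ^ 2) :=
      Real.log_le_log (by positivity) (by nlinarith [sq_nonneg ε])
    exact mul_le_mul_of_nonpos_left this (by norm_num)

lemma field_zero (σ x : ℝ) : field 0 σ x = ((fieldReal 0 σ x : ℝ) : EReal) := by
  simp [field, fieldReal]

lemma field_of_ne (δ : ℝ) {σ x : ℝ} (h : x + σ ≠ 0) :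
    field δ σ x = ((fieldReal δ σ x : ℝ) : EReal) := by
  rw [field, logInv_of_ne h, fieldReal]
  norm_cast
  ring_nf

lemma fieldReal_le_field {δ : ℝ} (hδ : 0 ≤ δ) (σ x : ℝ) :
    ((fieldReal δ σ x : ℝ) : EReal) ≤ field δ σ x := by
  by_cases h : x + σ = 0
  · rcases hδ.eq_or_lt with rfl | hδ
    · rw [field_zero]
    · have : ((2 * δ : ℝ) : EReal) * logInv (x + σ) = ⊤ := by
        rw [logInv, if_pos h]
        exact EReal.coe_mul_top_of_pos (by positivity)
      rw [field, this, EReal.coe_add_top]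
      exact le_top
  · rw [field_of_ne δ h]

lemma field_ne_bot {δ : ℝ} (hδ : 0 ≤ δ) (σ x : ℝ) : field δ σ x ≠ ⊥ :=
  fun h => EReal.coe_ne_bot _ (le_bot_iff.1 (h ▸ fieldReal_le_field hδ σ x))

lemma continuous_field {δ : ℝ} (hδ : 0 ≤ δ) (σ : ℝ) : Continuous (field δ σ) := by
  rcases hδ.eq_or_lt with rfl | hδ
  · rw [funext (field_zero σ)]
    refine continuous_coe_real_ereal.comp ?_
    unfold fieldReal
    simp only [mul_zero, zero_mul, sub_zero]
    fun_prop
  · have h2 : Continuous fun x => ((2 * δ : ℝ) : EReal) * logInv (x + σ) := by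
      refine continuous_iff_continuousAt.2 fun x => ?_
      refine EReal.Tendsto.const_mul ?_ ?_ ?_
      · exact (continuous_logInv.comp (by fun_prop)).continuousAt
      · exact Or.inl (EReal.coe_ne_bot _)
      · exact Or.inl (EReal.coe_ne_top _)
    unfold field
    refine continuous_iff_continuousAt.2 fun x => ?_
    refine Tendsto.comp (f := fun x => (_, _)) (EReal.continuousAt_add ?_ ?_)
      (ContinuousAt.prodMk (continuous_coe_real_ereal.comp (by fun_prop)).continuousAt
        h2.continuousAt)
    · exact Or.inl (EReal.coe_ne_top _)
    · exact Or.inl (EReal.coe_ne_bot _)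

lemma erealIntegral_of_ae_eq {X : Type*} [MeasurableSpace X] {m : Measure X} {f : X → EReal}
    {g : X → ℝ} (hg : Integrable g m) (h : ∀ᵐ x ∂m, f x = (g x : EReal)) :
    erealIntegral f m = ((∫ x, g x ∂m : ℝ) : EReal) := by
  have h1 : ∫⁻ x, (f x).toENNReal ∂m = ∫⁻ x, ENNReal.ofReal (g x) ∂m :=
    lintegral_congr_ae (h.mono fun x hx => by simp [hx])
  have h2 : ∫⁻ x, (-f x).toENNReal ∂m = ∫⁻ x, ENNReal.ofReal (-g x) ∂m :=
    lintegral_congr_ae (h.mono fun x hx => by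
      simp only [hx]
      rw [← EReal.coe_neg, EReal.toENNReal_of_ne_top (by simp)]
      rfl)
  have h3 : ∫⁻ x, ENNReal.ofReal (g x) ∂m ≠ ⊤ := hg.lintegral_lt_top.ne
  have h4 : ∫⁻ x, ENNReal.ofReal (-g x) ∂m ≠ ⊤ := hg.neg.lintegral_lt_top.ne
  rw [erealIntegral, h1, h2, integral_eq_lintegral_pos_part_sub_lintegral_neg_part hg,
    EReal.coe_sub, EReal.coe_ennreal_toReal h3, EReal.coe_ennreal_toReal h4]

/-- An integrable minorant suffices: `f` itself may have infinite integral, but its negative part is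
dominated by that of `g`. -/
lemma le_erealIntegral {X : Type*} [MeasurableSpace X] {m : Measure X} {f : X → EReal}
    {g : X → ℝ} (hg : Integrable g m) (h : ∀ᵐ x ∂m, (g x : EReal) ≤ f x) :
    ((∫ x, g x ∂m : ℝ) : EReal) ≤ erealIntegral f m := by
  rw [← erealIntegral_of_ae_eq hg (ae_of_all _ fun x => rfl), erealIntegral, erealIntegral]
  refine EReal.sub_le_sub ?_ ?_
  · exact EReal.coe_ennreal_le_coe_ennreal_iff.2
      (lintegral_mono_ae (h.mono fun x hx => EReal.toENNReal_le_toENNReal hx))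
  · exact EReal.coe_ennreal_le_coe_ennreal_iff.2
      (lintegral_mono_ae (h.mono fun x hx => EReal.toENNReal_le_toENNReal
        (EReal.neg_le_neg_iff.2 hx)))

/-! ### Equilibrium measures and the continuous lower bound -/

/-- The logarithmic potential of a measure. -/
def logPotential (ν : Measure ℝ) (t : ℝ) : ℝ := ∫ x, logKernel 0 (t - x) ∂ν

/-- The energy of a measure in the external field, as a real number. -/
def energyReal (α σ : ℝ) (ν : Measure ℝ) : ℝ :=
  mutualEnergy (logKernel 0) ν ν + ∫ t, fieldReal α σ t ∂ν

/-- Frostman's conditions for a measure on the half-line with a sufficiently regular density. -/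
structure IsEquilibrium (α σ : ℝ) (ν : Measure ℝ) (C : ℝ) : Prop where
  prob : IsProbabilityMeasure ν
  support : ∃ R, ν (Set.Icc 0 R)ᶜ = 0
  riesz : ∃ M : ℝ, ∀ t, ∫⁻ x, ENNReal.ofReal (|t - x| ^ (-(1 / 4) : ℝ)) ∂ν ≤ ENNReal.ofReal M
  le_potential : ∀ t, 0 ≤ t → C ≤ 2 * logPotential ν t + fieldReal α σ t
  potential_eq : ∀ᵐ t ∂ν, 2 * logPotential ν t + fieldReal α σ t = C
  density : ∃ f : ℝ → ℝ, Measurable f ∧ (∀ x, 0 ≤ f x) ∧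
    ν = volume.withDensity (fun x => ENNReal.ofReal (f x)) ∧
    Integrable (fun x => Real.log (f x)) ν

lemma logKernel_le_zero (ε : ℝ) {s : ℝ} (hs : s ≠ 0) : logKernel ε s ≤ logKernel 0 s := by
  have : Real.log (s ^ 2 + 0 ^ 2) ≤ Real.log (s ^ 2 + ε ^ 2) :=
    Real.log_le_log (by positivity) (by nlinarith [sq_nonneg ε])
  exact mul_le_mul_of_nonpos_left this (by norm_num)

/-- With `v = (ε/|s|) ^ (1/4)` the difference is `log (1 + v⁸) / 2`, and `1 + v⁸ ≤ (1 + v)⁸` gives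
the bound `4v`. The exponent `1/4` matches the Riesz condition. At `s = 0` the unsmoothed kernel
takes the default value `0`, which the extra term accounts for. -/
lemma logKernel_zero_sub_le {ε : ℝ} (hε : 0 < ε) (s : ℝ) :
    logKernel 0 s - logKernel ε s ≤ 4 * ε ^ (1 / 4 : ℝ) * |s| ^ (-(1 / 4) : ℝ) + 
      if s = 0 then |Real.log ε| else 0 := by
  by_cases hs : s = 0
  · subst hs
    simp only [logKernel, if_true]
    rw [abs_zero, Real.zero_rpow (by norm_num)]
    simp only [ne_eq, OfNat.ofNat_ne_zero, not_false_eq_true, zero_pow, add_zero, Real.log_zero,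
      mul_zero, zero_add, Real.log_pow]
    have := le_abs_self (Real.log ε)
    push_cast
    linarith
  · rw [if_neg hs, add_zero]
    set v := (ε / |s|) ^ (1 / 4 : ℝ) with hv
    have hs0 : 0 < |s| := abs_pos.2 hs
    have hv0 : 0 < v := by positivity
    have hv4 : v ^ 4 = ε / |s| := by
      rw [hv, ← Real.rpow_natCast, ← Real.rpow_mul (by positivity)]
      norm_num
    have h1 : 4 * ε ^ (1 / 4 : ℝ) * |s| ^ (-(1 / 4) : ℝ) = 4 * v := by
      rw [hv, Real.div_rpow hε.le hs0.le, Real.rpow_neg hs0.le]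
      ring
    have h2 : s ^ 2 + ε ^ 2 = |s| ^ 2 * (1 + (v ^ 4) ^ 2) := by
      rw [hv4]
      field_simp
      rw [sq_abs]
    have h3 : Real.log (1 + (v ^ 4) ^ 2) ≤ 8 * v := by
      calc Real.log (1 + (v ^ 4) ^ 2) ≤ Real.log ((1 + v) ^ 8) := by
            refine Real.log_le_log (by positivity) ?_
            have : (1 + v) ^ 8 = 1 + (v ^ 4) ^ 2 + (8 * v + 28 * v ^ 2 + 56 * v ^ 3 + 70 * v ^ 4 +
              56 * v ^ 5 + 28 * v ^ 6 + 8 * v ^ 7) := by ring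
            rw [this]
            have : 0 ≤ 8 * v + 28 * v ^ 2 + 56 * v ^ 3 + 70 * v ^ 4 +
              56 * v ^ 5 + 28 * v ^ 6 + 8 * v ^ 7 := by positivity
            linarith
        _ = 8 * Real.log (1 + v) := by rw [Real.log_pow]; norm_num
        _ ≤ 8 * v := by
            have := Real.log_le_sub_one_of_pos (show 0 < 1 + v by positivity)
            linarith
    rw [h1, logKernel, logKernel, h2, Real.log_mul (by positivity) (by positivity), sq_abs]
    simp only [ne_eq, OfNat.ofNat_ne_zero, not_false_eq_true, zero_pow, add_zero]
    linarith

lemma abs_logKernel_zero_le (s : ℝ) : |logKernel 0 s| ≤ 4 * |s| ^ (-(1 / 4) : ℝ) + |s| := by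
  rw [logKernel_zero, abs_neg, ← Real.log_abs]
  by_cases hs : s = 0
  · simp [hs]
  have hs0 : 0 < |s| := abs_pos.2 hs
  have h0 : 0 ≤ |s| ^ (-(1 / 4) : ℝ) := by positivity
  refine abs_le'.2 ⟨?_, ?_⟩
  · have := Real.log_le_sub_one_of_pos hs0
    linarith
  · have h1 := Real.log_le_rpow_div (x := |s|⁻¹) (by positivity) (ε := 1 / 4) (by norm_num)
    rw [Real.log_inv, Real.inv_rpow hs0.le, ← Real.rpow_neg hs0.le] at h1
    linarith

lemma continuousOn_fieldReal {α σ : ℝ} (hσ : 0 < σ ∨ α = 0) :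
    ContinuousOn (fieldReal α σ) (Set.Ici 0) := by
  unfold fieldReal
  rcases hσ with hσ | rfl
  · refine ContinuousOn.sub (by fun_prop) (ContinuousOn.mul (by fun_prop) ?_)
    refine ContinuousOn.log (by fun_prop) fun x hx => ?_
    have hx : 0 ≤ x := hx
    positivity
  · simp only [mul_zero, zero_mul, sub_zero]
    fun_prop

lemma integrable_of_continuousOn_compact {f : ℝ → ℝ} (hfm : Measurable f) {K : Set ℝ}
    (hK : IsCompact K) (hf : ContinuousOn f K) {ρ : Measure ℝ} [IsProbabilityMeasure ρ]
    (hρ : ρ Kᶜ = 0) : Integrable f ρ := by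
  obtain ⟨B, hB⟩ := hK.exists_bound_of_continuousOn hf
  exact Integrable.of_bound (C := B) hfm.aestronglyMeasurable
    ((show ∀ᵐ x ∂ρ, x ∈ K from hρ).mono hB)

namespace IsEquilibrium

variable {α σ C : ℝ} {ν : Measure ℝ}

lemma nullSingletonClass (h : IsEquilibrium α σ ν C) : NullSingletonClass ν := by
  obtain ⟨f, -, -, hν, -⟩ := h.density
  rw [hν]
  infer_instance

lemma ae_ne (h : IsEquilibrium α σ ν C) (t : ℝ) : ∀ᵐ x ∂ν, t - x ≠ 0 := by
  have := h.nullSingletonClass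
  filter_upwards [Measure.ae_ne ν t] with x hx
  exact sub_ne_zero.2 (Ne.symm hx)

lemma ae_prod_ne (h : IsEquilibrium α σ ν C) (ρ : Measure ℝ) [IsProbabilityMeasure ρ] :
    ∀ᵐ z ∂(ρ.prod ν), z.1 - z.2 ≠ 0 := by
  have := h.prob
  rw [Measure.ae_prod_iff_ae_ae]
  · exact ae_of_all _ fun t => h.ae_ne t
  · exact (measurableSet_eq_fun (by fun_prop) (by fun_prop)).compl

lemma riesz_bound (h : IsEquilibrium α σ ν C) : ∃ M : ℝ, 0 ≤ M ∧
    (∀ (ρ : Measure ℝ) [IsProbabilityMeasure ρ],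
      Integrable (fun z : ℝ × ℝ => |z.1 - z.2| ^ (-(1 / 4) : ℝ)) (ρ.prod ν) ∧
      ∫ z : ℝ × ℝ, |z.1 - z.2| ^ (-(1 / 4) : ℝ) ∂(ρ.prod ν) ≤ M) ∧
    (∀ t : ℝ, Integrable (fun x : ℝ => |t - x| ^ (-(1 / 4) : ℝ)) ν ∧
      ∫ x : ℝ, |t - x| ^ (-(1 / 4) : ℝ) ∂ν ≤ M) := by
  have := h.prob
  obtain ⟨M, hM⟩ := h.riesz
  have key : ∀ (ρ : Measure ℝ) [IsProbabilityMeasure ρ],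
      Integrable (fun z : ℝ × ℝ => |z.1 - z.2| ^ (-(1 / 4) : ℝ)) (ρ.prod ν) ∧
      ∫ z : ℝ × ℝ, |z.1 - z.2| ^ (-(1 / 4) : ℝ) ∂(ρ.prod ν) ≤ max M 0 := by
    intro ρ _
    have hm : Measurable fun z : ℝ × ℝ => |z.1 - z.2| ^ (-(1 / 4) : ℝ) := by fun_prop
    have h0 : ∀ z : ℝ × ℝ, 0 ≤ |z.1 - z.2| ^ (-(1 / 4) : ℝ) := fun z => by positivity
    have hl : ∫⁻ z : ℝ × ℝ, ENNReal.ofReal (|z.1 - z.2| ^ (-(1 / 4) : ℝ)) ∂(ρ.prod ν) ≤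
        ENNReal.ofReal M := by
      rw [lintegral_prod _ (by fun_prop)]
      calc _ ≤ ∫⁻ x, ENNReal.ofReal M ∂ρ := lintegral_mono fun t => hM t
        _ = _ := by simp
    refine ⟨⟨hm.aestronglyMeasurable, ?_⟩, ?_⟩
    · rw [hasFiniteIntegral_iff_ofReal (ae_of_all _ h0)]
      exact hl.trans_lt ENNReal.ofReal_lt_top
    · rw [integral_eq_lintegral_of_nonneg_ae (ae_of_all _ h0) hm.aestronglyMeasurable]
      exact ENNReal.toReal_le_of_le_ofReal (le_max_right _ _)
        (hl.trans (ENNReal.ofReal_le_ofReal (le_max_left _ _)))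
  refine ⟨max M 0, le_max_right _ _, key, fun t => ?_⟩
  -- The pointwise bound is the case of a Dirac mass in the bound for product measures.
  obtain ⟨h1, h2⟩ := key (Measure.dirac t)
  rw [Measure.dirac_prod] at h1 h2
  rw [integrable_map_measure (Measurable.aestronglyMeasurable (by fun_prop)) (by fun_prop)] at h1
  rw [integral_map (by fun_prop) (Measurable.aestronglyMeasurable (by fun_prop))] at h2
  exact ⟨h1, h2⟩

lemma integrable_logKernel_zero_prod (h : IsEquilibrium α σ ν C) {ρ : Measure ℝ}
    [IsProbabilityMeasure ρ] {K : Set ℝ} (hK : IsCompact K) (hρ : ρ Kᶜ = 0) :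
    Integrable (fun z : ℝ × ℝ => logKernel 0 (z.1 - z.2)) (ρ.prod ν) := by
  have := h.prob
  obtain ⟨M, -, hM, -⟩ := h.riesz_bound
  obtain ⟨R, hR⟩ := h.support
  have h1 : Integrable (fun z : ℝ × ℝ => |z.1 - z.2|) (ρ.prod ν) := by
    refine integrable_comp_sub continuous_abs (hK.union (isCompact_Icc (a := 0) (b := R))) ?_ ?_
    · exact measure_mono_null (Set.compl_subset_compl.2 Set.subset_union_left) hρ
    · exact measure_mono_null (Set.compl_subset_compl.2 Set.subset_union_right) hR
  refine Integrable.mono' (((hM ρ).1.const_mul 4).add h1)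
    (Measurable.aestronglyMeasurable (by fun_prop)) (ae_of_all _ fun z => ?_)
  exact abs_logKernel_zero_le _

lemma integrable_logPotential (h : IsEquilibrium α σ ν C) {ρ : Measure ℝ}
    [IsProbabilityMeasure ρ] {K : Set ℝ} (hK : IsCompact K) (hρ : ρ Kᶜ = 0) :
    Integrable (logPotential ν) ρ ∧
      ∫ t, logPotential ν t ∂ρ = mutualEnergy (logKernel 0) ρ ν := by
  have := h.prob
  have hi := h.integrable_logKernel_zero_prod hK hρ
  exact ⟨hi.integral_prod_left, (integral_prod _ hi).symm⟩

lemma support_compact (h : IsEquilibrium α σ ν C) :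
    ∃ K : Set ℝ, IsCompact K ∧ K ⊆ Set.Ici 0 ∧ ν Kᶜ = 0 := by
  obtain ⟨R, hR⟩ := h.support
  exact ⟨Set.Icc 0 R, isCompact_Icc, Set.Icc_subset_Ici_self, hR⟩

lemma integrable_log (h : IsEquilibrium α σ ν C) :
    Integrable (fun t => Real.log (t + σ)) ν := by
  have := h.prob
  obtain ⟨M, -, -, hM⟩ := h.riesz_bound
  obtain ⟨K, hK, -, hν⟩ := h.support_compact
  have h1 : Integrable (fun t => |-σ - t|) ν :=
    integrable_of_continuousOn_compact (by fun_prop) hK (by fun_prop) hν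
  refine Integrable.mono' (((hM (-σ)).1.const_mul 4).add h1)
    (Measurable.aestronglyMeasurable (by fun_prop)) (ae_of_all _ fun t => ?_)
  have h2 := abs_logKernel_zero_le (-σ - t)
  rwa [logKernel_zero, abs_neg, ← Real.log_neg_eq_log, neg_sub, sub_neg_eq_add] at h2

lemma integrable_fieldReal (h : IsEquilibrium α σ ν C) (δ : ℝ) :
    Integrable (fieldReal δ σ) ν := by
  have := h.prob
  obtain ⟨K, hK, -, hν⟩ := h.support_compact
  refine Integrable.sub ?_ (h.integrable_log.const_mul (2 * δ))
  exact integrable_of_continuousOn_compact (by fun_prop) hK (by fun_prop) hν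

/-- Integrating Frostman's equality against `ν` gives `2 I(ν) + ∫ Q dν = C`, where `I` is the
logarithmic energy. -/
lemma energyReal_eq (h : IsEquilibrium α σ ν C) :
    energyReal α σ ν = C - mutualEnergy (logKernel 0) ν ν := by
  have := h.prob
  obtain ⟨K, hK, hK0, hν⟩ := h.support_compact
  obtain ⟨h1, h2⟩ := h.integrable_logPotential hK hν
  have h3 : ∫ t, (2 * logPotential ν t + fieldReal α σ t) ∂ν = C := by
    rw [integral_congr_ae h.potential_eq]
    simp
  rw [integral_add (h1.const_mul 2) (h.integrable_fieldReal α), integral_const_mul, h2] at h3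
  rw [energyReal]
  linarith

/-- The key lower bound for the regularized energy of a measure on the half-line. -/
lemma exists_energy_lower_bound (h : IsEquilibrium α σ ν C) (hσ : 0 < σ ∨ α = 0) :
    ∃ M : ℝ, 0 ≤ M ∧ ∀ ε : ℝ, 0 < ε → ε ≤ 1 → ∀ (ρ : Measure ℝ) [IsProbabilityMeasure ρ]
      (K : Set ℝ), IsCompact K → K ⊆ Set.Ici 0 → ρ Kᶜ = 0 →
      energyReal α σ ν - M * ε ^ (1 / 4 : ℝ) + charDist 2 ρ ν ≤
        mutualEnergy (logKernel ε) ρ ρ + ∫ t, fieldReal α σ t ∂ρ := by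
  have := h.prob
  obtain ⟨M, hM0, hM, -⟩ := h.riesz_bound
  -- The cross term enters with factor `2`, and unsmoothing it costs `4 M ε ^ (1/4)`.
  refine ⟨8 * M, by positivity, fun ε hε hε1 ρ _ K hK hK0 hρ => ?_⟩
  obtain ⟨R, hR⟩ := h.support
  obtain ⟨K', hK', hρ', hν'⟩ : ∃ K' : Set ℝ, IsCompact K' ∧ ρ K'ᶜ = 0 ∧ ν K'ᶜ = 0 :=
    ⟨K ∪ Set.Icc 0 R, hK.union isCompact_Icc,
      measure_mono_null (Set.compl_subset_compl.2 Set.subset_union_left) hρ,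
      measure_mono_null (Set.compl_subset_compl.2 Set.subset_union_right) hR⟩
  have h1 := charDist_le_mutualEnergy hε hε1 hK' hρ' hν'
  have h2 : mutualEnergy (logKernel ε) ν ν ≤ mutualEnergy (logKernel 0) ν ν := by
    refine integral_mono_ae (integrable_comp_sub (continuous_logKernel hε) hK' hν' hν')
      (h.integrable_logKernel_zero_prod hK' hν') ?_
    filter_upwards [h.ae_prod_ne ν] with z hz
    exact logKernel_le_zero ε hz
  have h3 : mutualEnergy (logKernel 0) ρ ν - mutualEnergy (logKernel ε) ρ ν ≤
      4 * ε ^ (1 / 4 : ℝ) * M := by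
    have hi0 := h.integrable_logKernel_zero_prod hK' hρ'
    have hiε := integrable_comp_sub (continuous_logKernel hε) hK' hρ' hν'
    unfold mutualEnergy
    rw [← integral_sub hi0 hiε]
    calc _ ≤ ∫ z : ℝ × ℝ, 4 * ε ^ (1 / 4 : ℝ) * |z.1 - z.2| ^ (-(1 / 4) : ℝ) ∂(ρ.prod ν) := by
          refine integral_mono_ae (hi0.sub hiε) ((hM ρ).1.const_mul _) ?_
          filter_upwards [h.ae_prod_ne ρ] with z hz
          have := logKernel_zero_sub_le hε (z.1 - z.2)
          rwa [if_neg hz, add_zero] at this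
      _ ≤ _ := by
          rw [integral_const_mul]
          exact mul_le_mul_of_nonneg_left (hM ρ).2 (by positivity)
  obtain ⟨h4, h5⟩ := h.integrable_logPotential hK' hρ'
  have hf : Integrable (fieldReal α σ) ρ := integrable_of_continuousOn_compact (by fun_prop) hK
    ((continuousOn_fieldReal hσ).mono hK0) hρ
  -- Frostman's inequality is used on the whole support of `ρ`, which lies in the half-line.
  have h6 : C ≤ ∫ t, (2 * logPotential ν t + fieldReal α σ t) ∂ρ := by
    have : ∫ t, C ∂ρ ≤ ∫ t, (2 * logPotential ν t + fieldReal α σ t) ∂ρ := by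
      refine integral_mono_ae (integrable_const _) ((h4.const_mul 2).add hf) ?_
      filter_upwards [show ∀ᵐ x ∂ρ, x ∈ K from hρ] with x hx
      exact h.le_potential x (hK0 hx)
    simpa using this
  rw [integral_add (h4.const_mul 2) hf, integral_const_mul, h5] at h6
  rw [h.energyReal_eq]
  linarith

lemma energy_eq (h : IsEquilibrium α σ ν C) :
    energy α σ ν = ((energyReal α σ ν : ℝ) : EReal) := by
  have := h.prob
  have := h.nullSingletonClass
  obtain ⟨K, hK, hK0, hν⟩ := h.support_compact
  rw [energy, energyReal, EReal.coe_add]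
  congr 1
  · refine erealIntegral_of_ae_eq (h.integrable_logKernel_zero_prod hK hν) ?_
    filter_upwards [h.ae_prod_ne ν] with z hz
    rw [logInv_of_ne hz, logKernel_zero]
  · refine erealIntegral_of_ae_eq (h.integrable_fieldReal α) ?_
    filter_upwards [h.ae_ne (-σ)] with x hx
    exact field_of_ne α fun h0 => hx (by linarith)

/-- The smoothed kernel lies below `logInv`, so the smoothed lower bound applies to the true energy
at each `ε`; then `ε → 0`. -/
lemma energyReal_le_energy (h : IsEquilibrium α σ ν C) (hα : 0 ≤ α) (hσ : 0 < σ ∨ α = 0)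
    {m : Measure ℝ} (hm : m ∈ admissibleMeasures) :
    ((energyReal α σ ν : ℝ) : EReal) ≤ energy α σ m := by
  obtain ⟨hmp, K, hK, hK0, hmK⟩ := hm
  have := h.prob
  obtain ⟨M, hM0, hM⟩ := h.exists_energy_lower_bound hσ
  have key : ∀ ε : ℝ, 0 < ε → ε ≤ 1 →
      ((energyReal α σ ν - M * ε ^ (1 / 4 : ℝ) : ℝ) : EReal) ≤ energy α σ m := by
    intro ε hε hε1
    have h1 := hM ε hε hε1 m K hK hK0 hmK
    have h2 : energyReal α σ ν - M * ε ^ (1 / 4 : ℝ) ≤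
        mutualEnergy (logKernel ε) m m + ∫ t, fieldReal α σ t ∂m := by
      linarith [charDist_nonneg 2 m ν]
    refine (EReal.coe_le_coe_iff.2 h2).trans ?_
    rw [EReal.coe_add, energy]
    refine add_le_add ?_ ?_
    · exact le_erealIntegral (integrable_comp_sub (continuous_logKernel hε) hK hmK hmK)
        (ae_of_all _ fun z => logKernel_le_logInv _)
    · refine le_erealIntegral (integrable_of_continuousOn_compact (by fun_prop) hK
        ((continuousOn_fieldReal hσ).mono hK0) hmK) (ae_of_all _ fun x => ?_)
      exact fieldReal_le_field hα σ x
  have hlim : Tendsto (fun ε : ℝ => ((energyReal α σ ν - M * ε ^ (1 / 4 : ℝ) : ℝ) : EReal))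
      (𝓝[>] 0) (𝓝 ((energyReal α σ ν - M * 0 ^ (1 / 4 : ℝ) : ℝ) : EReal)) := by
    refine (continuous_coe_real_ereal.tendsto _).comp ?_
    refine Tendsto.mono_left ?_ nhdsWithin_le_nhds
    refine tendsto_const_nhds.sub (Tendsto.const_mul M ?_)
    exact (Real.continuousAt_rpow_const 0 (1 / 4 : ℝ) (Or.inr (by norm_num))).tendsto
  rw [Real.zero_rpow (by norm_num), mul_zero, sub_zero] at hlim
  refine le_of_tendsto hlim ?_
  filter_upwards [Ioc_mem_nhdsGT (show (0 : ℝ) < 1 by norm_num)] with ε hε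
  exact key ε hε.1 hε.2

lemma mem_admissibleMeasures (h : IsEquilibrium α σ ν C) : ν ∈ admissibleMeasures :=
  ⟨h.prob, h.support_compact⟩

lemma minEnergy_eq (h : IsEquilibrium α σ ν C) (hα : 0 ≤ α) (hσ : 0 < σ ∨ α = 0) :
    minEnergy α σ = ((energyReal α σ ν : ℝ) : EReal) := by
  refine le_antisymm ?_ ?_
  · rw [← h.energy_eq]
    exact iInf₂_le ν h.mem_admissibleMeasures
  · exact le_iInf₂ fun m hm => h.energyReal_le_energy hα hσ hm

end IsEquilibrium

/-! ### Discrete energy: continuity, coercivity and existence of minimizers -/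

/-- The discrete energy with the logarithmic kernel regularized at scale `ε`, as a real number. -/
def discreteReal (ε δ σ : ℝ) (n : ℕ) (x : Fin n → ℝ) : ℝ :=
  (∑ i, ∑ j ∈ Finset.univ.erase i, logKernel ε (x i - x j)) +
    ((n : ℝ) - 1) * ∑ i, fieldReal δ σ (x i)

lemma coe_discreteReal (ε δ σ : ℝ) (n : ℕ) (x : Fin n → ℝ) :
    ((discreteReal ε δ σ n x : ℝ) : EReal) =
      (∑ i, ∑ j ∈ Finset.univ.erase i, ((logKernel ε (x i - x j) : ℝ) : EReal)) +
        (((n : ℝ) - 1 : ℝ) : EReal) * ∑ i, ((fieldReal δ σ (x i) : ℝ) : EReal) := by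
  have hs : ∀ {ι : Type} (s : Finset ι) (f : ι → ℝ),
      ((∑ i ∈ s, f i : ℝ) : EReal) = ∑ i ∈ s, (f i : EReal) := fun s f =>
    map_sum (⟨⟨Real.toEReal, rfl⟩, EReal.coe_add⟩ : ℝ →+ EReal) f s
  rw [discreteReal, EReal.coe_add, EReal.coe_mul, hs, hs]
  simp_rw [hs]

lemma discreteReal_le_discreteEnergy {ε δ : ℝ} (hδ : 0 ≤ δ) (σ : ℝ) {n : ℕ} (hn : 1 ≤ n)
    (x : Fin n → ℝ) : ((discreteReal ε δ σ n x : ℝ) : EReal) ≤ discreteEnergy δ σ n x := by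
  rw [coe_discreteReal, discreteEnergy]
  refine add_le_add ?_ ?_
  · exact Finset.sum_le_sum fun i _ => Finset.sum_le_sum fun j _ => logKernel_le_logInv _
  · refine mul_le_mul_of_nonneg_left (Finset.sum_le_sum fun i _ => fieldReal_le_field hδ σ _) ?_
    have : (1 : ℝ) ≤ n := by exact_mod_cast hn
    exact_mod_cast sub_nonneg.2 this

lemma discreteEnergy_eq {δ σ : ℝ} {n : ℕ} {x : Fin n → ℝ} (hx : Function.Injective x)
    (h : ∀ i, x i + σ ≠ 0 ∨ δ = 0) :
    discreteEnergy δ σ n x = ((discreteReal 0 δ σ n x : ℝ) : EReal) := by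
  rw [coe_discreteReal, discreteEnergy]
  congr 1
  · refine Finset.sum_congr rfl fun i _ => Finset.sum_congr rfl fun j hj => ?_
    rw [logInv_of_ne, logKernel_zero]
    exact sub_ne_zero.2 fun h => (Finset.ne_of_mem_erase hj) (hx h).symm
  · congr 1
    refine Finset.sum_congr rfl fun i _ => ?_
    rcases h i with hi | rfl
    · exact field_of_ne δ hi
    · exact field_zero σ _

/-- Addition of extended reals is discontinuous only at `⊤ + ⊥`. Carrying along that no summand,
hence no partial sum, is `⊥` avoids this case. -/
lemma continuous_ereal_sum {X ι : Type*} [TopologicalSpace X] (s : Finset ι) {f : ι → X → EReal}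
    (hf : ∀ i ∈ s, Continuous (f i)) (hb : ∀ i ∈ s, ∀ x, f i x ≠ ⊥) :
    (Continuous fun x => ∑ i ∈ s, f i x) ∧ ∀ x, ∑ i ∈ s, f i x ≠ ⊥ := by
  classical
  induction s using Finset.induction_on with
  | empty => simp [continuous_const]
  | insert a s ha ih =>
    obtain ⟨h1, h2⟩ := ih (fun i hi => hf i (Finset.mem_insert_of_mem hi))
      (fun i hi => hb i (Finset.mem_insert_of_mem hi))
    have h3 := hf a (Finset.mem_insert_self a s)
    have h4 := hb a (Finset.mem_insert_self a s)
    simp_rw [Finset.sum_insert ha]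
    refine ⟨continuous_iff_continuousAt.2 fun x => ?_, fun x => ?_⟩
    · exact Tendsto.comp (f := fun x => (_, _))
        (EReal.continuousAt_add (Or.inr (h2 x)) (Or.inl (h4 x)))
        (h3.continuousAt.prodMk h1.continuousAt)
    · rw [Ne, EReal.add_eq_bot_iff, not_or]
      exact ⟨h4 x, h2 x⟩

lemma continuous_discreteEnergy {δ : ℝ} (hδ : 0 ≤ δ) (σ : ℝ) {n : ℕ} (hn : 2 ≤ n) :
    Continuous (discreteEnergy δ σ n) := by
  have hn1 : (0 : ℝ) < (n : ℝ) - 1 := by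
    have : (2 : ℝ) ≤ n := by exact_mod_cast hn
    linarith
  have hl : ∀ i j : Fin n, Continuous fun x : Fin n → ℝ => logInv (x i - x j) := fun i j =>
    continuous_logInv.comp (by fun_prop)
  have hi : ∀ i : Fin n, (Continuous fun x : Fin n → ℝ =>
      ∑ j ∈ Finset.univ.erase i, logInv (x i - x j)) ∧
      ∀ x : Fin n → ℝ, ∑ j ∈ Finset.univ.erase i, logInv (x i - x j) ≠ ⊥ := fun i =>
    continuous_ereal_sum _ (fun j _ => hl i j) fun j _ x => logInv_ne_bot _
  obtain ⟨h1, h1'⟩ := continuous_ereal_sum Finset.univ (fun i _ => (hi i).1)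
    (fun i _ => (hi i).2)
  obtain ⟨h2, h2'⟩ := continuous_ereal_sum (Finset.univ : Finset (Fin n))
    (f := fun i (x : Fin n → ℝ) => field δ σ (x i))
    (fun i _ => (continuous_field hδ σ).comp (continuous_apply i))
    (fun i _ x => field_ne_bot hδ σ _)
  have h3 : Continuous fun x : Fin n → ℝ =>
      (((n : ℝ) - 1 : ℝ) : EReal) * ∑ i, field δ σ (x i) := by
    refine continuous_iff_continuousAt.2 fun x => ?_
    exact EReal.Tendsto.const_mul h2.continuousAt (Or.inl (EReal.coe_ne_bot _))
      (Or.inl (EReal.coe_ne_top _))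
  have h3' : ∀ x : Fin n → ℝ, (((n : ℝ) - 1 : ℝ) : EReal) * ∑ i, field δ σ (x i) ≠ ⊥ := by
    intro x
    rw [EReal.mul_ne_bot]
    refine ⟨Or.inl (EReal.coe_ne_bot _), Or.inr (h2' x), Or.inl (EReal.coe_ne_top _), Or.inl ?_⟩
    exact_mod_cast hn1.le
  unfold discreteEnergy
  refine continuous_iff_continuousAt.2 fun x => ?_
  exact Tendsto.comp (f := fun x => (_, _))
    (EReal.continuousAt_add (Or.inr (h3' x)) (Or.inl (h1' x)))
    (h1.continuousAt.prodMk h3.continuousAt)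

lemma sum_erase_add (n : ℕ) (f : Fin n → ℝ) :
    ∑ i, ∑ j ∈ Finset.univ.erase i, (f i + f j) = 2 * ((n : ℝ) - 1) * ∑ i, f i := by
  have h : ∀ i : Fin n, ∑ j ∈ Finset.univ.erase i, (f i + f j) =
      ∑ j, (f i + f j) - 2 * f i := by
    intro i
    rw [← Finset.add_sum_erase Finset.univ _ (Finset.mem_univ i)]
    ring
  simp_rw [h, Finset.sum_sub_distrib, Finset.sum_add_distrib, ← Finset.mul_sum]
  simp [← Finset.mul_sum]
  ring

lemma fieldReal_ge {δ : ℝ} (hδ : 0 ≤ δ) (σ t : ℝ) :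
    3 / 4 * (t + σ) ^ 2 - 4 * δ ^ 2 ≤ fieldReal δ σ t := by
  have h1 : Real.log (t + σ) ≤ |t + σ| := by
    rw [← Real.log_abs]
    exact Real.log_le_self (abs_nonneg _)
  have h2 : 2 * δ * Real.log (t + σ) ≤ 2 * δ * |t + σ| := by gcongr
  have h3 : 2 * δ * |t + σ| ≤ (t + σ) ^ 2 / 4 + 4 * δ ^ 2 := by
    nlinarith [sq_nonneg (|t + σ| / 2 - 2 * δ), sq_abs (t + σ)]
  rw [fieldReal]
  linarith

/-- With `u_i = x_i + σ`, each pair satisfies `log |x_i - x_j| ≤ |u_i| + |u_j|` and `|u| ≤ u²/8 +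
2`. Summed over pairs, the repulsion uses up only `u²/4` of the confinement `3u²/4`. -/
lemma discreteReal_ge {δ : ℝ} (hδ : 0 ≤ δ) (σ : ℝ) {n : ℕ} (hn : 1 ≤ n) (x : Fin n → ℝ) :
    ((n : ℝ) - 1) * ∑ i, (1 / 2 * (x i + σ) ^ 2 - 4 * δ ^ 2 - 4) ≤ discreteReal 0 δ σ n x := by
  have hn1 : (0 : ℝ) ≤ (n : ℝ) - 1 := by
    have : (1 : ℝ) ≤ n := by exact_mod_cast hn
    linarith
  have h1 : -(2 * ((n : ℝ) - 1) * ∑ i, ((x i + σ) ^ 2 / 8 + 2)) ≤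
      ∑ i, ∑ j ∈ Finset.univ.erase i, logKernel 0 (x i - x j) := by
    rw [← sum_erase_add, ← Finset.sum_neg_distrib]
    refine Finset.sum_le_sum fun i _ => ?_
    rw [← Finset.sum_neg_distrib]
    refine Finset.sum_le_sum fun j _ => ?_
    rw [logKernel_zero, ← Real.log_abs]
    have h2 := Real.log_le_self (abs_nonneg (x i - x j))
    have h3 : |x i - x j| ≤ |x i + σ| + |x j + σ| := by
      have : x i - x j = (x i + σ) - (x j + σ) := by ring
      rw [this]
      exact abs_sub _ _
    nlinarith [sq_nonneg (|x i + σ| - 4), sq_nonneg (|x j + σ| - 4), sq_abs (x i + σ),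
      sq_abs (x j + σ)]
  have h4 : ((n : ℝ) - 1) * ∑ i, (3 / 4 * (x i + σ) ^ 2 - 4 * δ ^ 2) ≤
      ((n : ℝ) - 1) * ∑ i, fieldReal δ σ (x i) :=
    mul_le_mul_of_nonneg_left (Finset.sum_le_sum fun i _ => fieldReal_ge hδ σ _) hn1
  rw [discreteReal]
  refine le_trans (le_of_eq ?_) (add_le_add h1 h4)
  have h5 : ∀ i, 1 / 2 * (x i + σ) ^ 2 - 4 * δ ^ 2 - 4 =
      (3 / 4 * (x i + σ) ^ 2 - 4 * δ ^ 2) - 2 * ((x i + σ) ^ 2 / 8 + 2) := fun i => by ring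
  simp_rw [h5]
  rw [Finset.sum_sub_distrib, ← Finset.mul_sum]
  ring

lemma exists_isMinimizingConfig {δ : ℝ} (hδ : 0 ≤ δ) (σ : ℝ) {n : ℕ} (hn : 2 ≤ n) :
    ∃ x, IsMinimizingConfig δ σ n x := by
  have hn1 : (1 : ℝ) ≤ (n : ℝ) - 1 := by
    have : (2 : ℝ) ≤ n := by exact_mod_cast hn
    linarith
  -- A configuration of finite energy: distinct nonnegative points with `x_i + σ ≥ 1`.
  set x₀ : Fin n → ℝ := fun i => |σ| + 1 + (i : ℝ) with hx₀
  have h0 : x₀ ∈ orthant n := fun i => by positivity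
  have hinj : Function.Injective x₀ := by
    intro i j hij
    simp only [hx₀, add_right_inj, Nat.cast_inj] at hij
    exact Fin.ext hij
  have hne : ∀ i, x₀ i + σ ≠ 0 := by
    intro i
    have := neg_abs_le σ
    have : (0 : ℝ) ≤ (i : ℕ) := by positivity
    simp only [hx₀]
    linarith
  have hval := discreteEnergy_eq (δ := δ) hinj fun i => Or.inl (hne i)
  set r := discreteReal 0 δ σ n x₀
  have hclosed : IsClosed (orthant n) := by
    have : orthant n = ⋂ i, {x | 0 ≤ x i} := by
      ext x; simp [orthant]
    rw [this]
    exact isClosed_iInter fun i => isClosed_le continuous_const (continuous_apply i)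
  have hcoer : ∀ᶠ x in cocompact (Fin n → ℝ) ⊓ 𝓟 (orthant n),
      discreteEnergy δ σ n x₀ ≤ discreteEnergy δ σ n x := by
    refine Filter.Eventually.filter_mono inf_le_left ?_
    -- Radius beyond which the energy exceeds `r`: energy below `r` bounds every `(x_i + σ)²` by `2
    -- (|r| + n (4δ² + 4))`, and `|x_i| ≤ (x_i + σ)² + 1 + |σ|`.
    set T : ℝ := 2 * (|r| + n * (4 * δ ^ 2 + 4)) + 1 + |σ| with hT
    have hT0 : 0 ≤ T := by positivity
    filter_upwards [(tendsto_norm_cocompact_atTop (E := Fin n → ℝ)).eventually_gt_atTop T]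
      with x hx
    rw [hval]
    refine le_trans (EReal.coe_le_coe_iff.2 ?_)
      (discreteReal_le_discreteEnergy (ε := 0) hδ σ (by omega) x)
    refine le_trans ?_ (discreteReal_ge hδ σ (by omega) x)
    by_contra hlt
    push Not at hlt
    have hsum : ∑ i, (1 / 2 * (x i + σ) ^ 2 - 4 * δ ^ 2 - 4) ≤ |r| := by
      by_contra hc
      push Not at hc
      have h1 := abs_nonneg r
      have h2 := le_abs_self r
      nlinarith
    have hb : ‖x‖ ≤ T := by
      refine (pi_norm_le_iff_of_nonneg hT0).2 fun i => ?_
      have h1 : 1 / 2 * (x i + σ) ^ 2 ≤ ∑ i, 1 / 2 * (x i + σ) ^ 2 :=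
        Finset.single_le_sum (f := fun i => 1 / 2 * (x i + σ) ^ 2) (fun i _ => by positivity)
          (Finset.mem_univ i)
      have h2 : ∑ i, (1 / 2 * (x i + σ) ^ 2 - 4 * δ ^ 2 - 4) =
          ∑ i, 1 / 2 * (x i + σ) ^ 2 - n * (4 * δ ^ 2 + 4) := by
        simp only [sub_sub, Finset.sum_sub_distrib]
        simp
        ring
      have h3 : |x i + σ| ≤ (x i + σ) ^ 2 + 1 := by
        nlinarith [sq_abs (x i + σ), sq_nonneg (|x i + σ| - 1), abs_nonneg (x i + σ)]
      have h4 : |x i| ≤ |x i + σ| + |σ| := by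
        have := abs_sub (x i + σ) σ
        rwa [add_sub_cancel_right] at this
      rw [Real.norm_eq_abs]
      linarith
    linarith
  obtain ⟨x, hx, hmin⟩ := (continuous_discreteEnergy hδ σ hn).continuousOn.exists_isMinOn'
    hclosed h0 hcoer
  exact ⟨x, hx, hmin⟩

lemma IsMinimizingConfig.iInf_eq {δ σ : ℝ} {n : ℕ} {x : Fin n → ℝ}
    (h : IsMinimizingConfig δ σ n x) :
    ⨅ y ∈ orthant n, discreteEnergy δ σ n y = discreteEnergy δ σ n x :=
  le_antisymm (iInf₂_le x h.1) (le_iInf₂ fun _ hy => h.2 hy)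

/-! ### Empirical measures and the discrete lower bound -/

lemma isProbabilityMeasure_empirical {n : ℕ} (hn : 1 ≤ n) (x : Fin n → ℝ) :
    IsProbabilityMeasure (empirical n x) := by
  constructor
  have : (n : ENNReal) ≠ 0 := by
    exact_mod_cast (by omega : n ≠ 0)
  simp [empirical, ENNReal.inv_mul_cancel this (ENNReal.natCast_ne_top n)]

lemma integral_empirical {n : ℕ} (x : Fin n → ℝ) (f : ℝ → ℝ) :
    ∫ t, f t ∂(empirical n x) = (n : ℝ)⁻¹ * ∑ i, f (x i) := by
  rw [empirical, integral_smul_measure, integral_finsetSum_measure]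
  · simp
  · intro i _
    exact integrable_dirac (by simp)

lemma integrable_empirical {n : ℕ} (hn : 1 ≤ n) (x : Fin n → ℝ) (f : ℝ → ℝ) :
    Integrable f (empirical n x) := by
  refine Integrable.smul_measure ?_ ?_
  · exact integrable_finsetSum_measure.2 fun i _ => integrable_dirac (by simp)
  · simp
    omega

lemma empirical_compl {n : ℕ} (x : Fin n → ℝ) {K : Set ℝ} (h : ∀ i, x i ∈ K) :
    empirical n x Kᶜ = 0 := by
  simp only [empirical, Measure.smul_apply, Measure.finsetSum_apply, smul_eq_mul]
  rw [Finset.sum_eq_zero, mul_zero]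
  intro i _
  rw [Measure.dirac_apply]
  simp [h i]

lemma mutualEnergy_empirical {n : ℕ} (hn : 1 ≤ n) (x : Fin n → ℝ) {g : ℝ → ℝ}
    (hg : Continuous g) : mutualEnergy g (empirical n x) (empirical n x) =
      ((n : ℝ)⁻¹) ^ 2 * ∑ i, ∑ j, g (x i - x j) := by
  have := isProbabilityMeasure_empirical hn x
  have hK : empirical n x (Set.range x)ᶜ = 0 := empirical_compl x fun i => ⟨i, rfl⟩
  rw [mutualEnergy, integral_prod _ (integrable_comp_sub hg (Set.finite_range x).isCompact hK hK)]
  simp_rw [integral_empirical, Finset.mul_sum]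
  refine Finset.sum_congr rfl fun i _ => Finset.sum_congr rfl fun j _ => ?_
  ring

/-- Smoothing makes the diagonal finite: the `n` diagonal terms, each equal to `-log ε`, are added
to complete the double sum and then removed. -/
lemma discreteReal_eq_empirical {ε : ℝ} (hε : 0 < ε) (δ σ : ℝ) {n : ℕ} (hn : 1 ≤ n)
    (x : Fin n → ℝ) : discreteReal ε δ σ n x =
      (n : ℝ) ^ 2 * mutualEnergy (logKernel ε) (empirical n x) (empirical n x) +
        n * Real.log ε + n * ((n : ℝ) - 1) * ∫ t, fieldReal δ σ t ∂(empirical n x) := by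
  have hn0 : (n : ℝ) ≠ 0 := by
    exact_mod_cast (by omega : n ≠ 0)
  have h1 : ∀ i, ∑ j ∈ Finset.univ.erase i, logKernel ε (x i - x j) =
      ∑ j, logKernel ε (x i - x j) + Real.log ε := by
    intro i
    rw [← Finset.add_sum_erase Finset.univ _ (Finset.mem_univ i)]
    simp only [sub_self, logKernel]
    rw [zero_pow two_ne_zero, zero_add, Real.log_pow]
    push_cast
    ring
  rw [mutualEnergy_empirical hn x (continuous_logKernel hε), integral_empirical, discreteReal]
  simp_rw [h1, Finset.sum_add_distrib]
  simp only [Finset.sum_const, Finset.card_univ, Fintype.card_fin, nsmul_eq_mul]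
  field_simp

/-- The fields differ by `2 (δ - α) log (t + σ)`. For `σ > 0` the logarithm is bounded below on the
half-line and grows slowly. For `α = 0` the difference `δ - α` is nonnegative, so an upper bound for
the logarithm suffices and its singularity is harmless. -/
lemma exists_fieldReal_perturbation {α σ : ℝ} (hσ : 0 < σ ∨ α = 0) :
    ∃ c : ℝ, 0 ≤ c ∧ ∀ δ, 0 ≤ δ → ∀ t, 0 ≤ t →
      fieldReal α σ t - c * |δ - α| * (1 + (t + σ) ^ 2) ≤ fieldReal δ σ t := by
  have hlog : ∀ u : ℝ, Real.log u ≤ 1 + u ^ 2 := by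
    intro u
    have h1 := Real.log_le_self (abs_nonneg u)
    rw [Real.log_abs] at h1
    nlinarith [sq_abs u, sq_nonneg (|u| - 1), abs_nonneg u]
  rcases hσ with hσ | rfl
  · refine ⟨2 * (|Real.log σ| + 1), by positivity, fun δ _ t ht => ?_⟩
    have hu : |Real.log (t + σ)| ≤ (|Real.log σ| + 1) * (1 + (t + σ) ^ 2) := by
      have h0 := abs_nonneg (Real.log σ)
      refine abs_le'.2 ⟨?_, ?_⟩
      · nlinarith [hlog (t + σ), sq_nonneg (t + σ)]
      · have h1 : Real.log σ ≤ Real.log (t + σ) := Real.log_le_log hσ (by linarith)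
        nlinarith [neg_abs_le (Real.log σ), sq_nonneg (t + σ)]
    have h2 : (δ - α) * Real.log (t + σ) ≤ |δ - α| * |Real.log (t + σ)| := by
      rw [← abs_mul]
      exact le_abs_self _
    have h3 := mul_le_mul_of_nonneg_left hu (abs_nonneg (δ - α))
    rw [fieldReal, fieldReal]
    nlinarith
  · refine ⟨2, by norm_num, fun δ hδ t _ => ?_⟩
    have h1 := mul_le_mul_of_nonneg_left (hlog (t + σ)) hδ
    rw [fieldReal, fieldReal, sub_zero, abs_of_nonneg hδ]
    nlinarith

lemma neg_le_mutualEnergy_empirical {ε : ℝ} (hε : 0 < ε) (hε1 : ε ≤ 1) (σ : ℝ) {n : ℕ}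
    (hn : 1 ≤ n) (x : Fin n → ℝ) : -(2 * ∫ t, (t + σ) ^ 2 ∂(empirical n x)) ≤
      mutualEnergy (logKernel ε) (empirical n x) (empirical n x) := by
  have hn0 : (n : ℝ) ≠ 0 := by
    exact_mod_cast (by omega : n ≠ 0)
  rw [mutualEnergy_empirical hn x (continuous_logKernel hε), integral_empirical]
  have h1 : ∀ i j, -((x i + σ) ^ 2 + (x j + σ) ^ 2) ≤ logKernel ε (x i - x j) := by
    intro i j
    have h2 : Real.log ((x i - x j) ^ 2 + ε ^ 2) ≤ (x i - x j) ^ 2 := by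
      have := Real.log_le_sub_one_of_pos (show 0 < (x i - x j) ^ 2 + ε ^ 2 by positivity)
      nlinarith
    rw [logKernel]
    nlinarith [sq_nonneg ((x i + σ) + (x j + σ))]
  have h3 : ∑ i, ∑ j, -((x i + σ) ^ 2 + (x j + σ) ^ 2) ≤ ∑ i, ∑ j, logKernel ε (x i - x j) :=
    Finset.sum_le_sum fun i _ => Finset.sum_le_sum fun j _ => h1 i j
  have h4 : ∑ i, ∑ j, -((x i + σ) ^ 2 + (x j + σ) ^ 2) = -(2 * n * ∑ i, (x i + σ) ^ 2) := by
    simp_rw [Finset.sum_neg_distrib, Finset.sum_add_distrib]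
    simp [← Finset.mul_sum]
    ring
  have h5 := mul_le_mul_of_nonneg_left h3 (show 0 ≤ ((n : ℝ)⁻¹) ^ 2 by positivity)
  rw [h4] at h5
  refine le_trans (le_of_eq ?_) h5
  field_simp

/-- The error term in the lower bound for the normalized discrete energy. -/
def errorTerm (M c B d : ℝ) (n : ℕ) : ℝ :=
  M * ((n : ℝ)⁻¹) ^ (1 / 4 : ℝ) + 2 * B / ((n : ℝ) - 1) + Real.log n / ((n : ℝ) - 1) +
    c * d * (1 + B)

lemma tendsto_natCast_sub_one : Tendsto (fun n : ℕ => (n : ℝ) - 1) atTop atTop :=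
  tendsto_atTop_add_const_right _ (-1) tendsto_natCast_atTop_atTop

lemma tendsto_errorTerm (M c B : ℝ) {d : ℕ → ℝ} (hd : Tendsto d atTop (𝓝 0)) :
    Tendsto (fun n => errorTerm M c B (d n) n) atTop (𝓝 0) := by
  have h1 : Tendsto (fun n : ℕ => ((n : ℝ)⁻¹) ^ (1 / 4 : ℝ)) atTop (𝓝 0) := by
    have := (tendsto_inv_atTop_zero.comp (tendsto_natCast_atTop_atTop (R := ℝ))).rpow_const
      (p := 1 / 4) (Or.inr (by norm_num))
    simpa using this
  have h2 : Tendsto (fun n : ℕ => 2 * B / ((n : ℝ) - 1)) atTop (𝓝 0) :=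
    tendsto_const_nhds.div_atTop tendsto_natCast_sub_one
  have h3 : Tendsto (fun n : ℕ => Real.log n / ((n : ℝ) - 1)) atTop (𝓝 0) := by
    have h4 := (Real.tendsto_pow_log_div_mul_add_atTop 1 (-1) 1 one_ne_zero).comp
      (tendsto_natCast_atTop_atTop (R := ℝ))
    refine h4.congr fun n => ?_
    simp [sub_eq_add_neg]
  have h5 : Tendsto (fun n => c * d n * (1 + B)) atTop (𝓝 0) := by
    simpa using (hd.const_mul c).mul_const (1 + B)
  simpa [errorTerm] using ((h1.const_mul M).add h2 |>.add h3).add h5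

/-- The scale `ε = 1/n` balances the errors: smoothing costs `n ^ (-1/4)` and the diagonal costs
`log n / (n - 1)`, both vanishing. The moment bound controls the remaining two terms of `errorTerm`.
-/
lemma IsEquilibrium.exists_discreteReal_ge {α σ C : ℝ} {ν : Measure ℝ}
    (h : IsEquilibrium α σ ν C) (hσ : 0 < σ ∨ α = 0) :
    ∃ M c : ℝ, ∀ δ, 0 ≤ δ → ∀ B : ℝ, 0 ≤ B → ∀ (n : ℕ), 2 ≤ n → ∀ x ∈ orthant n,
      ∫ t, (t + σ) ^ 2 ∂(empirical n x) ≤ B →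
      (n : ℝ) * ((n : ℝ) - 1) * (energyReal α σ ν + charDist 2 (empirical n x) ν -
        errorTerm M c B |δ - α| n) ≤ discreteReal (n : ℝ)⁻¹ δ σ n x := by
  obtain ⟨M, hM0, hM⟩ := h.exists_energy_lower_bound hσ
  obtain ⟨c, hc0, hc⟩ := exists_fieldReal_perturbation hσ
  refine ⟨M, c, fun δ hδ B hB n hn x hx hxB => ?_⟩
  have hn2 : (2 : ℝ) ≤ n := by exact_mod_cast hn
  have hn0 : (0 : ℝ) < n := by linarith
  have hn1 : (0 : ℝ) < (n : ℝ) - 1 := by linarith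
  have hε : 0 < (n : ℝ)⁻¹ := by positivity
  have hε1 : (n : ℝ)⁻¹ ≤ 1 := inv_le_one_of_one_le₀ (by linarith)
  have := isProbabilityMeasure_empirical (by omega) x
  have h1 := hM _ hε hε1 (empirical n x) (Set.range x) (Set.finite_range x).isCompact
    (by rintro _ ⟨i, rfl⟩; exact hx i) (empirical_compl x fun i => ⟨i, rfl⟩)
  have h2 := neg_le_mutualEnergy_empirical hε hε1 σ (by omega) x
  have h3 : ∫ t, fieldReal α σ t ∂(empirical n x) - c * |δ - α| * (1 + B) ≤
      ∫ t, fieldReal δ σ t ∂(empirical n x) := by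
    have hi := fun f => integrable_empirical (n := n) (by omega) x f
    have h4 : ∫ t, (fieldReal α σ t - c * |δ - α| * (1 + (t + σ) ^ 2)) ∂(empirical n x) ≤
        ∫ t, fieldReal δ σ t ∂(empirical n x) := by
      rw [integral_empirical, integral_empirical]
      exact mul_le_mul_of_nonneg_left (Finset.sum_le_sum fun i _ => hc δ hδ _ (hx i))
        (by positivity)
    rw [integral_sub (hi _) (hi _), integral_const_mul, integral_add (hi _) (hi _)] at h4
    simp only [integral_const, probReal_univ, smul_eq_mul, mul_one] at h4
    have h5 : c * |δ - α| * (1 + ∫ t, (t + σ) ^ 2 ∂(empirical n x)) ≤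
        c * |δ - α| * (1 + B) := by gcongr
    linarith
  rw [discreteReal_eq_empirical hε δ σ (by omega) x]
  set V := mutualEnergy (logKernel (n : ℝ)⁻¹) (empirical n x) (empirical n x)
  set F := ∫ t, fieldReal δ σ t ∂(empirical n x)
  set G := ∫ t, fieldReal α σ t ∂(empirical n x)
  -- The interaction carries `n²` and the field `n(n-1)`. The mismatch is `V / (n - 1)`, which needs
  -- a lower bound since `V` may be negative.
  have h6 : (n : ℝ) ^ 2 * V + n * Real.log (n : ℝ)⁻¹ + n * ((n : ℝ) - 1) * F =
      n * ((n : ℝ) - 1) * (V + F + V / ((n : ℝ) - 1) - Real.log n / ((n : ℝ) - 1)) := by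
    rw [Real.log_inv]
    field_simp
    ring
  rw [h6]
  refine mul_le_mul_of_nonneg_left ?_ (by positivity)
  have h7 : -(2 * B / ((n : ℝ) - 1)) ≤ V / ((n : ℝ) - 1) := by
    rw [← neg_div]
    exact (div_le_div_iff_of_pos_right hn1).2 (by linarith)
  rw [errorTerm]
  linarith

/-! ### Random configurations, the discrete upper bound and convergence of minimizers -/

lemma map_pair_pi {n : ℕ} (ν : Measure ℝ) [IsProbabilityMeasure ν] {i j : Fin n} (hij : i ≠ j) :
    MeasurePreserving (fun x : Fin n → ℝ => (x i, x j)) (Measure.pi fun _ => ν) (ν.prod ν) := by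
  refine ⟨by fun_prop, ?_⟩
  have h1 := ProbabilityTheory.iIndepFun_pi (μ := fun _ : Fin n => ν) (X := fun _ => id)
    (fun _ => aemeasurable_id)
  have h2 := (ProbabilityTheory.indepFun_iff_map_prod_eq_prod_map_map
    (f := fun x : Fin n → ℝ => x i) (g := fun x : Fin n → ℝ => x j)
    (measurable_pi_apply i).aemeasurable (measurable_pi_apply j).aemeasurable).1
    (h1.indepFun hij)
  rw [h2]
  congr 1
  · exact (measurePreserving_eval (fun _ : Fin n => ν) i).map_eq
  · exact (measurePreserving_eval (fun _ : Fin n => ν) j).map_eq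

lemma integrable_comp_eval {n : ℕ} {ν : Measure ℝ} [IsProbabilityMeasure ν] {f : ℝ → ℝ}
    (hf : Integrable f ν) (i : Fin n) :
    Integrable (fun x : Fin n → ℝ => f (x i)) (Measure.pi fun _ => ν) ∧
      ∫ x, f (x i) ∂(Measure.pi fun _ : Fin n => ν) = ∫ t, f t ∂ν := by
  have h := measurePreserving_eval (fun _ : Fin n => ν) i
  refine ⟨h.integrable_comp_of_integrable hf, ?_⟩
  conv_rhs => rw [← h.map_eq]
  rw [integral_map h.measurable.aemeasurable]
  rw [h.map_eq]
  exact hf.aestronglyMeasurable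

lemma integrable_comp_pair {n : ℕ} {ν : Measure ℝ} [IsProbabilityMeasure ν] {g : ℝ × ℝ → ℝ}
    (hg : Integrable g (ν.prod ν)) {i j : Fin n} (hij : i ≠ j) :
    Integrable (fun x : Fin n → ℝ => g (x i, x j)) (Measure.pi fun _ => ν) ∧
      ∫ x, g (x i, x j) ∂(Measure.pi fun _ : Fin n => ν) = ∫ z, g z ∂(ν.prod ν) := by
  have h := map_pair_pi ν hij
  refine ⟨h.integrable_comp_of_integrable hg, ?_⟩
  conv_rhs => rw [← h.map_eq]
  rw [integral_map h.measurable.aemeasurable]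
  rw [h.map_eq]
  exact hg.aestronglyMeasurable

namespace IsEquilibrium

variable {α σ C : ℝ} {ν : Measure ℝ}

lemma integral_fieldReal (h : IsEquilibrium α σ ν C) (δ : ℝ) :
    ∫ t, fieldReal δ σ t ∂ν = ∫ t, fieldReal α σ t ∂ν -
      2 * (δ - α) * ∫ t, Real.log (t + σ) ∂ν := by
  rw [← integral_const_mul, ← integral_sub (h.integrable_fieldReal α)
    (h.integrable_log.const_mul _)]
  refine integral_congr_ae (ae_of_all _ fun t => ?_)
  simp only [fieldReal]
  ring

/-- Under the product measure each of the `n(n-1)` ordered pairs has law `ν × ν`, so the mean of the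
discrete energy has no diagonal error. -/
lemma integral_discreteReal (h : IsEquilibrium α σ ν C) (δ : ℝ) (n : ℕ) :
    Integrable (discreteReal 0 δ σ n) (Measure.pi fun _ => ν) ∧
      ∫ x, discreteReal 0 δ σ n x ∂(Measure.pi fun _ : Fin n => ν) =
        n * ((n : ℝ) - 1) * (mutualEnergy (logKernel 0) ν ν + ∫ t, fieldReal δ σ t ∂ν) := by
  have := h.prob
  obtain ⟨K, hK, -, hν⟩ := h.support_compact
  have hi := h.integrable_logKernel_zero_prod hK hν
  have hp : ∀ i, ∀ j ∈ Finset.univ.erase i,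
      Integrable (fun x : Fin n → ℝ => logKernel 0 (x i - x j)) (Measure.pi fun _ => ν) ∧
      ∫ x, logKernel 0 (x i - x j) ∂(Measure.pi fun _ : Fin n => ν) =
        mutualEnergy (logKernel 0) ν ν := fun i j hj =>
    integrable_comp_pair hi (Finset.ne_of_mem_erase hj).symm
  have hf := fun i : Fin n => integrable_comp_eval (h.integrable_fieldReal δ) i
  have h1 : Integrable (fun x : Fin n → ℝ => ∑ i, ∑ j ∈ Finset.univ.erase i,
      logKernel 0 (x i - x j)) (Measure.pi fun _ => ν) :=
    integrable_finsetSum _ fun i _ => integrable_finsetSum _ fun j hj => (hp i j hj).1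
  have h2 : Integrable (fun x : Fin n → ℝ => ((n : ℝ) - 1) * ∑ i, fieldReal δ σ (x i))
      (Measure.pi fun _ => ν) :=
    (integrable_finsetSum _ fun i _ => (hf i).1).const_mul _
  refine ⟨h1.add h2, ?_⟩
  unfold discreteReal
  rw [integral_add h1 h2, integral_const_mul, integral_finsetSum _ fun i _ => (hf i).1,
    integral_finsetSum _ fun i _ => integrable_finsetSum _ fun j hj => (hp i j hj).1]
  have h3 : ∀ i, ∫ x, ∑ j ∈ Finset.univ.erase i, logKernel 0 (x i - x j)
      ∂(Measure.pi fun _ : Fin n => ν) = ((n : ℝ) - 1) * mutualEnergy (logKernel 0) ν ν := by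
    intro i
    rw [integral_finsetSum _ fun j hj => (hp i j hj).1, Finset.sum_congr rfl fun j hj =>
      (hp i j hj).2]
    have : 1 ≤ n := by have := i.2; omega
    simp [Finset.card_erase_of_mem, Nat.cast_sub this]
  simp_rw [h3, fun i => (hf i).2]
  simp
  ring

lemma ae_pi (h : IsEquilibrium α σ ν C) (n : ℕ) :
    ∀ᵐ x ∂(Measure.pi fun _ : Fin n => ν),
      x ∈ orthant n ∧ Function.Injective x ∧ ∀ i, x i + σ ≠ 0 := by
  have := h.prob
  obtain ⟨K, hK, hK0, hν⟩ := h.support_compact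
  have h1 : ∀ᵐ x ∂(Measure.pi fun _ : Fin n => ν), ∀ i, x i ∈ K ∧ x i + σ ≠ 0 := by
    rw [ae_all_iff]
    intro i
    refine (measurePreserving_eval (fun _ : Fin n => ν) i).quasiMeasurePreserving.ae
      (p := fun t => t ∈ K ∧ t + σ ≠ 0) ?_
    filter_upwards [show ∀ᵐ x ∂ν, x ∈ K from hν, h.ae_ne (-σ)] with t ht ht2
    exact ⟨ht, fun h0 => ht2 (by linarith)⟩
  have h2 : ∀ᵐ x ∂(Measure.pi fun _ : Fin n => ν), ∀ i j, i ≠ j → x i - x j ≠ 0 := by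
    simp_rw [ae_all_iff]
    intro i j hij
    exact (map_pair_pi ν hij).quasiMeasurePreserving.ae (h.ae_prod_ne ν)
  filter_upwards [h1, h2] with x hx1 hx2
  refine ⟨fun i => hK0 (hx1 i).1, fun i j hij => ?_, fun i => (hx1 i).2⟩
  by_contra hne
  exact hx2 i j hne (sub_eq_zero.2 hij)

lemma iInf_discreteEnergy_le (h : IsEquilibrium α σ ν C) (δ : ℝ) (n : ℕ) :
    ⨅ x ∈ orthant n, discreteEnergy δ σ n x ≤ ((n * ((n : ℝ) - 1) *
      (energyReal α σ ν - 2 * (δ - α) * ∫ t, Real.log (t + σ) ∂ν) : ℝ) : EReal) := by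
  have := h.prob
  obtain ⟨h1, h2⟩ := h.integral_discreteReal δ n
  -- Some configuration does no worse than the mean, and it can be chosen outside the null set where
  -- points collide or leave the half-line.
  obtain ⟨x, hx, hle⟩ := exists_notMem_null_le_integral h1 (ae_iff.1 (h.ae_pi n))
  simp only [Set.mem_ofPred_eq, not_not] at hx
  refine (iInf₂_le x hx.1).trans ?_
  rw [discreteEnergy_eq hx.2.1 fun i => Or.inl (hx.2.2 i), EReal.coe_le_coe_iff]
  refine hle.trans (le_of_eq ?_)
  rw [h2, h.integral_fieldReal, energyReal]
  ring

end IsEquilibrium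

lemma IsMinimizingConfig.moment_le {δ σ E : ℝ} (hδ : 0 ≤ δ) {n : ℕ} (hn : 2 ≤ n)
    {x : Fin n → ℝ} (hx : discreteEnergy δ σ n x ≤ ((n * ((n : ℝ) - 1) * E : ℝ) : EReal)) :
    ∫ t, (t + σ) ^ 2 ∂(empirical n x) ≤ 2 * (E + 4 * δ ^ 2 + 4) := by
  have hn2 : (2 : ℝ) ≤ n := by exact_mod_cast hn
  have h1 := (discreteReal_le_discreteEnergy (ε := 0) hδ σ (by omega) x).trans hx
  rw [EReal.coe_le_coe_iff] at h1
  have h2 := (discreteReal_ge hδ σ (by omega) x).trans h1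
  have h3 : ∑ i, (1 / 2 * (x i + σ) ^ 2 - 4 * δ ^ 2 - 4) =
      1 / 2 * ∑ i, (x i + σ) ^ 2 - n * (4 * δ ^ 2 + 4) := by
    simp only [sub_sub, Finset.sum_sub_distrib, Finset.mul_sum]
    simp
    ring
  rw [h3] at h2
  have h4 : 1 / 2 * ∑ i, (x i + σ) ^ 2 - n * (4 * δ ^ 2 + 4) ≤ n * E := by
    refine le_of_mul_le_mul_left ?_ (show 0 < (n : ℝ) - 1 by linarith)
    linarith
  rw [integral_empirical, inv_mul_le_iff₀ (by linarith)]
  linarith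

/-- Two-sided bounds for minimizers of the discrete energy. -/
lemma IsEquilibrium.exists_tau_bounds {α σ C : ℝ} {ν : Measure ℝ}
    (h : IsEquilibrium α σ ν C) (hσ : 0 < σ ∨ α = 0) {δ : ℕ → ℝ} (hδ : ∀ n, 0 ≤ δ n)
    (hlim : Tendsto δ atTop (𝓝 α)) :
    ∃ (B : ℝ) (err : ℕ → ℝ), 0 ≤ B ∧ Tendsto err atTop (𝓝 0) ∧
      ∀ n, 2 ≤ n → ∀ x, IsMinimizingConfig (δ n) σ n x →
        ∫ t, (t + σ) ^ 2 ∂(empirical n x) ≤ B ∧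
        (((energyReal α σ ν + charDist 2 (empirical n x) ν - err n : ℝ) : EReal) ≤
          tau (δ n) σ n) ∧
        tau (δ n) σ n ≤ ((energyReal α σ ν + err n : ℝ) : EReal) := by
  obtain ⟨D, hD⟩ := hlim.bddAbove_range
  have hD : ∀ n, δ n ≤ D := fun n => hD ⟨n, rfl⟩
  have hD0 : 0 ≤ D := (hδ 0).trans (hD 0)
  obtain ⟨M, c, hM⟩ := h.exists_discreteReal_ge hσ
  set L := ∫ t, Real.log (t + σ) ∂ν
  -- The moment bound of `moment_le`, made uniform in `n` through `δ n ≤ D`.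
  set B := 2 * (|energyReal α σ ν| + 2 * (D + |α|) * |L| + 4 * D ^ 2 + 4) with hB
  have hB0 : 0 ≤ B := by positivity
  have hd : Tendsto (fun n => |δ n - α|) atTop (𝓝 0) := by
    simpa using (hlim.sub_const α).abs
  have herr0 : Tendsto (fun n => |errorTerm M c B |δ n - α| n| + 2 * |δ n - α| * |L|) atTop
      (𝓝 0) := by
    simpa using (tendsto_errorTerm M c B hd).abs.add ((hd.const_mul 2).mul_const |L|)
  refine ⟨B, _, hB0, herr0, fun n hn x hx => ?_⟩
  have hn2 : (2 : ℝ) ≤ n := by exact_mod_cast hn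
  have hn1 : (0 : ℝ) < (n : ℝ) - 1 := by linarith
  have hn0 : (0 : ℝ) < n := by linarith
  have hup := h.iInf_discreteEnergy_le (δ n) n
  have hdL : -(2 * (δ n - α) * L) ≤ 2 * |δ n - α| * |L| := by
    have : 2 * |δ n - α| * |L| = |2 * (δ n - α) * L| := by
      rw [abs_mul, abs_mul, abs_two]
    rw [this]
    exact neg_le_abs _
  have hmom : ∫ t, (t + σ) ^ 2 ∂(empirical n x) ≤ B := by
    rw [hx.iInf_eq] at hup
    refine (IsMinimizingConfig.moment_le (hδ n) hn hup).trans ?_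
    have h1 : |δ n - α| ≤ D + |α| := by
      refine (abs_sub _ _).trans ?_
      rw [abs_of_nonneg (hδ n)]
      linarith [hD n]
    have h2 : 2 * |δ n - α| * |L| ≤ 2 * (D + |α|) * |L| := by gcongr
    have h3 : (δ n) ^ 2 ≤ D ^ 2 := pow_le_pow_left₀ (hδ n) (hD n) 2
    have h4 := le_abs_self (energyReal α σ ν)
    rw [hB]
    linarith
  have hcnn : (0 : EReal) ≤ ((1 / ((n : ℝ) * ((n : ℝ) - 1)) : ℝ) : EReal) := by
    exact_mod_cast (by positivity : 0 ≤ 1 / ((n : ℝ) * ((n : ℝ) - 1)))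
  have hcancel : ∀ r : ℝ, 1 / ((n : ℝ) * ((n : ℝ) - 1)) * (n * ((n : ℝ) - 1) * r) = r := by
    intro r
    field_simp
  refine ⟨hmom, ?_, ?_⟩
  · have h1 := hM (δ n) (hδ n) B hB0 n hn x hx.1 hmom
    have h2 := (EReal.coe_le_coe_iff.2 h1).trans
      (discreteReal_le_discreteEnergy (hδ n) σ (by omega) x)
    have h3 := mul_le_mul_of_nonneg_left h2 hcnn
    rw [← EReal.coe_mul, hcancel, ← hx.iInf_eq] at h3
    refine le_trans (EReal.coe_le_coe_iff.2 ?_) h3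
    have h4 := le_abs_self (errorTerm M c B |δ n - α| n)
    have h5 : 0 ≤ 2 * |δ n - α| * |L| := by positivity
    linarith
  · have h3 := mul_le_mul_of_nonneg_left hup hcnn
    rw [← EReal.coe_mul, hcancel] at h3
    refine h3.trans (EReal.coe_le_coe_iff.2 ?_)
    have h4 := abs_nonneg (errorTerm M c B |δ n - α| n)
    linarith

lemma IsEquilibrium.tendsto_tau {α σ C : ℝ} {ν : Measure ℝ}
    (h : IsEquilibrium α σ ν C) (hσ : 0 < σ ∨ α = 0) {δ : ℕ → ℝ} (hδ : ∀ n, 0 ≤ δ n)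
    (hlim : Tendsto δ atTop (𝓝 α)) :
    Tendsto (fun n => tau (δ n) σ n) atTop (𝓝 ((energyReal α σ ν : ℝ) : EReal)) := by
  obtain ⟨B, err, -, herr, hb⟩ := h.exists_tau_bounds hσ hδ hlim
  have hc := continuous_coe_real_ereal.tendsto (energyReal α σ ν)
  have h1 : Tendsto (fun n => ((energyReal α σ ν - err n : ℝ) : EReal)) atTop
      (𝓝 ((energyReal α σ ν : ℝ) : EReal)) :=
    hc.comp (by simpa using herr.const_sub (energyReal α σ ν))
  have h2 : Tendsto (fun n => ((energyReal α σ ν + err n : ℝ) : EReal)) atTop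
      (𝓝 ((energyReal α σ ν : ℝ) : EReal)) :=
    hc.comp (by simpa using herr.const_add (energyReal α σ ν))
  refine tendsto_of_tendsto_of_tendsto_of_le_of_le' h1 h2 ?_ ?_
  · filter_upwards [eventually_ge_atTop 2] with n hn
    obtain ⟨x, hx⟩ := exists_isMinimizingConfig (hδ n) σ hn
    refine le_trans (EReal.coe_le_coe_iff.2 ?_) (hb n hn x hx).2.1
    linarith [charDist_nonneg 2 (empirical n x) ν]
  · filter_upwards [eventually_ge_atTop 2] with n hn
    obtain ⟨x, hx⟩ := exists_isMinimizingConfig (hδ n) σ hn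
    exact (hb n hn x hx).2.2

lemma IsEquilibrium.tendsto_integral_empirical {α σ C : ℝ} {ν : Measure ℝ}
    (h : IsEquilibrium α σ ν C) (hσ : 0 < σ ∨ α = 0) {δ : ℕ → ℝ} (hδ : ∀ n, 0 ≤ δ n)
    (hlim : Tendsto δ atTop (𝓝 α)) (x : (n : ℕ) → Fin n → ℝ)
    (hx : ∀ n, 2 ≤ n → IsMinimizingConfig (δ n) σ n (x n)) (f : BoundedContinuousFunction ℝ ℝ) :
    Tendsto (fun n => ∫ t, f t ∂(empirical n (x n))) atTop (𝓝 (∫ t, f t ∂ν)) := by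
  obtain ⟨B, err, hB0, herr, hb⟩ := h.exists_tau_bounds hσ hδ hlim
  have := h.prob
  -- The shift discards `n < 2`, where no minimality is assumed and the empirical measure for `n =
  -- 0` is not a probability.
  rw [← tendsto_add_atTop_iff_nat 2]
  have hp : ∀ n, IsProbabilityMeasure (empirical (n + 2) (x (n + 2))) := fun n =>
    isProbabilityMeasure_empirical (by omega) _
  refine tendsto_integral_of_charDist (M := B + 1 + |σ|)
    (ρ := fun n => empirical (n + 2) (x (n + 2)))
    (fun n => integrable_empirical (by omega) _ _) (fun n => ?_) ?_ ?_ f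
  · have h1 := (hb (n + 2) (by omega) _ (hx _ (by omega))).1
    have h2 : ∫ t, |t| ∂(empirical (n + 2) (x (n + 2))) ≤
        ∫ t, ((t + σ) ^ 2 + (1 + |σ|)) ∂(empirical (n + 2) (x (n + 2))) := by
      refine integral_mono (integrable_empirical (by omega) _ _)
        (integrable_empirical (by omega) _ _) fun t => ?_
      have h3 := abs_sub (t + σ) σ
      rw [add_sub_cancel_right] at h3
      simp only
      nlinarith [sq_abs (t + σ), sq_nonneg (|t + σ| - 1), abs_nonneg (t + σ)]
    rw [integral_add (integrable_empirical (by omega) _ _)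
      (integrable_empirical (by omega) _ _)] at h2
    simp only [integral_const, probReal_univ, smul_eq_mul, one_mul] at h2
    linarith
  · obtain ⟨K, hK, -, hν⟩ := h.support_compact
    exact integrable_of_continuousOn_compact (by fun_prop) hK (by fun_prop) hν
  · have h3 : Tendsto (fun n => 2 * err (n + 2)) atTop (𝓝 0) := by
      simpa using ((tendsto_add_atTop_iff_nat 2).2 herr).const_mul 2
    -- Both bounds concern the same `tau`, so the gain `charDist` is at most `2 err`.
    refine squeeze_zero (fun n => charDist_nonneg _ _ _) (fun n => ?_) h3
    obtain ⟨-, h4, h5⟩ := hb (n + 2) (by omega) _ (hx _ (by omega))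
    have h6 := EReal.coe_le_coe_iff.1 (h4.trans h5)
    linarith

/-! ### Asymptotics of the partition function -/

lemma sum_erase_eq_two_mul_sum_Ioi (n : ℕ) (F : Fin n → Fin n → ℝ) (hF : ∀ i j, F i j = F j i) :
    ∑ i, ∑ j ∈ Finset.univ.erase i, F i j = 2 * ∑ i, ∑ j ∈ Finset.Ioi i, F i j := by
  have h1 : ∀ i : Fin n, Finset.univ.erase i = Finset.Iio i ∪ Finset.Ioi i := by
    intro i
    ext j
    simp
  have h2 : ∀ i : Fin n, Disjoint (Finset.Iio i) (Finset.Ioi i) := by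
    intro i
    rw [Finset.disjoint_left]
    intro j h1 h2
    simp only [Finset.mem_Iio, Finset.mem_Ioi] at h1 h2
    exact absurd h1 (not_lt_of_gt h2)
  simp_rw [h1, Finset.sum_union (h2 _), Finset.sum_add_distrib]
  have h3 : ∑ i, ∑ j ∈ Finset.Iio i, F i j = ∑ j, ∑ i ∈ Finset.Ioi j, F i j :=
    Finset.sum_comm' (by simp)
  rw [h3, two_mul]
  congr 1
  exact Finset.sum_congr rfl fun i _ => Finset.sum_congr rfl fun j _ => hF j i

/-- The integrand of the partition function. -/
def partitionIntegrand (β σ M : ℝ) (n : ℕ) (x : Fin n → ℝ) : ℝ :=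
  (∏ i, |x i + σ| ^ (β * M)) * Real.exp (-((n : ℝ) * (β / 2) * ∑ i, (x i + σ) ^ 2)) *
    |vandermonde n x| ^ β

lemma vandermonde_ne_zero_iff {n : ℕ} {x : Fin n → ℝ} :
    vandermonde n x ≠ 0 ↔ Function.Injective x := by
  simp only [vandermonde, Finset.prod_ne_zero_iff, Finset.mem_Ioi, Finset.mem_univ, true_imp_iff,
    sub_ne_zero]
  constructor
  · intro h i j hij
    by_contra hne
    rcases lt_or_gt_of_ne hne with hlt | hlt
    · exact h i j hlt hij
    · exact h j i hlt hij.symm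
  · exact fun h i j hij hx => hij.ne (h hx)

/-- The Gaussian weight carries `n` copies of the field whereas `discreteReal` contains `n - 1`; the
spare copy is the additional sum, which later provides integrability. -/
lemma partitionIntegrand_eq_exp {β σ δ : ℝ} {n : ℕ} {x : Fin n → ℝ}
    (hx : Function.Injective x) (h : ∀ i, x i + σ ≠ 0 ∨ δ = 0) :
    partitionIntegrand β σ (n * δ) n x =
      Real.exp (-(β / 2) * (discreteReal 0 δ σ n x + ∑ i, fieldReal δ σ (x i))) := by
  have hV := vandermonde_ne_zero_iff.2 hx
  have h1 : ∏ i, |x i + σ| ^ (β * (n * δ)) =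
      Real.exp (∑ i, β * (n * δ) * Real.log (x i + σ)) := by
    rw [Real.exp_sum]
    refine Finset.prod_congr rfl fun i _ => ?_
    rcases h i with hi | rfl
    · rw [Real.rpow_def_of_pos (abs_pos.2 hi), Real.log_abs, mul_comm]
    · simp
  have h2 : |vandermonde n x| ^ β =
      Real.exp (β * ∑ i, ∑ j ∈ Finset.Ioi i, Real.log (x i - x j)) := by
    rw [Real.rpow_def_of_pos (abs_pos.2 hV), Real.log_abs, vandermonde, mul_comm β,
      Real.log_prod]
    · congr 2
      refine Finset.sum_congr rfl fun i _ => ?_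
      rw [Real.log_prod]
      intro j hj
      exact sub_ne_zero.2 fun h => (Finset.mem_Ioi.1 hj).ne (hx h)
    · intro i _
      exact Finset.prod_ne_zero_iff.2 fun j hj =>
        sub_ne_zero.2 fun h => (Finset.mem_Ioi.1 hj).ne (hx h)
  have h3 := sum_erase_eq_two_mul_sum_Ioi n (fun i j => logKernel 0 (x i - x j)) fun i j => by
    rw [logKernel_zero, logKernel_zero, ← neg_sub, Real.log_neg_eq_log]
  rw [partitionIntegrand, h1, h2, discreteReal, h3, ← Real.exp_add, ← Real.exp_add]
  congr 1
  simp_rw [logKernel_zero, fieldReal, Finset.sum_sub_distrib, Finset.sum_neg_distrib,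
    ← Finset.mul_sum]
  ring

lemma partitionIntegrand_eq_zero_or {β σ δ : ℝ} (hβ : 0 < β) {n : ℕ} (hn : 1 ≤ n)
    (x : Fin n → ℝ) : partitionIntegrand β σ (n * δ) n x = 0 ∨
      (Function.Injective x ∧ ∀ i, x i + σ ≠ 0 ∨ δ = 0) := by
  by_contra hc
  push Not at hc
  obtain ⟨h1, h2⟩ := hc
  have hV : Function.Injective x := by
    refine vandermonde_ne_zero_iff.1 fun h => h1 ?_
    rw [partitionIntegrand, h, abs_zero, Real.zero_rpow hβ.ne', mul_zero]
  obtain ⟨i, hi, hδ⟩ := h2 hV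
  refine h1 ?_
  rw [partitionIntegrand, Finset.prod_eq_zero (Finset.mem_univ i), zero_mul, zero_mul]
  rw [hi, abs_zero, Real.zero_rpow]
  have : (n : ℝ) ≠ 0 := by exact_mod_cast (by omega : n ≠ 0)
  positivity

lemma orthant_eq_pi (n : ℕ) : orthant n = Set.univ.pi fun _ : Fin n => Set.Ici (0 : ℝ) := by
  ext x
  simp [orthant, Pi.le_def]

lemma partitionFunction_le {β σ δ D r : ℝ} (hβ : 0 < β) (hδ : 0 ≤ δ) (hδD : δ ≤ D) {n : ℕ}
    (hn : 1 ≤ n) (hr : ∀ x ∈ orthant n, (r : EReal) ≤ discreteEnergy δ σ n x) :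
    partitionFunction β σ (n * δ) n ≤ ENNReal.ofReal (Real.exp (-(β / 2) * r) *
      (∫ t in Set.Ici (0 : ℝ), Real.exp (2 * β * D ^ 2) *
        Real.exp (-(3 / 8 * β) * (t + σ) ^ 2)) ^ n) := by
  -- The exponents are `β/2` times the bound `Q ≥ 3u²/4 - 4δ²` with `u = t + σ`, where `δ ≤ D`.
  set h : ℝ → ℝ := fun t => Real.exp (2 * β * D ^ 2) * Real.exp (-(3 / 8 * β) * (t + σ) ^ 2)
    with hh
  have hint : Integrable h (volume.restrict (Set.Ici 0)) := by
    have h1 := (integrable_exp_neg_mul_sq (show 0 < 3 / 8 * β by positivity)).comp_add_right σ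
    exact (h1.const_mul _).integrableOn
  have hle : ∀ x ∈ orthant n, partitionIntegrand β σ (n * δ) n x ≤
      Real.exp (-(β / 2) * r) * ∏ i, h (x i) := by
    intro x hx
    rcases partitionIntegrand_eq_zero_or (δ := δ) (σ := σ) hβ hn x with h0 | ⟨h1, h2⟩
    · rw [h0]
      positivity
    · rw [partitionIntegrand_eq_exp h1 h2, mul_add, Real.exp_add, Finset.mul_sum, Real.exp_sum]
      have h3 := hr x hx
      rw [discreteEnergy_eq h1 h2, EReal.coe_le_coe_iff] at h3
      refine mul_le_mul ?_ ?_ (by positivity) (by positivity)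
      · exact Real.exp_le_exp.2 (mul_le_mul_of_nonpos_left h3 (by linarith))
      · refine Finset.prod_le_prod (fun i _ => by positivity) fun i _ => ?_
        simp only [hh]
        rw [← Real.exp_add]
        refine Real.exp_le_exp.2 ?_
        have h4 := fieldReal_ge hδ σ (x i)
        have h5 : δ ^ 2 ≤ D ^ 2 := pow_le_pow_left₀ hδ hδD 2
        nlinarith
  calc partitionFunction β σ (n * δ) n
      ≤ ∫⁻ x in orthant n, ENNReal.ofReal (Real.exp (-(β / 2) * r) * ∏ i, h (x i)) := by
        refine setLIntegral_mono_ae' ?_ (ae_of_all _ fun x hx => ENNReal.ofReal_le_ofReal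
          (hle x hx))
        rw [orthant_eq_pi]
        exact MeasurableSet.univ_pi fun _ => measurableSet_Ici
    _ = ∫⁻ x, ENNReal.ofReal (Real.exp (-(β / 2) * r) * ∏ i, h (x i))
          ∂(Measure.pi fun _ : Fin n => volume.restrict (Set.Ici (0 : ℝ))) := by
        rw [orthant_eq_pi, volume_pi, Measure.restrict_pi_pi]
    _ = _ := by
        rw [← ofReal_integral_eq_lintegral_ofReal, integral_const_mul,
          integral_fintype_prod_eq_pow, Fintype.card_fin]
        · exact (Integrable.fintype_prod fun _ => hint).const_mul _
        · exact ae_of_all _ fun x => by positivity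

lemma pi_withDensity_ofReal {n : ℕ} {f : ℝ → ℝ} (hf : Measurable f) (hf0 : ∀ t, 0 ≤ f t)
    {ν : Measure ℝ} [IsProbabilityMeasure ν]
    (hν : ν = volume.withDensity fun t => ENNReal.ofReal (f t)) :
    (Measure.pi fun _ : Fin n => ν) =
      volume.withDensity fun x => ENNReal.ofReal (∏ i, f (x i)) := by
  have hfi : Integrable f := by
    refine ⟨hf.aestronglyMeasurable, ?_⟩
    rw [hasFiniteIntegral_iff_ofReal (ae_of_all _ hf0)]
    have h1 : ν Set.univ = 1 := measure_univ
    rw [hν, withDensity_apply _ MeasurableSet.univ, Measure.restrict_univ] at h1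
    rw [h1]
    exact ENNReal.one_lt_top
  refine Measure.pi_eq fun s hs => ?_
  rw [withDensity_apply _ (MeasurableSet.univ_pi hs), volume_pi, Measure.restrict_pi_pi,
    ← ofReal_integral_eq_lintegral_ofReal, integral_fintype_prod_eq_prod, 
    ENNReal.ofReal_prod_of_nonneg]
  · refine Finset.prod_congr rfl fun i _ => ?_
    rw [hν, withDensity_apply _ (hs i), ofReal_integral_eq_lintegral_ofReal hfi.integrableOn
      (ae_of_all _ hf0)]
  · exact fun i _ => integral_nonneg hf0
  · exact Integrable.fintype_prod_dep fun i => hfi.integrableOn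
  · exact ae_of_all _ fun x => Finset.prod_nonneg fun i _ => hf0 _

lemma ofReal_integral_le_lintegral {X : Type*} [MeasurableSpace X] {m : Measure X} {f : X → ℝ}
    (hf : Integrable f m) :
    ENNReal.ofReal (∫ x, f x ∂m) ≤ ∫⁻ x, ENNReal.ofReal (f x) ∂m := by
  rw [integral_eq_lintegral_pos_part_sub_lintegral_neg_part hf]
  refine ENNReal.ofReal_le_of_le_toReal ?_
  linarith [ENNReal.toReal_nonneg (a := ∫⁻ x, ENNReal.ofReal (-f x) ∂m)]

/-- Jensen's inequality for the exponential function. -/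
lemma ofReal_exp_integral_le {X : Type*} [MeasurableSpace X] {m : Measure X}
    [IsProbabilityMeasure m] {g : X → ℝ} (hg : Integrable g m) :
    ENNReal.ofReal (Real.exp (∫ x, g x ∂m)) ≤ ∫⁻ x, ENNReal.ofReal (Real.exp (g x)) ∂m := by
  set c := ∫ x, g x ∂m with hc
  have h1 : Integrable (fun x => Real.exp c * (1 + (g x - c))) m :=
    ((integrable_const _).add (hg.sub (integrable_const _))).const_mul _
  have h2 : ∫ x, Real.exp c * (1 + (g x - c)) ∂m = Real.exp c := by
    have h3 : Integrable (fun x => g x - c) m := hg.sub (integrable_const _)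
    rw [integral_const_mul, integral_add (integrable_const _) h3,
      integral_sub hg (integrable_const _), ← hc]
    simp
  calc ENNReal.ofReal (Real.exp c)
      = ENNReal.ofReal (∫ x, Real.exp c * (1 + (g x - c)) ∂m) := by rw [h2]
    _ ≤ ∫⁻ x, ENNReal.ofReal (Real.exp c * (1 + (g x - c))) ∂m := ofReal_integral_le_lintegral h1
    _ ≤ _ := by
      refine lintegral_mono fun x => ENNReal.ofReal_le_ofReal ?_
      have h3 : Real.exp (g x) = Real.exp c * Real.exp (g x - c) := by
        rw [← Real.exp_add]
        congr 1
        ring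
      rw [h3]
      have := Real.add_one_le_exp (g x - c)
      gcongr
      linarith

/-- The integral is rewritten under `ν^n` by dividing by the product density, and Jensen's
inequality is applied to the exponential. The constant `S` is `∫ log f dν`; it contributes only `n
S`. -/
lemma IsEquilibrium.exists_le_partitionFunction {α σ C : ℝ} {ν : Measure ℝ}
    (h : IsEquilibrium α σ ν C) :
    ∃ S : ℝ, ∀ β, 0 < β → ∀ (δ : ℝ) (n : ℕ), 
      ENNReal.ofReal (Real.exp (-(β / 2) * (n * ((n : ℝ) - 1) * (mutualEnergy (logKernel 0) ν ν +
        ∫ t, fieldReal δ σ t ∂ν) + n * ∫ t, fieldReal δ σ t ∂ν) - n * S)) ≤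
      partitionFunction β σ (n * δ) n := by
  have := h.prob
  obtain ⟨f, hfm, hf0, hν, hfl⟩ := h.density
  refine ⟨∫ t, Real.log (f t) ∂ν, fun β hβ δ n => ?_⟩
  set P := Measure.pi fun _ : Fin n => ν with hP
  set g : (Fin n → ℝ) → ℝ := fun x => -(β / 2) * (discreteReal 0 δ σ n x +
    ∑ i, fieldReal δ σ (x i)) - ∑ i, Real.log (f (x i)) with hg
  obtain ⟨h1, h2⟩ := h.integral_discreteReal δ n
  have h3 := fun i : Fin n => integrable_comp_eval (h.integrable_fieldReal δ) i
  have h4 := fun i : Fin n => integrable_comp_eval hfl i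
  have h5 : Integrable (fun x : Fin n → ℝ => ∑ i, fieldReal δ σ (x i)) P :=
    integrable_finsetSum _ fun i _ => (h3 i).1
  have h6 : Integrable (fun x : Fin n → ℝ => ∑ i, Real.log (f (x i))) P :=
    integrable_finsetSum _ fun i _ => (h4 i).1
  have hgi : Integrable g P := ((h1.add h5).const_mul _).sub h6
  have hgv : ∫ x, g x ∂P = -(β / 2) * (n * ((n : ℝ) - 1) * (mutualEnergy (logKernel 0) ν ν +
        ∫ t, fieldReal δ σ t ∂ν) + n * ∫ t, fieldReal δ σ t ∂ν) -
        n * ∫ t, Real.log (f t) ∂ν := by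
    have h7 : Integrable (fun x => -(β / 2) * (discreteReal 0 δ σ n x +
      ∑ i, fieldReal δ σ (x i))) P := (h1.add h5).const_mul _
    simp only [hg]
    rw [integral_sub h7 h6, integral_const_mul, integral_add h1 h5, h2,
      integral_finsetSum _ fun i _ => (h3 i).1, integral_finsetSum _ fun i _ => (h4 i).1]
    simp_rw [fun i => (h3 i).2, fun i => (h4 i).2]
    simp
  rw [← hgv]
  refine (ofReal_exp_integral_le hgi).trans ?_
  have hw : Measurable fun x : Fin n → ℝ => ENNReal.ofReal (∏ i, f (x i)) := by fun_prop
  have hgood := h.ae_pi n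
  have hPd := pi_withDensity_ofReal (n := n) hfm hf0 hν
  rw [hPd, ae_withDensity_iff hw] at hgood
  have hgm : Measurable fun x => ENNReal.ofReal (Real.exp (g x)) := by
    simp only [hg, discreteReal]
    fun_prop
  rw [hP, hPd, lintegral_withDensity_eq_lintegral_mul _ hw hgm]
  have horth : MeasurableSet (orthant n) := by
    rw [orthant_eq_pi]
    exact MeasurableSet.univ_pi fun _ => measurableSet_Ici
  rw [partitionFunction, ← lintegral_indicator horth]
  refine lintegral_mono_ae ?_
  filter_upwards [hgood] with x hx
  simp only [Pi.mul_apply]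
  -- Where the product density vanishes there is nothing to prove; elsewhere every `f (x i)` is
  -- positive and cancels against `exp (-∑ log f)`.
  by_cases h0 : ENNReal.ofReal (∏ i, f (x i)) = 0
  · rw [h0, zero_mul]
    exact zero_le
  obtain ⟨hx1, hx2, hx3⟩ := hx h0
  rw [Set.indicator_of_mem hx1]
  have hpos : ∀ i, 0 < f (x i) := by
    intro i
    refine (hf0 _).lt_of_ne fun h => h0 ?_
    rw [Finset.prod_eq_zero (Finset.mem_univ i) h.symm, ENNReal.ofReal_zero]
  rw [← ENNReal.ofReal_mul (Finset.prod_nonneg fun i _ => hf0 _)]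
  refine ENNReal.ofReal_le_ofReal (le_of_eq ?_)
  have h8 := partitionIntegrand_eq_exp (β := β) (δ := δ) hx2 fun i => Or.inl (hx3 i)
  rw [partitionIntegrand] at h8
  rw [h8]
  simp only [hg]
  rw [Real.exp_sub, Real.exp_sum, Finset.prod_congr rfl fun i _ => Real.exp_log (hpos i)]
  have : ∏ i, f (x i) ≠ 0 := Finset.prod_ne_zero_iff.2 fun i _ => (hpos i).ne'
  field_simp

lemma log_ofReal_exp (r : ℝ) : ENNReal.log (ENNReal.ofReal (Real.exp r)) = (r : EReal) := by
  rw [ENNReal.log_ofReal_of_pos (Real.exp_pos r), Real.log_exp]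

/-- After division by `n²`, the factor `n(n-1)/n²` tends to `1`, while the one-particle integral,
the spare field and the entropy each contribute `O(1/n)`. -/
lemma IsEquilibrium.tendsto_partitionFunction {α σ C : ℝ} {ν : Measure ℝ}
    (h : IsEquilibrium α σ ν C) (hσ : 0 < σ ∨ α = 0) {μ : ℕ → ℝ} (hμ : ∀ n, 0 ≤ μ n)
    (hlim : Tendsto (fun n => μ n / n) atTop (𝓝 α)) {β : ℝ} (hβ : 0 < β) :
    Tendsto (fun n : ℕ => -(((1 / (n : ℝ) ^ 2 : ℝ) : EReal) *
      ENNReal.log (partitionFunction β σ (μ n) n))) atTop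
      (𝓝 (((β / 2 : ℝ) : EReal) * ((energyReal α σ ν : ℝ) : EReal))) := by
  set δ : ℕ → ℝ := fun n => μ n / n with hδdef
  have hδ : ∀ n, 0 ≤ δ n := fun n => div_nonneg (hμ n) (Nat.cast_nonneg n)
  obtain ⟨D, hD⟩ := hlim.bddAbove_range
  have hD : ∀ n, δ n ≤ D := fun n => hD ⟨n, rfl⟩
  obtain ⟨B, err, -, herr, hb⟩ := h.exists_tau_bounds hσ hδ hlim
  obtain ⟨S, hS⟩ := h.exists_le_partitionFunction
  set E := energyReal α σ ν with hE
  set L := ∫ t, Real.log (t + σ) ∂ν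
  set Q := ∫ t, fieldReal α σ t ∂ν
  set A : ℝ := ∫ t in Set.Ici (0 : ℝ), Real.exp (2 * β * D ^ 2) *
        Real.exp (-(3 / 8 * β) * (t + σ) ^ 2)
  have hinv : Tendsto (fun n : ℕ => (n : ℝ)⁻¹) atTop (𝓝 0) := tendsto_inv_atTop_nhds_zero_nat
  have hone : Tendsto (fun n : ℕ => 1 - (n : ℝ)⁻¹) atTop (𝓝 1) := by
    simpa using hinv.const_sub 1
  -- lower and upper bounds for the normalized logarithm
  set low : ℕ → ℝ := fun n => β / 2 * ((1 - (n : ℝ)⁻¹) * (E - err n)) -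
    (n : ℝ)⁻¹ * Real.log (|A| + 1)
  set up : ℕ → ℝ := fun n => β / 2 * ((1 - (n : ℝ)⁻¹) * (E - 2 * (δ n - α) * L) +
    (n : ℝ)⁻¹ * (Q - 2 * (δ n - α) * L)) + (n : ℝ)⁻¹ * S
  have hlow : Tendsto low atTop (𝓝 (β / 2 * E)) := by
    have h1 : Tendsto (fun n => E - err n) atTop (𝓝 E) := by simpa using herr.const_sub E
    have h2 := ((hone.mul h1).const_mul (β / 2)).sub (hinv.mul_const (Real.log (|A| + 1)))
    simpa using h2
  have hup : Tendsto up atTop (𝓝 (β / 2 * E)) := by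
    have h1 : Tendsto (fun n => 2 * (δ n - α) * L) atTop (𝓝 0) := by
      have := ((hlim.sub_const α).const_mul 2).mul_const L
      simpa using this
    have h2 : Tendsto (fun n => E - 2 * (δ n - α) * L) atTop (𝓝 E) := by
      simpa using h1.const_sub E
    have h3 : Tendsto (fun n => Q - 2 * (δ n - α) * L) atTop (𝓝 Q) := by
      simpa using h1.const_sub Q
    have h4 := (((hone.mul h2).add (hinv.mul h3)).const_mul (β / 2)).add (hinv.mul_const S)
    simpa using h4
  rw [← EReal.coe_mul]
  refine tendsto_of_tendsto_of_tendsto_of_le_of_le' ((continuous_coe_real_ereal.tendsto _).comp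
    hlow) ((continuous_coe_real_ereal.tendsto _).comp hup) ?_ ?_
  · filter_upwards [eventually_ge_atTop 2] with n hn
    have hn2 : (2 : ℝ) ≤ n := by exact_mod_cast hn
    have hn0 : (0 : ℝ) < n := by linarith
    have hn1 : (0 : ℝ) < (n : ℝ) - 1 := by linarith
    have hμn : μ n = n * δ n := by simp only [hδdef]; field_simp
    have hr : ∀ x ∈ orthant n, ((n * ((n : ℝ) - 1) * (E - err n) : ℝ) : EReal) ≤
        discreteEnergy (δ n) σ n x := by
      intro x hx
      obtain ⟨y, hy⟩ := exists_isMinimizingConfig (hδ n) σ hn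
      have h1 : ((E - err n : ℝ) : EReal) ≤ tau (δ n) σ n := by
        refine le_trans (EReal.coe_le_coe_iff.2 ?_) (hb n hn y hy).2.1
        linarith [charDist_nonneg 2 (empirical n y) ν]
      have hcnn : (0 : EReal) ≤ ((n * ((n : ℝ) - 1) : ℝ) : EReal) := by
        exact_mod_cast (by positivity : 0 ≤ n * ((n : ℝ) - 1))
      have h2 := mul_le_mul_of_nonneg_left h1 hcnn
      rw [tau, ← mul_assoc, ← EReal.coe_mul, ← EReal.coe_mul, mul_one_div_cancel (by positivity),
        EReal.coe_one, one_mul] at h2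
      exact h2.trans (iInf₂_le x hx)
    have hZ := partitionFunction_le hβ (hδ n) (hD n) (by omega) hr
    have hZ2 : partitionFunction β σ (μ n) n ≤ ENNReal.ofReal (Real.exp (-(n ^ 2 * low n))) := by
      rw [hμn]
      refine hZ.trans (ENNReal.ofReal_le_ofReal ?_)
      have h3 : A ^ n ≤ Real.exp (n * Real.log (|A| + 1)) := by
        rw [← Real.log_pow, Real.exp_log (by positivity)]
        refine (le_abs_self _).trans ?_
        rw [abs_pow]
        exact pow_le_pow_left₀ (abs_nonneg A) (by linarith) n
      calc _ ≤ Real.exp (-(β / 2) * (n * ((n : ℝ) - 1) * (E - err n))) *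
            Real.exp (n * Real.log (|A| + 1)) := by gcongr
        _ = _ := by
          rw [← Real.exp_add]
          congr 1
          simp only [low]
          field_simp
          ring
    have h4 := ENNReal.log_monotone hZ2
    rw [log_ofReal_exp] at h4
    have hcnn : (0 : EReal) ≤ ((1 / (n : ℝ) ^ 2 : ℝ) : EReal) := by
      exact_mod_cast (by positivity : 0 ≤ 1 / (n : ℝ) ^ 2)
    have h5 := EReal.neg_le_neg_iff.2 (mul_le_mul_of_nonneg_left h4 hcnn)
    rw [← EReal.coe_mul, ← EReal.coe_neg] at h5
    refine le_trans (le_of_eq ?_) h5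
    simp only [Function.comp]
    congr 1
    field_simp
  · filter_upwards [eventually_ge_atTop 2] with n hn
    have hn2 : (2 : ℝ) ≤ n := by exact_mod_cast hn
    have hn0 : (0 : ℝ) < n := by linarith
    have hμn : μ n = n * δ n := by simp only [hδdef]; field_simp
    have hZ := hS β hβ (δ n) n
    rw [← hμn, h.integral_fieldReal (δ n)] at hZ
    have h4 := ENNReal.log_monotone hZ
    rw [log_ofReal_exp] at h4
    have hcnn : (0 : EReal) ≤ ((1 / (n : ℝ) ^ 2 : ℝ) : EReal) := by
      exact_mod_cast (by positivity : 0 ≤ 1 / (n : ℝ) ^ 2)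
    have h5 := EReal.neg_le_neg_iff.2 (mul_le_mul_of_nonneg_left h4 hcnn)
    rw [← EReal.coe_mul, ← EReal.coe_neg] at h5
    refine h5.trans (le_of_eq ?_)
    simp only [Function.comp]
    congr 1
    simp only [up, hE, energyReal]
    field_simp
    ring

/-! ### Logarithmic averages on the unit circle -/

section LogAverage

open Complex Metric

variable {z : ℂ}

lemma one_sub_mul_mem_slitPlane {ζ : ℂ} (h : ‖z * ζ‖ < 1) : 1 - z * ζ ∈ slitPlane := by
  refine Or.inl ?_
  have := (abs_re_le_norm (z * ζ)).trans_lt h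
  simp only [sub_re, one_re]
  linarith [le_abs_self (z * ζ).re]

lemma hasDerivAt_log_one_sub {ζ : ℂ} (h : ‖z * ζ‖ < 1) :
    HasDerivAt (fun ζ => log (1 - z * ζ)) (-z / (1 - z * ζ)) ζ := by
  have h1 : HasDerivAt (fun ζ => 1 - z * ζ) (-z) ζ := by
    simpa using ((hasDerivAt_id ζ).const_mul z).const_sub 1
  exact h1.clog (one_sub_mul_mem_slitPlane h)

lemma norm_mul_lt_one (hz : ‖z‖ < 1) {ζ : ℂ} (hζ : ζ ∈ closedBall (0 : ℂ) 1) : ‖z * ζ‖ < 1 := by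
  rw [mem_closedBall_zero_iff] at hζ
  rw [norm_mul]
  exact mul_lt_one_of_nonneg_of_lt_one_left (norm_nonneg _) hz hζ

lemma diffContOnCl_log_one_sub (hz : ‖z‖ < 1) :
    DiffContOnCl ℂ (fun ζ => log (1 - z * ζ)) (ball 0 1) := by
  refine DifferentiableOn.diffContOnCl fun ζ hζ => ?_
  rw [closure_ball _ one_ne_zero] at hζ
  exact (hasDerivAt_log_one_sub (norm_mul_lt_one hz hζ)).differentiableAt.differentiableWithinAt

lemma circleAverage_inv_pow_mul {f : ℂ → ℂ} (hf : DiffContOnCl ℂ f (ball 0 1)) (k : ℕ) :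
    Real.circleAverage (fun ζ => (ζ ^ k)⁻¹ * f ζ) 0 1 = iteratedDeriv k f 0 / (k.factorial : ℂ) := by
  rw [Real.circleAverage_eq_circleIntegral one_ne_zero]
  have h := hf.circleIntegral_one_div_sub_center_pow_smul one_pos k
  have h2 : (∮ ζ in C(0, 1), (ζ - 0)⁻¹ • ((ζ ^ k)⁻¹ * f ζ)) =
      ∮ ζ in C(0, 1), (1 / (ζ - 0) ^ (k + 1)) • f ζ := by
    congr 1
    ext ζ
    simp only [sub_zero, smul_eq_mul, one_div, pow_succ, mul_inv]
    ring
  rw [h2, h]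
  have := Real.pi_ne_zero
  simp only [smul_eq_mul]
  field_simp

lemma iteratedDeriv_log_one_sub (z : ℂ) :
    iteratedDeriv 1 (fun ζ => log (1 - z * ζ)) 0 = -z ∧
      iteratedDeriv 2 (fun ζ => log (1 - z * ζ)) 0 = -z ^ 2 := by
  have h1 : deriv (fun ζ => log (1 - z * ζ)) =ᶠ[𝓝 0] fun ζ => -z / (1 - z * ζ) := by
    have : ∀ᶠ ζ in 𝓝 (0 : ℂ), ‖z * ζ‖ < 1 := by
      have : Tendsto (fun ζ : ℂ => ‖z * ζ‖) (𝓝 0) (𝓝 ‖z * 0‖) :=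
        (continuous_const.mul continuous_id).norm.tendsto 0
      rw [mul_zero, norm_zero] at this
      exact this.eventually_lt_const one_pos
    exact this.mono fun ζ hζ => (hasDerivAt_log_one_sub hζ).deriv
  refine ⟨?_, ?_⟩
  · rw [iteratedDeriv_one, h1.eq_of_nhds]
    simp
  · rw [iteratedDeriv_succ, iteratedDeriv_one, h1.deriv_eq]
    have h2 : HasDerivAt (fun ζ => 1 - z * ζ) (-z) 0 := by
      simpa using ((hasDerivAt_id (0 : ℂ)).const_mul z).const_sub 1
    have h3 : HasDerivAt (fun ζ => -z / (1 - z * ζ)) _ 0 :=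
      (hasDerivAt_const (0 : ℂ) (-z)).div h2 (by simp)
    rw [h3.deriv]
    simp
    ring

lemma continuousOn_circleIntegrable {f : ℂ → ℂ} (hf : ContinuousOn f (sphere 0 1)) :
    CircleIntegrable f 0 1 := ContinuousOn.circleIntegrable zero_le_one hf

/-- The weight `1 - A cos θ - B cos 2θ - α (P_q(θ) - 1)` with the Poisson kernel `P_q`. -/
def circleWeight (A B q α θ : ℝ) : ℝ :=
  1 - A * Real.cos θ - B * Real.cos (2 * θ) -
    α * ((1 - q ^ 2) / (1 + 2 * q * Real.cos θ + q ^ 2) - 1)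

lemma poisson_denom_pos {q : ℝ} (hq0 : 0 ≤ q) (hq1 : q < 1) (θ : ℝ) :
    0 < 1 + 2 * q * Real.cos θ + q ^ 2 := by
  nlinarith [Real.neg_one_le_cos θ, sq_nonneg (1 - q), mul_nonneg hq0
    (show 0 ≤ 1 + Real.cos θ by linarith [Real.neg_one_le_cos θ])]

@[fun_prop]
lemma continuous_circleWeight (A B α : ℝ) {q : ℝ} (hq0 : 0 ≤ q) (hq1 : q < 1) :
    Continuous (circleWeight A B q α) := by
  unfold circleWeight
  refine Continuous.sub (by fun_prop) (continuous_const.mul (Continuous.sub ?_ continuous_const))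
  exact Continuous.div (by fun_prop) (by fun_prop) fun θ => (poisson_denom_pos hq0 hq1 θ).ne'

lemma circleWeight_periodic (A B q α : ℝ) :
    Function.Periodic (circleWeight A B q α) (2 * Real.pi) := by
  intro θ
  simp only [circleWeight]
  rw [mul_add, Real.cos_add_two_pi, show 2 * θ + 2 * (2 * Real.pi) =
    2 * θ + 2 * Real.pi + 2 * Real.pi by ring, Real.cos_add_two_pi, Real.cos_add_two_pi]

lemma circleWeight_neg (A B q α θ : ℝ) : circleWeight A B q α (-θ) = circleWeight A B q α θ := by
  simp only [circleWeight]
  rw [mul_neg, Real.cos_neg, Real.cos_neg]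

/-- Expand `cos kθ = (ζ^k + ζ^{-k}) / 2` on `|ζ| = 1`. The average of `ζ^k F` vanishes for `k = 1,
2`, that of `ζ^{-k} F` is a Taylor coefficient at `0`, and the Poisson kernel with pole `-q`
evaluates `F` at `-q`. -/
lemma integral_circleWeight_mul_re {A B q α : ℝ} (hq0 : 0 ≤ q) (hq1 : q < 1) {F : ℂ → ℂ}
    (hd : DiffContOnCl ℂ F (ball 0 1)) :
    ∫ θ in (0 : ℝ)..2 * Real.pi, circleWeight A B q α θ * (F (exp (θ * I))).re =
      2 * Real.pi * ((1 + α) * F 0 - A * iteratedDeriv 1 F 0 / 2 - B * iteratedDeriv 2 F 0 / 4 -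
        α * F (-q)).re := by
  have hFc : ContinuousOn F (closedBall 0 1) := hd.continuousOn_ball
  have hFs : ContinuousOn F (sphere 0 1) := hFc.mono sphere_subset_closedBall
  have hne : ∀ ζ ∈ sphere (0 : ℂ) 1, ζ ≠ 0 := by
    rintro ζ hζ rfl
    simp at hζ
  have hpow : ∀ k : ℕ, DiffContOnCl ℂ (fun ζ => ζ ^ k * F ζ) (ball 0 1) := fun k =>
    ((differentiable_id.pow k).diffContOnCl).smul hd
  have hq : (-(q : ℂ)) ∈ ball (0 : ℂ) 1 := by
    rw [mem_ball_zero_iff, norm_neg, norm_real, Real.norm_of_nonneg hq0]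
    exact hq1
  have a0 : ∀ f : ℂ → ℂ, DiffContOnCl ℂ f (ball 0 1) → Real.circleAverage f 0 1 = f 0 := by
    intro f hf
    have := circleAverage_inv_pow_mul hf 0
    simpa using this
  have a1 := circleAverage_inv_pow_mul hd 1
  have a2 := circleAverage_inv_pow_mul hd 2
  have aP := hd.circleAverage_poissonKernel_smul' hq
  have hPc : ContinuousOn (fun ζ : ℂ => ((‖ζ - 0‖ ^ 2 - ‖-(q : ℂ) - 0‖ ^ 2) /
      ‖(ζ - 0) - (-(q : ℂ) - 0)‖ ^ 2) • F ζ) (sphere 0 1) := by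
    have hn : Continuous fun ζ : ℂ => ‖ζ - 0‖ ^ 2 - ‖-(q : ℂ) - 0‖ ^ 2 := by fun_prop
    have hd : Continuous fun ζ : ℂ => ‖(ζ - 0) - (-(q : ℂ) - 0)‖ ^ 2 := by fun_prop
    refine ContinuousOn.smul (hn.continuousOn.div hd.continuousOn ?_) hFs
    intro ζ hζ h0
    have h1 : ζ = -(q : ℂ) := by
      have := pow_eq_zero_iff (two_ne_zero) |>.1 h0
      rw [norm_eq_zero] at this
      linear_combination this
    rw [h1] at hζ
    rw [mem_sphere_zero_iff_norm] at hζ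
    rw [mem_ball_zero_iff] at hq
    linarith
  have ic0 : CircleIntegrable F 0 1 := continuousOn_circleIntegrable hFs
  have icp : ∀ k : ℕ, CircleIntegrable (fun ζ => ζ ^ k * F ζ) 0 1 := fun k =>
    continuousOn_circleIntegrable (by fun_prop)
  have ici : ∀ k : ℕ, CircleIntegrable (fun ζ => (ζ ^ k)⁻¹ * F ζ) 0 1 := fun k =>
    continuousOn_circleIntegrable (ContinuousOn.mul (ContinuousOn.inv₀ (by fun_prop)
      fun ζ hζ => pow_ne_zero k (hne ζ hζ)) hFs)
  have icP := continuousOn_circleIntegrable hPc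
  set P : ℂ → ℂ := fun ζ : ℂ => ((‖ζ - 0‖ ^ 2 - ‖-(q : ℂ) - 0‖ ^ 2) /
      ‖(ζ - 0) - (-(q : ℂ) - 0)‖ ^ 2) • F ζ with hP
  set K : ℂ → ℂ := fun ζ => ((1 : ℂ) + α) • F ζ + ((-(A : ℂ) / 2) • (ζ ^ 1 * F ζ) +
    ((-(A : ℂ) / 2) • ((ζ ^ 1)⁻¹ * F ζ) + ((-(B : ℂ) / 2) • (ζ ^ 2 * F ζ) +
      ((-(B : ℂ) / 2) • ((ζ ^ 2)⁻¹ * F ζ) + (-(α : ℂ)) • P ζ)))) with hK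
  have e5 := (icP.const_fun_smul (a := (-(α : ℂ))))
  have e4 := ((ici 2).const_fun_smul (a := (-(B : ℂ) / 2)))
  have e3 := ((icp 2).const_fun_smul (a := (-(B : ℂ) / 2)))
  have e2 := ((ici 1).const_fun_smul (a := (-(A : ℂ) / 2)))
  have e1 := ((icp 1).const_fun_smul (a := (-(A : ℂ) / 2)))
  have e0 := (ic0.const_fun_smul (a := (1 + (α : ℂ))))
  have s4 : CircleIntegrable (fun ζ => (-(B : ℂ) / 2) • ((ζ ^ 2)⁻¹ * F ζ) + (-(α : ℂ)) • P ζ)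
      0 1 := e4.add e5
  have s3 : CircleIntegrable (fun ζ => (-(B : ℂ) / 2) • (ζ ^ 2 * F ζ) +
      ((-(B : ℂ) / 2) • ((ζ ^ 2)⁻¹ * F ζ) + (-(α : ℂ)) • P ζ)) 0 1 := e3.add s4
  have s2 : CircleIntegrable (fun ζ => (-(A : ℂ) / 2) • ((ζ ^ 1)⁻¹ * F ζ) +
      ((-(B : ℂ) / 2) • (ζ ^ 2 * F ζ) +
      ((-(B : ℂ) / 2) • ((ζ ^ 2)⁻¹ * F ζ) + (-(α : ℂ)) • P ζ))) 0 1 := e2.add s3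
  have s1 : CircleIntegrable (fun ζ => (-(A : ℂ) / 2) • (ζ ^ 1 * F ζ) +
      ((-(A : ℂ) / 2) • ((ζ ^ 1)⁻¹ * F ζ) + ((-(B : ℂ) / 2) • (ζ ^ 2 * F ζ) +
      ((-(B : ℂ) / 2) • ((ζ ^ 2)⁻¹ * F ζ) + (-(α : ℂ)) • P ζ)))) 0 1 := e1.add s2
  have hKav : Real.circleAverage K 0 1 =
      (1 + α) * F 0 - A * iteratedDeriv 1 F 0 / 2 - B * iteratedDeriv 2 F 0 / 4 -
        α * F (-q) := by
    rw [hK, Real.circleAverage_fun_add e0 s1, Real.circleAverage_fun_add e1 s2,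
      Real.circleAverage_fun_add e2 s3, Real.circleAverage_fun_add e3 s4, Real.circleAverage_fun_add e4 e5]
    simp only [Real.circleAverage_fun_smul]
    rw [a1, a2, aP, a0 _ (hpow 1), a0 _ (hpow 2), a0 _ hd]
    simp only [smul_eq_mul, Nat.factorial]
    push_cast
    ring_nf
  have hKi : CircleIntegrable K 0 1 := e0.add s1
  have hre := reCLM.circleAverage_comp_comm hKi
  rw [hKav, Real.circleAverage_def, smul_eq_mul, inv_mul_eq_iff_eq_mul₀ (by positivity)] at hre
  rw [reCLM_apply] at hre
  rw [← hre]
  refine intervalIntegral.integral_congr fun θ _ => ?_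
  have hc : circleMap 0 1 θ = exp (θ * I) := by simp [circleMap]
  simp only [Function.comp, reCLM_apply, hc]
  set ζ := exp (θ * I) with hζ
  have hζn : ‖ζ‖ = 1 := norm_exp_ofReal_mul_I θ
  have hζi : ζ⁻¹ = exp (-(θ * I)) := by rw [hζ, exp_neg]
  have hcos : ζ + ζ⁻¹ = 2 * (Real.cos θ : ℂ) := by
    rw [hζi, ofReal_cos, cos, ← neg_mul]
    ring
  have hcos2 : ζ ^ 2 + (ζ ^ 2)⁻¹ = 2 * (Real.cos (2 * θ) : ℂ) := by
    rw [Real.cos_two_mul]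
    have hz0 : ζ ≠ 0 := exp_ne_zero _
    have : ζ * ζ⁻¹ = 1 := mul_inv_cancel₀ hz0
    rw [← inv_pow]
    push_cast
    push_cast at hcos
    linear_combination (ζ + ζ⁻¹ + 2 * cos (θ : ℂ)) * hcos - 2 * this
  have hden : ‖(ζ - 0) - (-(q : ℂ) - 0)‖ ^ 2 = 1 + 2 * q * Real.cos θ + q ^ 2 := by
    have h1 : (ζ - 0) - (-(q : ℂ) - 0) = ((Real.cos θ + q : ℝ) : ℂ) + (Real.sin θ : ℝ) * I := by
      rw [hζ, exp_mul_I]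
      push_cast
      ring
    rw [h1, ← normSq_eq_norm_sq, normSq_add_mul_I]
    linear_combination Real.sin_sq_add_cos_sq θ
  have hnum : ‖ζ - 0‖ ^ 2 - ‖-(q : ℂ) - 0‖ ^ 2 = 1 - q ^ 2 := by
    rw [sub_zero, sub_zero, hζn, norm_neg, norm_real, Real.norm_of_nonneg hq0]
    ring
  have hKζ : K ζ = (circleWeight A B q α θ : ℂ) * F ζ := by
    simp only [hK, hP, hden, hnum, circleWeight, real_smul, smul_eq_mul]
    push_cast
    push_cast at hcos hcos2
    linear_combination (-(A : ℂ) / 2 * F ζ) * hcos + (-(B : ℂ) / 2 * F ζ) * hcos2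
  rw [hKζ, re_ofReal_mul]

/-- The logarithm of `|1 - 2 z cos θ + z²|`, written as a sum of two logarithms. -/
def pairLog (z : ℂ) (θ : ℝ) : ℝ :=
  Real.log ‖1 - z * exp (θ * I)‖ + Real.log ‖1 - z * exp ((-θ : ℝ) * I)‖

lemma norm_mul_exp (z : ℂ) (θ : ℝ) : ‖z * exp (θ * I)‖ = ‖z‖ := by
  rw [norm_mul, norm_exp_ofReal_mul_I, mul_one]

lemma continuous_log_norm_one_sub (hz : ‖z‖ < 1) :
    Continuous fun θ : ℝ => Real.log ‖1 - z * exp (θ * I)‖ := by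
  refine Continuous.log (by fun_prop) fun θ h => ?_
  rw [norm_eq_zero, sub_eq_zero] at h
  have := norm_mul_exp z θ
  rw [← h, norm_one] at this
  linarith

lemma integral_circleWeight_mul_re_add {A B q α : ℝ} (hq0 : 0 ≤ q) (hq1 : q < 1) {F : ℂ → ℂ}
    (hd : DiffContOnCl ℂ F (ball 0 1)) :
    ∫ θ in (0 : ℝ)..Real.pi, circleWeight A B q α θ *
      ((F (exp (θ * I))).re + (F (exp ((-θ : ℝ) * I))).re) =
      2 * Real.pi * ((1 + α) * F 0 - A * iteratedDeriv 1 F 0 / 2 - B * iteratedDeriv 2 F 0 / 4 -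
        α * F (-q)).re := by
  rw [← integral_circleWeight_mul_re hq0 hq1 hd]
  have hc := continuous_circleWeight A B α hq0 hq1
  have hl : Continuous fun θ : ℝ => (F (exp (θ * I))).re :=
    continuous_re.comp (hd.continuousOn_ball.comp_continuous (by fun_prop) fun θ => by
      rw [mem_closedBall_zero_iff, norm_exp_ofReal_mul_I])
  set g : ℝ → ℝ := fun θ => circleWeight A B q α θ * (F (exp (θ * I))).re with hg
  have hgc : Continuous g := hc.mul hl
  have hgp : Function.Periodic g (2 * Real.pi) := by
    intro θ
    simp only [hg, circleWeight_periodic A B q α θ]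
    congr 3
    push_cast
    rw [add_mul, exp_add, exp_two_pi_mul_I, mul_one]
  -- By periodicity the full circle becomes `[-π, π]`, which the evenness of the weight folds onto
  -- `[0, π]`.
  have h1 : ∫ θ in (0 : ℝ)..2 * Real.pi, g θ = ∫ θ in (-Real.pi)..Real.pi, g θ := by
    have := hgp.intervalIntegral_add_eq 0 (-Real.pi)
    rw [zero_add] at this
    rw [this]
    congr 1
    ring
  have h2 : ∫ θ in (-Real.pi)..0, g θ = ∫ θ in (0 : ℝ)..Real.pi, g (-θ) := by
    rw [intervalIntegral.integral_comp_neg, neg_zero]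
  have h3 : IntervalIntegrable (fun θ => g (-θ)) volume 0 Real.pi :=
    (hgc.comp continuous_neg).intervalIntegrable _ _
  rw [h1, ← intervalIntegral.integral_add_adjacent_intervals (b := 0)
    (hgc.intervalIntegrable _ _) (hgc.intervalIntegrable _ _), h2,
    ← intervalIntegral.integral_add h3 (hgc.intervalIntegrable _ _)]
  refine intervalIntegral.integral_congr fun θ _ => ?_
  simp only [hg, circleWeight_neg]
  ring

lemma integral_circleWeight {A B q α : ℝ} (hq0 : 0 ≤ q) (hq1 : q < 1) :
    ∫ θ in (0 : ℝ)..Real.pi, circleWeight A B q α θ = Real.pi := by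
  have h := integral_circleWeight_mul_re_add (A := A) (B := B) (α := α) hq0 hq1
    (diffContOnCl_const (c := (1 : ℂ)))
  simp only [one_re, iteratedDeriv_const] at h
  norm_num at h
  linarith

lemma integral_circleWeight_mul_pairLog_of_lt {A B q α : ℝ} (hq0 : 0 ≤ q) (hq1 : q < 1)
    (hz : ‖z‖ < 1) :
    ∫ θ in (0 : ℝ)..Real.pi, circleWeight A B q α θ * pairLog z θ =
      2 * Real.pi * (A * z / 2 + B * z ^ 2 / 4 - α * log (1 + q * z)).re := by
  have h := integral_circleWeight_mul_re_add (A := A) (B := B) (α := α) hq0 hq1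
    (diffContOnCl_log_one_sub hz)
  rw [(iteratedDeriv_log_one_sub z).1, (iteratedDeriv_log_one_sub z).2] at h
  simp only [log_re] at h
  unfold pairLog
  rw [h]
  simp only [mul_zero, sub_zero, log_one]
  ring_nf

/-- A majorant independent of `ρ`: as `|ζ| = 1`, `|1 - ζ| ≤ |1 - ρζ| + (1 - ρ) ≤ 2 |1 - ρζ|`. -/
lemma abs_log_norm_one_sub_le {ζ : ℂ} (hζ : ‖ζ‖ = 1) (hζ1 : ζ ≠ 1) {ρ : ℝ} (h0 : 0 ≤ ρ)
    (h1 : ρ < 1) : |Real.log ‖1 - ρ * ζ‖| ≤ Real.log 2 + |Real.log ‖1 - ζ‖| := by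
  have hρ : ‖(ρ : ℂ) * ζ‖ = ρ := by
    rw [norm_mul, hζ, mul_one, norm_real, Real.norm_of_nonneg h0]
  have hpos : 0 < ‖1 - ζ‖ := norm_pos_iff.2 (sub_ne_zero.2 hζ1.symm)
  have hge : 1 - ρ ≤ ‖1 - ρ * ζ‖ := by
    have := norm_sub_norm_le (1 : ℂ) (ρ * ζ)
    rwa [norm_one, hρ] at this
  have hle : ‖1 - ρ * ζ‖ ≤ 2 := by
    have := norm_sub_le (1 : ℂ) (ρ * ζ)
    rw [norm_one, hρ] at this
    linarith
  have hhalf : ‖1 - ζ‖ / 2 ≤ ‖1 - ρ * ζ‖ := by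
    have h2 : 1 - ζ = (1 - ρ * ζ) - ((1 - ρ : ℝ) : ℂ) * ζ := by
      push_cast
      ring
    have h3 := norm_sub_le (1 - ρ * ζ) (((1 - ρ : ℝ) : ℂ) * ζ)
    rw [← h2, norm_mul, hζ, mul_one, norm_real, Real.norm_of_nonneg (by linarith)] at h3
    linarith
  have h4 : Real.log ‖1 - ρ * ζ‖ ≤ Real.log 2 := Real.log_le_log (by linarith) hle
  have h5 : Real.log ‖1 - ζ‖ - Real.log 2 ≤ Real.log ‖1 - ρ * ζ‖ := by
    rw [← Real.log_div hpos.ne' two_ne_zero]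
    exact Real.log_le_log (by positivity) hhalf
  refine abs_le.2 ⟨?_, ?_⟩
  · linarith [neg_abs_le (Real.log ‖1 - ζ‖)]
  · linarith [abs_nonneg (Real.log ‖1 - ζ‖)]

lemma intervalIntegrable_log_norm_one_sub (hz : ‖z‖ = 1) :
    IntervalIntegrable (fun θ : ℝ => Real.log ‖1 - z * exp (θ * I)‖) volume 0 Real.pi ∧
    IntervalIntegrable (fun θ : ℝ => Real.log ‖1 - z * exp ((-θ : ℝ) * I)‖) volume 0
      Real.pi := by
  have hz0 : z ≠ 0 := by
    rintro rfl
    simp at hz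
  have key : ∀ w : ℂ, IntervalIntegrable (fun θ : ℝ => Real.log ‖exp (θ * I) - w‖) volume 0
      Real.pi := by
    intro w
    have h1 := circleIntegrable_log_norm_sub_const (a := w) (c := 0) 1
    have h2 : IntervalIntegrable (fun θ : ℝ => Real.log ‖exp (θ * I) - w‖) volume 0
        (2 * Real.pi) := by
      simpa [CircleIntegrable, circleMap] using h1
    refine h2.mono_set ?_
    rw [Set.uIcc_of_le Real.pi_pos.le, Set.uIcc_of_le (by positivity)]
    exact Set.Icc_subset_Icc_right (by linarith [Real.pi_pos])
  constructor
  · refine (key z⁻¹).congr fun θ _ => ?_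
    have : 1 - z * exp (θ * I) = -z * (exp (θ * I) - z⁻¹) := by
      field_simp
      ring
    rw [this, norm_mul, norm_neg, hz, one_mul]
  · refine (key z).congr fun θ _ => ?_
    have : 1 - z * exp ((-θ : ℝ) * I) = exp ((-θ : ℝ) * I) * (exp (θ * I) - z) := by
      rw [mul_sub, ← exp_add]
      push_cast
      rw [neg_mul, neg_add_cancel, exp_zero]
      ring
    rw [this, norm_mul, norm_exp_ofReal_mul_I, one_mul]

lemma intervalIntegrable_pairLog (hz : ‖z‖ ≤ 1) :
    IntervalIntegrable (pairLog z) volume 0 Real.pi := by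
  rcases hz.lt_or_eq with hz | hz
  · exact (((continuous_log_norm_one_sub hz)).add
      ((continuous_log_norm_one_sub hz).comp continuous_neg)).intervalIntegrable _ _
  · exact (intervalIntegrable_log_norm_one_sub hz).1.add
      (intervalIntegrable_log_norm_one_sub hz).2

lemma mul_exp_ne_one (hz : ‖z‖ = 1) {θ : ℝ} (hθ : θ ∈ Set.Icc 0 Real.pi)
    (hne : θ ≠ Real.arccos z.re) :
    z * exp (θ * I) ≠ 1 ∧ z * exp ((-θ : ℝ) * I) ≠ 1 := by
  have hzz : normSq z = 1 := by rw [normSq_eq_norm_sq, hz, one_pow]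
  have key : ∀ t : ℝ, Real.cos t = Real.cos θ → z * exp (t * I) ≠ 1 := by
    intro t ht h
    have h1 : exp (t * I) = (starRingEnd ℂ) z := by
      have h2 : (starRingEnd ℂ) z * z = 1 := by
        rw [← normSq_eq_conj_mul_self, hzz, ofReal_one]
      calc exp (t * I) = ((starRingEnd ℂ) z * z) * exp (t * I) := by rw [h2, one_mul]
        _ = (starRingEnd ℂ) z * (z * exp (t * I)) := by ring
        _ = _ := by rw [h, mul_one]
    have h3 := congrArg re h1
    rw [exp_ofReal_mul_I_re, conj_re, ht] at h3
    exact hne (by rw [← h3, Real.arccos_cos hθ.1 hθ.2])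
  exact ⟨key θ rfl, key (-θ) (Real.cos_neg θ)⟩

/-- The boundary case `|z| = 1`, needed on the support itself, is the radial limit of the interior
formula. Domination fails only at the angle `arccos z.re`, where `z e^{±iθ} = 1` may occur. -/
lemma integral_circleWeight_mul_pairLog {A B q α : ℝ} (hq0 : 0 ≤ q) (hq1 : q < 1)
    (hz : ‖z‖ ≤ 1) :
    ∫ θ in (0 : ℝ)..Real.pi, circleWeight A B q α θ * pairLog z θ =
      2 * Real.pi * (A * z / 2 + B * z ^ 2 / 4 - α * log (1 + q * z)).re := by
  rcases hz.lt_or_eq with hz | hz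
  · exact integral_circleWeight_mul_pairLog_of_lt hq0 hq1 hz
  have hmem : ∀ᶠ ρ in 𝓝[<] (1 : ℝ), 0 ≤ ρ ∧ ρ < 1 := by
    filter_upwards [Ioo_mem_nhdsLT (show (0 : ℝ) < 1 by norm_num)] with ρ hρ
    exact ⟨hρ.1.le, hρ.2⟩
  have hlim1 : Tendsto (fun ρ : ℝ => ∫ θ in (0 : ℝ)..Real.pi,
      circleWeight A B q α θ * pairLog (ρ * z) θ) (𝓝[<] 1)
      (𝓝 (∫ θ in (0 : ℝ)..Real.pi, circleWeight A B q α θ * pairLog z θ)) := by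
    obtain ⟨M, hM⟩ := isCompact_Icc.exists_bound_of_continuousOn (s := Set.Icc 0 Real.pi)
      (continuous_circleWeight A B α hq0 hq1).continuousOn
    obtain ⟨hi1, hi2⟩ := intervalIntegrable_log_norm_one_sub hz
    have hexc : ∀ᵐ θ : ℝ, θ ≠ Real.arccos z.re := Measure.ae_ne _ _
    have hcont : ∀ t : ℝ, z * exp (t * I) ≠ 1 →
        Tendsto (fun ρ : ℝ => Real.log ‖1 - ρ * z * exp (t * I)‖) (𝓝[<] 1)
          (𝓝 (Real.log ‖1 - z * exp (t * I)‖)) := by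
      intro t ht
      refine Tendsto.mono_left ?_ nhdsWithin_le_nhds
      have h1 : Continuous fun ρ : ℝ => ‖1 - ρ * z * exp (t * I)‖ := by fun_prop
      have h2 := h1.tendsto 1
      simp only [ofReal_one, one_mul] at h2
      exact h2.log (norm_ne_zero_iff.2 (sub_ne_zero.2 ht.symm))
    refine intervalIntegral.tendsto_integral_filter_of_dominated_convergence
      (fun θ => M * ((Real.log 2 + |Real.log ‖1 - z * exp (θ * I)‖|) +
        (Real.log 2 + |Real.log ‖1 - z * exp ((-θ : ℝ) * I)‖|))) ?_ ?_ ?_ ?_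
    · refine Eventually.of_forall fun ρ => Measurable.aestronglyMeasurable ?_
      have := (continuous_circleWeight A B α hq0 hq1).measurable
      unfold pairLog
      fun_prop
    · filter_upwards [hmem] with ρ hρ
      filter_upwards [hexc] with θ hθ hθm
      rw [Set.uIoc_of_le Real.pi_pos.le] at hθm
      obtain ⟨h1, h2⟩ := mul_exp_ne_one hz ⟨hθm.1.le, hθm.2⟩ hθ
      rw [norm_mul]
      refine mul_le_mul (hM θ ⟨hθm.1.le, hθm.2⟩) ?_ (norm_nonneg _)
        ((norm_nonneg _).trans (hM 0 ⟨le_rfl, Real.pi_pos.le⟩))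
      rw [pairLog, Real.norm_eq_abs]
      refine (abs_add_le _ _).trans (add_le_add ?_ ?_)
      · rw [mul_assoc]
        exact abs_log_norm_one_sub_le (by rw [norm_mul_exp, hz]) h1 hρ.1 hρ.2
      · rw [mul_assoc]
        exact abs_log_norm_one_sub_le (by rw [norm_mul_exp, hz]) h2 hρ.1 hρ.2
    · exact (((intervalIntegrable_const).add hi1.abs).add
        ((intervalIntegrable_const).add hi2.abs)).const_mul M
    · filter_upwards [hexc] with θ hθ hθm
      rw [Set.uIoc_of_le Real.pi_pos.le] at hθm
      obtain ⟨h1, h2⟩ := mul_exp_ne_one hz ⟨hθm.1.le, hθm.2⟩ hθ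
      exact ((hcont θ h1).add (hcont (-θ) h2)).const_mul _
  have hlim2 : Tendsto (fun ρ : ℝ => 2 * Real.pi * (A * (ρ * z) / 2 + B * (ρ * z) ^ 2 / 4 -
      α * log (1 + q * (ρ * z))).re) (𝓝[<] 1)
      (𝓝 (2 * Real.pi * (A * z / 2 + B * z ^ 2 / 4 - α * log (1 + q * z)).re)) := by
    refine Tendsto.mono_left ?_ nhdsWithin_le_nhds
    have hslit : 1 + q * (((1 : ℝ) : ℂ) * z) ∈ slitPlane := by
      have h1 : ‖(-q : ℂ) * z‖ < 1 := by
        rw [norm_mul, hz, mul_one, norm_neg, norm_real, Real.norm_of_nonneg hq0]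
        exact hq1
      have := one_sub_mul_mem_slitPlane h1
      simpa using this
    have h1 : ContinuousAt (fun ρ : ℝ => 2 * Real.pi * (A * (ρ * z) / 2 +
        B * (ρ * z) ^ 2 / 4 - α * log (1 + q * (ρ * z))).re) 1 := by
      refine ContinuousAt.mul continuousAt_const
        (continuous_re.continuousAt.comp (ContinuousAt.sub (by fun_prop)
          (ContinuousAt.mul continuousAt_const (ContinuousAt.clog (by fun_prop) hslit))))
    have h2 := h1.tendsto
    simpa using h2
  refine tendsto_nhds_unique hlim1 (hlim2.congr' ?_)
  filter_upwards [hmem] with ρ hρ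
  rw [integral_circleWeight_mul_pairLog_of_lt hq0 hq1]
  rw [norm_mul, hz, mul_one, norm_real, Real.norm_of_nonneg hρ.1]
  exact hρ.2

end LogAverage

/-! ### The measure `nu` in the circle coordinate -/

/-- The conditions on the end points `a < b` under which `nu α a b` is an equilibrium measure. -/
structure IsArc (α a b : ℝ) : Prop where
  nonneg : 0 ≤ α
  lt : a < b
  pos : α = 0 ∨ 0 < a
  phi_nonneg : 0 ≤ phi α b a
  psi_eq : psi α b a = 0

/-- The position of the pole of the logarithmic field in the circle coordinate. -/
def arcRatio (α a b : ℝ) : ℝ := if α = 0 then 0 else (√b - √a) / (√b + √a)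

/-- The parametrization of `[a, b]` by the half circle. -/
def arcPoint (a b θ : ℝ) : ℝ := (a + b) / 2 + (b - a) / 2 * Real.cos θ

/-- The density of `nu α a b` in the circle coordinate, up to the factor `1 / π`. -/
def arcWeight (α a b θ : ℝ) : ℝ :=
  circleWeight ((b - a) / 2 * ((a + b) / 2)) (((b - a) / 2) ^ 2 / 2) (arcRatio α a b) α θ

lemma arcPoint_continuous (a b : ℝ) : Continuous (arcPoint a b) := by
  unfold arcPoint
  fun_prop

lemma arcPoint_measurable (a b : ℝ) : Measurable (arcPoint a b) := (arcPoint_continuous a b).measurable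

lemma arcPoint_mem_Icc {a b : ℝ} (hab : a ≤ b) (θ : ℝ) : arcPoint a b θ ∈ Set.Icc a b := by
  unfold arcPoint
  constructor
  · nlinarith [Real.neg_one_le_cos θ]
  · nlinarith [Real.cos_le_one θ]

lemma arcPoint_injOn {a b : ℝ} (hab : a < b) : Set.InjOn (arcPoint a b) (Set.Icc 0 Real.pi) := by
  intro x hx y hy h
  refine Real.injOn_cos hx hy ?_
  unfold arcPoint at h
  have : (b - a) / 2 ≠ 0 := by linarith
  exact mul_left_cancel₀ this (by linarith)

lemma arcPoint_image {a b : ℝ} (hab : a < b) :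
    arcPoint a b '' Set.Ioo 0 Real.pi = Set.Ioo a b := by
  ext x
  constructor
  · rintro ⟨θ, hθ, rfl⟩
    have h1 : Real.cos θ < 1 := by
      rw [← Real.cos_zero]
      exact Real.cos_lt_cos_of_nonneg_of_le_pi le_rfl hθ.2.le hθ.1
    have h2 : -1 < Real.cos θ := by
      rw [← Real.cos_pi]
      exact Real.cos_lt_cos_of_nonneg_of_le_pi hθ.1.le le_rfl hθ.2
    unfold arcPoint
    constructor <;> nlinarith
  · intro hx
    have hr : 0 < (b - a) / 2 := by linarith
    set c := (x - (a + b) / 2) / ((b - a) / 2) with hc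
    have hc1 : c < 1 := by
      rw [hc, div_lt_one hr]
      linarith [hx.2]
    have hc2 : -1 < c := by
      rw [hc, lt_div_iff₀ hr]
      linarith [hx.1]
    refine ⟨Real.arccos c, ⟨Real.arccos_pos.2 hc1, ?_⟩, ?_⟩
    · refine lt_of_le_of_ne (Real.arccos_le_pi c) fun h => ?_
      rw [Real.arccos_eq_pi] at h
      linarith
    · unfold arcPoint
      rw [Real.cos_arccos hc2.le hc1.le, hc, mul_div_cancel₀ _ hr.ne']
      ring

namespace IsArc

variable {α a b : ℝ} (h : IsArc α a b)

include h

lemma half_pos : 0 < (b - a) / 2 := by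
  have := h.lt
  linarith

lemma ratio_nonneg : 0 ≤ arcRatio α a b := by
  unfold arcRatio
  split_ifs with h0
  · exact le_rfl
  · have := Real.sqrt_le_sqrt h.lt.le
    have h2 := Real.sqrt_nonneg a
    exact div_nonneg (by linarith) (by linarith)

lemma ratio_lt_one : arcRatio α a b < 1 := by
  unfold arcRatio
  split_ifs with h0
  · exact one_pos
  · have ha := h.pos.resolve_left h0
    have hb := ha.trans h.lt
    have h1 := Real.sqrt_pos.2 ha
    have h2 := Real.sqrt_pos.2 hb
    rw [div_lt_one (by positivity)]
    linarith

lemma continuous_arcWeight : Continuous (arcWeight α a b) :=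
  continuous_circleWeight _ _ _ h.ratio_nonneg h.ratio_lt_one

/-- The Poisson denominator at the pole is a multiple of the position. -/
lemma ratio_denom (hα : α ≠ 0) (c : ℝ) :
    1 + 2 * arcRatio α a b * c + arcRatio α a b ^ 2 =
      4 / (√a + √b) ^ 2 * ((a + b) / 2 + (b - a) / 2 * c) := by
  have ha := h.pos.resolve_left hα
  have hb := ha.trans h.lt
  have h1 := Real.sqrt_pos.2 ha
  have h2 := Real.sqrt_pos.2 hb
  have e1 := Real.sq_sqrt ha.le
  have e2 := Real.sq_sqrt hb.le
  rw [arcRatio, if_neg hα]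
  generalize √a = s at *
  generalize √b = t at *
  subst e1 e2
  have : t + s ≠ 0 := by positivity
  have : s + t ≠ 0 := by positivity
  field_simp
  ring

/-- The factorization of the weight provided by `psi α b a = 0`. -/
lemma weight_factor {c : ℝ} (hc : α = 0 ∨ (a + b) / 2 + (b - a) / 2 * c ≠ 0) :
    1 - (b - a) / 2 * ((a + b) / 2) * c - ((b - a) / 2) ^ 2 / 2 * (2 * c ^ 2 - 1) -
      α * ((1 - arcRatio α a b ^ 2) / (1 + 2 * arcRatio α a b * c + arcRatio α a b ^ 2) - 1) =
    (b - a) / 2 * (1 - c) * (((a + b) / 2 + (b - a) / 2 * c) + (b - a) / 2 -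
      α * √(a / b) / ((a + b) / 2 + (b - a) / 2 * c)) := by
  have hpsi := h.psi_eq
  unfold psi at hpsi
  rcases eq_or_ne α 0 with h0 | h0
  · simp only [h0] at *
    simp only [zero_mul, zero_div, sub_zero, mul_zero, add_zero] at *
    linear_combination (-1 / 2) * hpsi
  · have hy := hc.resolve_left h0
    have ha := h.pos.resolve_left h0
    have hb := ha.trans h.lt
    rw [h.ratio_denom h0, Real.sqrt_div ha.le, arcRatio, if_neg h0]
    have h1 := Real.sqrt_pos.2 ha
    have h2 := Real.sqrt_pos.2 hb
    have e1 := Real.sq_sqrt ha.le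
    have e2 := Real.sq_sqrt hb.le
    generalize √a = s at *
    generalize √b = t at *
    have hst : t + s ≠ 0 := by positivity
    have hst' : s + t ≠ 0 := by positivity
    have k1 : (1 - ((t - s) / (t + s)) ^ 2) / (4 / (s + t) ^ 2 * ((a + b) / 2 + (b - a) / 2 * c)) =
        s * t / ((a + b) / 2 + (b - a) / 2 * c) := by
      field_simp
      ring
    rw [k1]
    set y := (a + b) / 2 + (b - a) / 2 * c with hyd
    have k2 : α * (s / t) * b = α * (s * t) := by
      rw [← e2]
      field_simp
    have k3 : α * (s * t / y) = (α * (s / t) * b) / y := by rw [k2]; ring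
    have k4 : (b - a) / 2 * (1 - c) * (α * (s / t) / y) =
        (α * (s / t) * b) / y - α * (s / t) := by
      have : (b - a) / 2 * (1 - c) = b - y := by rw [hyd]; ring
      rw [this]
      field_simp
    -- After cancellation of the `1/y` terms, the two sides differ by the value of the weight at `c
    -- = 1`, which is `-psi α b a / 2`.
    rw [mul_sub ((b - a) / 2 * (1 - c)), k4, mul_sub α, k3, mul_one, hyd]
    linear_combination (-1 / 2) * hpsi

/-- The effective force is increasing, and equals `phi α b a / 2` at the left end point. -/
lemma force_left : a + (b - a) / 2 - α * √(a / b) / a = phi α b a / 2 := by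
  unfold phi
  rcases eq_or_ne α 0 with h0 | h0
  · simp [h0]
    ring
  · have ha := h.pos.resolve_left h0
    have hb := ha.trans h.lt
    rw [Real.sqrt_div ha.le, Real.sqrt_mul ha.le]
    have h1 := Real.sqrt_pos.2 ha
    have h2 := Real.sqrt_pos.2 hb
    have e1 := Real.sq_sqrt ha.le
    have : √a / √b / a = 1 / (√a * √b) := by
      field_simp
      nlinarith
    rw [mul_div_assoc, this]
    ring

lemma force_nonneg {y : ℝ} (hy : a ≤ y) : 0 ≤ y + (b - a) / 2 - α * √(a / b) / y := by
  have h1 := h.force_left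
  have h2 := h.phi_nonneg
  rcases eq_or_ne α 0 with h0 | h0
  · simp only [h0, zero_mul, zero_div] at *
    linarith
  · have ha := h.pos.resolve_left h0
    have : α * √(a / b) / y ≤ α * √(a / b) / a := by
      have := h.nonneg
      gcongr
    linarith

lemma force_nonpos (hphi : phi α b a = 0) {y : ℝ} (hy : y ≤ a) (hpos : α = 0 ∨ 0 < y) :
    y + (b - a) / 2 - α * √(a / b) / y ≤ 0 := by
  have h1 := h.force_left
  rcases eq_or_ne α 0 with h0 | h0
  · simp only [h0, zero_mul, zero_div] at *
    linarith
  · have hy0 := hpos.resolve_left h0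
    have : α * √(a / b) / a ≤ α * √(a / b) / y := by
      have := h.nonneg
      gcongr
    linarith

lemma arcPoint_pos (hα : α ≠ 0) (θ : ℝ) : 0 < arcPoint a b θ :=
  (h.pos.resolve_left hα).trans_le (arcPoint_mem_Icc h.lt.le θ).1

lemma arcWeight_eq (θ : ℝ) : arcWeight α a b θ = (b - a) / 2 * (1 - Real.cos θ) *
    (arcPoint a b θ + (b - a) / 2 - α * √(a / b) / arcPoint a b θ) := by
  have := h.weight_factor (c := Real.cos θ) (by
    rcases eq_or_ne α 0 with h0 | h0
    · exact Or.inl h0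
    · exact Or.inr (h.arcPoint_pos h0 θ).ne')
  rw [arcWeight, circleWeight, Real.cos_two_mul, this]
  rfl

lemma arcWeight_nonneg (θ : ℝ) : 0 ≤ arcWeight α a b θ := by
  rw [h.arcWeight_eq]
  have h1 := h.force_nonneg (arcPoint_mem_Icc h.lt.le θ).1
  have h2 := Real.cos_le_one θ
  have h3 := h.half_pos
  exact mul_nonneg (mul_nonneg h3.le (by linarith)) h1

/-- The square root is `tan (θ/2) = (1 - cos θ) / sin θ`, and the factor `1 - cos θ` is the one
split off in `weight_factor`. -/
lemma nuDensity_arcPoint {θ : ℝ} (hθ : θ ∈ Set.Ioo 0 Real.pi) :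
    nuDensity α a b (arcPoint a b θ) =
      arcWeight α a b θ / (Real.pi * ((b - a) / 2 * Real.sin θ)) := by
  have hs := Real.sin_pos_of_mem_Ioo hθ
  have hr := h.half_pos
  have hc1 : 0 < 1 - Real.cos θ := by nlinarith [Real.sin_sq_add_cos_sq θ, Real.neg_one_le_cos θ]
  have hc2 : 0 < 1 + Real.cos θ := by nlinarith [Real.sin_sq_add_cos_sq θ, Real.cos_le_one θ]
  have hsq : √((b - arcPoint a b θ) / (arcPoint a b θ - a)) = (1 - Real.cos θ) / Real.sin θ := by
    rw [Real.sqrt_eq_iff_mul_self_eq_of_pos (by positivity)]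
    have : arcPoint a b θ - a = (b - a) / 2 * (1 + Real.cos θ) := by unfold arcPoint; ring
    rw [this]
    have : b - arcPoint a b θ = (b - a) / 2 * (1 - Real.cos θ) := by unfold arcPoint; ring
    rw [this, mul_div_mul_left _ _ hr.ne', div_mul_div_comm, div_eq_div_iff (by positivity)
      (by positivity)]
    linear_combination (1 - Real.cos θ) * (Real.sin_sq_add_cos_sq θ) * (-1)
  have hba : b - a ≠ 0 := by linarith
  rw [nuDensity, hsq, h.arcWeight_eq]
  have := Real.pi_pos
  generalize arcPoint a b θ = x
  rw [eq_div_iff (by positivity)]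
  field_simp
  ring

lemma nuDensity_nonneg {x : ℝ} (hx : a ≤ x) : 0 ≤ nuDensity α a b x := by
  have h1 := h.force_nonneg hx
  have h2 : 2 * x + b - a - 2 * α * √(a / b) * (1 / x) =
    2 * (x + (b - a) / 2 - α * √(a / b) / x) := by ring
  rw [nuDensity, h2]
  have := Real.pi_pos
  positivity

end IsArc

/-- The measure `nu α a b` in the circle coordinate. -/
def arcMeasure (α a b : ℝ) : Measure ℝ :=
  (volume.restrict (Set.Ioo 0 Real.pi)).withDensity fun θ =>
    ENNReal.ofReal (arcWeight α a b θ / Real.pi)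

lemma measurable_nuDensity (α a b : ℝ) : Measurable (nuDensity α a b) := by
  unfold nuDensity
  fun_prop

namespace IsArc

variable {α a b : ℝ} (h : IsArc α a b)

include h

lemma nu_eq_map : nu α a b = (arcMeasure α a b).map (arcPoint a b) := by
  have hm := arcPoint_measurable a b
  ext S hS
  rw [Measure.map_apply hm hS, nu, withDensity_apply _ hS, arcMeasure,
    withDensity_apply _ (hm hS), Measure.restrict_restrict hS, Measure.restrict_restrict (hm hS),
    ← lintegral_indicator (hS.inter measurableSet_Ioc),
    ← lintegral_indicator ((hm hS).inter measurableSet_Ioo)]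
  have e1 : ∀ x, (S ∩ Set.Ioc a b).indicator (fun x => ENNReal.ofReal (nuDensity α a b x)) x =
      (Set.Ioc a b).indicator (S.indicator fun x => ENNReal.ofReal (nuDensity α a b x)) x := by
    intro x
    rw [Set.indicator_indicator, Set.inter_comm]
  have e2 : ∀ θ, (arcPoint a b ⁻¹' S ∩ Set.Ioo 0 Real.pi).indicator
      (fun θ => ENNReal.ofReal (arcWeight α a b θ / Real.pi)) θ =
      (Set.Ioo 0 Real.pi).indicator (fun θ => ENNReal.ofReal |-((b - a) / 2 * Real.sin θ)| *
        S.indicator (fun x => ENNReal.ofReal (nuDensity α a b x)) (arcPoint a b θ)) θ := by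
    intro θ
    by_cases hθ : θ ∈ Set.Ioo 0 Real.pi
    · rw [Set.indicator_of_mem hθ]
      by_cases hS : arcPoint a b θ ∈ S
      · have hs := Real.sin_pos_of_mem_Ioo hθ
        have hr := h.half_pos
        rw [Set.indicator_of_mem (show θ ∈ arcPoint a b ⁻¹' S ∩ Set.Ioo 0 Real.pi from ⟨hS, hθ⟩), Set.indicator_of_mem hS, h.nuDensity_arcPoint hθ,
          ← ENNReal.ofReal_mul (abs_nonneg _), abs_neg, abs_of_pos (by positivity)]
        congr 1
        have := Real.pi_pos
        rw [mul_comm Real.pi, ← div_div, mul_div_assoc', mul_div_cancel₀]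
        positivity
      · rw [Set.indicator_of_notMem hS, Set.indicator_of_notMem (fun h => hS h.1), mul_zero]
    · rw [Set.indicator_of_notMem hθ, Set.indicator_of_notMem fun h => hθ h.2]
  simp_rw [e1, e2]
  rw [lintegral_indicator measurableSet_Ioc, lintegral_indicator measurableSet_Ioo,
    ← restrict_Ioo_eq_restrict_Ioc, ← arcPoint_image h.lt]
  refine lintegral_image_eq_lintegral_abs_deriv_mul measurableSet_Ioo (fun θ _ => ?_)
    ((arcPoint_injOn h.lt).mono Set.Ioo_subset_Icc_self) _
  have := ((Real.hasDerivAt_cos θ).const_mul ((b - a) / 2)).const_add ((a + b) / 2)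
  rw [mul_neg] at this
  exact this.hasDerivWithinAt

/-- The cosine terms integrate to zero over the half circle and the Poisson kernel has mean one, so
only the constant term of the weight contributes. -/
lemma isProbabilityMeasure_arcMeasure : IsProbabilityMeasure (arcMeasure α a b) := by
  refine ⟨?_⟩
  have hc := h.continuous_arcWeight
  rw [arcMeasure, withDensity_apply _ MeasurableSet.univ, Measure.restrict_univ,
    ← ofReal_integral_eq_lintegral_ofReal]
  · rw [← integral_Ioc_eq_integral_Ioo, ← intervalIntegral.integral_of_le Real.pi_pos.le,
      intervalIntegral.integral_div]
    unfold arcWeight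
    rw [integral_circleWeight h.ratio_nonneg h.ratio_lt_one, div_self Real.pi_ne_zero,
      ENNReal.ofReal_one]
  · exact ((hc.div_const _).integrableOn_Icc (a := 0) (b := Real.pi)).mono_set
      Set.Ioo_subset_Icc_self
  · exact Eventually.of_forall fun θ => div_nonneg (h.arcWeight_nonneg θ) Real.pi_pos.le

lemma isProbabilityMeasure_nu : IsProbabilityMeasure (nu α a b) := by
  rw [h.nu_eq_map]
  have := h.isProbabilityMeasure_arcMeasure
  exact Measure.isProbabilityMeasure_map (arcPoint_measurable a b).aemeasurable

lemma integral_arcMeasure (g : ℝ → ℝ) :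
    ∫ θ, g θ ∂(arcMeasure α a b) =
      Real.pi⁻¹ * ∫ θ in (0 : ℝ)..Real.pi, arcWeight α a b θ * g θ := by
  have hc := h.continuous_arcWeight
  rw [arcMeasure, integral_withDensity_eq_integral_toReal_smul
    (hc.div_const _).measurable.ennreal_ofReal (Eventually.of_forall fun _ => ENNReal.ofReal_lt_top),
    intervalIntegral.integral_of_le Real.pi_pos.le, integral_Ioc_eq_integral_Ioo,
    ← integral_const_mul]
  refine integral_congr_ae (Eventually.of_forall fun θ => ?_)
  simp only [smul_eq_mul]
  rw [ENNReal.toReal_ofReal (div_nonneg (h.arcWeight_nonneg θ) Real.pi_pos.le)]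
  ring

lemma integrable_arcMeasure {g : ℝ → ℝ}
    (hg : IntervalIntegrable (fun θ => arcWeight α a b θ * g θ) volume 0 Real.pi) :
    Integrable g (arcMeasure α a b) := by
  have hc := h.continuous_arcWeight
  rw [arcMeasure, integrable_withDensity_iff_integrable_smul'
    (hc.div_const _).measurable.ennreal_ofReal (Eventually.of_forall fun _ => ENNReal.ofReal_lt_top)]
  rw [intervalIntegrable_iff, Set.uIoc_of_le Real.pi_pos.le,
    integrableOn_Ioc_iff_integrableOn_Ioo] at hg
  refine (hg.const_mul Real.pi⁻¹).congr (Eventually.of_forall fun θ => ?_)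
  simp only [smul_eq_mul]
  rw [ENNReal.toReal_ofReal (div_nonneg (h.arcWeight_nonneg θ) Real.pi_pos.le)]
  ring

end IsArc

/-! ### The potential in the Joukowski coordinate -/

/-- The constant value of the total potential on `[a, b]`. -/
def arcConst (α a b : ℝ) : ℝ :=
  -2 * Real.log ((b - a) / 4) + ((a + b) / 2) ^ 2 + ((b - a) / 2) ^ 2 / 2 +
    2 * α * Real.log (4 / (√a + √b) ^ 2)

namespace IsArc

variable {α a b : ℝ} (h : IsArc α a b)

include h

open Complex in
/-- The logarithmic potential in the coordinate of the Joukowski map. -/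
lemma logPotential_nu {z : ℂ} (hz0 : z ≠ 0) (hz : ‖z‖ ≤ 1) {y : ℝ}
    (hy : (y : ℂ) = (a + b) / 2 + (b - a) / 4 * (z + z⁻¹)) :
    logPotential (nu α a b) y = -Real.log ((b - a) / 4) + Real.log ‖z‖ -
      ((b - a) / 2 * ((a + b) / 2) * z + ((b - a) / 2) ^ 2 * z ^ 2 / 4 -
        2 * α * log (1 + arcRatio α a b * z)).re := by
  have hr := h.half_pos
  have hm := arcPoint_measurable a b
  rw [logPotential, h.nu_eq_map, integral_map hm.aemeasurable
    (f := fun x => logKernel 0 (y - x))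
    (measurable_logKernel.comp (measurable_const.sub measurable_id)).aestronglyMeasurable, h.integral_arcMeasure]
  have key : ∀ θ : ℝ, z * exp (θ * I) ≠ 1 → z * exp ((-θ : ℝ) * I) ≠ 1 →
      logKernel 0 (y - arcPoint a b θ) =
        (-Real.log ((b - a) / 4) + Real.log ‖z‖) - pairLog z θ := by
    intro θ h1 h2
    have e1 : exp (θ * I) * exp ((-θ : ℝ) * I) = 1 := by
      rw [← exp_add]
      push_cast
      rw [neg_mul, add_neg_cancel, exp_zero]
    have e2 : exp (θ * I) + exp ((-θ : ℝ) * I) = 2 * (Real.cos θ : ℂ) := by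
      rw [ofReal_cos, cos]
      push_cast
      ring
    -- The Joukowski map factors `y - x` into two factors `1 - z e^{±iθ}`, whose logarithms make up
    -- `pairLog`.
    have e3 : ((y - arcPoint a b θ : ℝ) : ℂ) = (((b - a) / 4 : ℝ) : ℂ) * z⁻¹ *
        ((1 - z * exp (θ * I)) * (1 - z * exp ((-θ : ℝ) * I))) := by
      have e4 : (1 - z * exp (θ * I)) * (1 - z * exp ((-θ : ℝ) * I)) =
          z * (z + z⁻¹ - 2 * (Real.cos θ : ℂ)) := by
        have : z * z⁻¹ = 1 := mul_inv_cancel₀ hz0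
        linear_combination z ^ 2 * e1 - z * e2 - this
      rw [e4, mul_assoc, inv_mul_cancel_left₀ hz0]
      unfold arcPoint
      push_cast
      rw [hy]
      ring
    have n1 : ‖1 - z * exp (θ * I)‖ ≠ 0 := norm_ne_zero_iff.2 (sub_ne_zero.2 h1.symm)
    have n2 : ‖1 - z * exp ((-θ : ℝ) * I)‖ ≠ 0 := norm_ne_zero_iff.2 (sub_ne_zero.2 h2.symm)
    have n3 : ‖z‖ ≠ 0 := norm_ne_zero_iff.2 hz0
    rw [logKernel_zero, ← Real.log_abs, ← Real.norm_eq_abs, ← norm_real, e3, norm_mul, norm_mul,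
      norm_mul, norm_real, norm_inv, Real.norm_of_nonneg (by linarith),
      Real.log_mul (mul_ne_zero (by linarith) (inv_ne_zero n3)) (mul_ne_zero n1 n2),
      Real.log_mul (by linarith) (inv_ne_zero n3), Real.log_mul n1 n2, Real.log_inv, pairLog]
    ring
  have hc := h.continuous_arcWeight
  have hint : ∫ θ in (0 : ℝ)..Real.pi, arcWeight α a b θ * logKernel 0 (y - arcPoint a b θ) =
      ∫ θ in (0 : ℝ)..Real.pi, ((-Real.log ((b - a) / 4) + Real.log ‖z‖) * arcWeight α a b θ -
        arcWeight α a b θ * pairLog z θ) := by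
    refine intervalIntegral.integral_congr_ae ?_
    filter_upwards [Measure.ae_ne volume (Real.arccos z.re)] with θ hθ hθm
    rw [Set.uIoc_of_le Real.pi_pos.le] at hθm
    have : z * exp (θ * I) ≠ 1 ∧ z * exp ((-θ : ℝ) * I) ≠ 1 := by
      rcases hz.lt_or_eq with hz | hz
      · constructor <;>
        · intro h1
          have := congrArg norm h1
          rw [norm_mul_exp, norm_one] at this
          linarith
      · exact mul_exp_ne_one hz ⟨hθm.1.le, hθm.2⟩ hθ
    rw [key θ this.1 this.2]
    ring
  have hi : IntervalIntegrable (fun θ => arcWeight α a b θ * pairLog z θ) volume 0 Real.pi :=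
    (intervalIntegrable_pairLog hz).continuousOn_mul hc.continuousOn
  rw [hint, intervalIntegral.integral_sub ((hc.intervalIntegrable _ _).const_mul _) hi,
    intervalIntegral.integral_const_mul]
  unfold arcWeight
  rw [integral_circleWeight h.ratio_nonneg h.ratio_lt_one,
    integral_circleWeight_mul_pairLog h.ratio_nonneg h.ratio_lt_one hz]
  have e5 : ((b - a) / 2 * ((a + b) / 2) * z + ((b - a) / 2) ^ 2 * z ^ 2 / 4 -
        2 * α * log (1 + arcRatio α a b * z)) =
      ((2 : ℝ) : ℂ) * ((((b - a) / 2 * ((a + b) / 2) : ℝ) : ℂ) * z / 2 +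
        ((((b - a) / 2) ^ 2 / 2 : ℝ) : ℂ) * z ^ 2 / 4 - α * log (1 + arcRatio α a b * z)) := by
    push_cast
    ring
  rw [e5, re_ofReal_mul]
  have := Real.pi_ne_zero
  field_simp

lemma ratio_denom_log {c : ℝ} (hc : α = 0 ∨ (a + b) / 2 + (b - a) / 2 * c ≠ 0) :
    α * Real.log (1 + 2 * arcRatio α a b * c + arcRatio α a b ^ 2) =
      α * Real.log (4 / (√a + √b) ^ 2) + α * Real.log ((a + b) / 2 + (b - a) / 2 * c) := by
  rcases eq_or_ne α 0 with h0 | h0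
  · simp [h0]
  · have h1 := Real.sqrt_pos.2 (h.pos.resolve_left h0)
    have h2 := Real.sqrt_nonneg b
    rw [h.ratio_denom h0, Real.log_mul (by positivity) (hc.resolve_left h0)]
    ring

open Complex in
-- On `[a, b]` the Joukowski coordinate is `z = e^{iφ}`. The real parts of `z`, `z²` and `log (1 + q
-- z)` then reproduce exactly `cos φ`, `cos 2φ` and the logarithm of the Poisson denominator, which
-- cancel the field up to a constant.
lemma potential_eq_arcConst {y : ℝ} (hy : y ∈ Set.Icc a b) :
    2 * logPotential (nu α a b) y + y ^ 2 - 2 * α * Real.log y = arcConst α a b := by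
  have hr := h.half_pos
  obtain ⟨φ, rfl⟩ : ∃ φ, y = arcPoint a b φ := by
    set c := (y - (a + b) / 2) / ((b - a) / 2) with hc
    have hc1 : c ≤ 1 := by
      rw [hc, div_le_one hr]
      linarith [hy.2]
    have hc2 : -1 ≤ c := by
      rw [hc, le_div_iff₀ hr]
      linarith [hy.1]
    refine ⟨Real.arccos c, ?_⟩
    rw [arcPoint, Real.cos_arccos hc2 hc1, hc, mul_div_cancel₀ _ hr.ne']
    ring
  have hzn : ‖exp (φ * I)‖ = 1 := norm_exp_ofReal_mul_I φ
  have hexp : exp (φ * I) = (Real.cos φ : ℂ) + (Real.sin φ : ℂ) * I := by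
    rw [exp_mul_I, ofReal_cos, ofReal_sin]
  have hinv : (exp (φ * I))⁻¹ = (Real.cos φ : ℂ) - (Real.sin φ : ℂ) * I := by
    rw [← exp_neg, ← neg_mul, exp_mul_I, cos_neg, sin_neg, ofReal_cos, ofReal_sin]
    ring
  rw [h.logPotential_nu (exp_ne_zero (φ * I)) hzn.le (by
    rw [hinv, hexp]
    unfold arcPoint
    push_cast
    ring), hzn, Real.log_one]
  have hsq : (exp (φ * I)) ^ 2 = (Real.cos (2 * φ) : ℂ) + (Real.sin (2 * φ) : ℂ) * I := by
    rw [← exp_nat_mul, ofReal_cos, ofReal_sin, ← exp_mul_I]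
    push_cast
    ring_nf
  have hlog : (log (1 + arcRatio α a b * exp (φ * I))).re =
      Real.log (1 + 2 * arcRatio α a b * Real.cos φ + arcRatio α a b ^ 2) / 2 := by
    have : ‖1 + arcRatio α a b * exp (φ * I)‖ ^ 2 =
        1 + 2 * arcRatio α a b * Real.cos φ + arcRatio α a b ^ 2 := by
      rw [← normSq_eq_norm_sq, hexp]
      have : 1 + (arcRatio α a b : ℂ) * (Real.cos φ + Real.sin φ * I) =
        ((1 + arcRatio α a b * Real.cos φ : ℝ) : ℂ) + ((arcRatio α a b * Real.sin φ : ℝ) : ℂ) * I := by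
        push_cast
        ring
      rw [this, normSq_add_mul_I]
      linear_combination arcRatio α a b ^ 2 * Real.sin_sq_add_cos_sq φ
    rw [log_re, ← this, Real.log_pow]
    push_cast
    ring
  have hre : ((b - a) / 2 * ((a + b) / 2) * exp (φ * I) +
      ((b - a) / 2) ^ 2 * exp (φ * I) ^ 2 / 4 -
        2 * α * log (1 + arcRatio α a b * exp (φ * I)) : ℂ).re =
      (b - a) / 2 * ((a + b) / 2) * Real.cos φ + ((b - a) / 2) ^ 2 / 4 * Real.cos (2 * φ) -
        α * Real.log (1 + 2 * arcRatio α a b * Real.cos φ + arcRatio α a b ^ 2) := by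
    have e : ((b - a) / 2 * ((a + b) / 2) * exp (φ * I) +
      ((b - a) / 2) ^ 2 * exp (φ * I) ^ 2 / 4 -
        2 * α * log (1 + arcRatio α a b * exp (φ * I)) : ℂ) =
        (((b - a) / 2 * ((a + b) / 2) : ℝ) : ℂ) * exp (φ * I) +
      ((((b - a) / 2) ^ 2 / 4 : ℝ) : ℂ) * exp (φ * I) ^ 2 -
        ((2 * α : ℝ) : ℂ) * log (1 + arcRatio α a b * exp (φ * I)) := by
      push_cast
      ring
    rw [e, sub_re, add_re, re_ofReal_mul, re_ofReal_mul, re_ofReal_mul, hlog, hsq,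
      exp_ofReal_mul_I_re, add_re, re_ofReal_mul, ofReal_re, I_re]
    ring
  rw [hre, h.ratio_denom_log (by
    rcases eq_or_ne α 0 with h0 | h0
    · exact Or.inl h0
    · exact Or.inr (h.arcPoint_pos h0 φ).ne'), Real.cos_two_mul]
  unfold arcConst arcPoint
  ring

/-- The difference between the total potential and its value on `[a, b]`, in the coordinate of
the Joukowski map. -/
lemma potential_sub_arcConst {z y : ℝ} (hz0 : z ≠ 0) (hz : |z| ≤ 1)
    (hy : y = (a + b) / 2 + (b - a) / 4 * (z + z⁻¹)) (hpos : α = 0 ∨ y ≠ 0) :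
    2 * logPotential (nu α a b) y + y ^ 2 - 2 * α * Real.log y - arcConst α a b =
      2 * Real.log z - (b - a) / 2 * ((a + b) / 2) * (z - z⁻¹) -
        ((b - a) / 2) ^ 2 / 4 * (z ^ 2 - (z⁻¹) ^ 2) +
        2 * α * (Real.log (1 + arcRatio α a b * z) - Real.log (1 + arcRatio α a b * z⁻¹)) := by
  have hlog : (Complex.log (1 + arcRatio α a b * (z : ℂ))).re =
      Real.log (1 + arcRatio α a b * z) := by
    rw [Complex.log_re, ← Real.log_abs (1 + arcRatio α a b * z), ← Real.norm_eq_abs,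
      ← Complex.norm_real]
    push_cast
    rfl
  have hre : ((b - a) / 2 * ((a + b) / 2) * (z : ℂ) +
      ((b - a) / 2) ^ 2 * (z : ℂ) ^ 2 / 4 -
        2 * α * Complex.log (1 + arcRatio α a b * z) : ℂ).re =
      (b - a) / 2 * ((a + b) / 2) * z + ((b - a) / 2) ^ 2 / 4 * z ^ 2 -
        2 * α * Real.log (1 + arcRatio α a b * z) := by
    have e : ((b - a) / 2 * ((a + b) / 2) * (z : ℂ) +
      ((b - a) / 2) ^ 2 * (z : ℂ) ^ 2 / 4 -
        2 * α * Complex.log (1 + arcRatio α a b * z) : ℂ) =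
        (((b - a) / 2 * ((a + b) / 2) * z + ((b - a) / 2) ^ 2 / 4 * z ^ 2 : ℝ) : ℂ) -
        ((2 * α : ℝ) : ℂ) * Complex.log (1 + arcRatio α a b * z) := by
      push_cast
      ring
    rw [e, Complex.sub_re, Complex.ofReal_re, Complex.re_ofReal_mul, hlog]
  have hc : (a + b) / 2 + (b - a) / 2 * ((z + z⁻¹) / 2) = y := by rw [hy]; ring
  have hd := h.ratio_denom_log (c := (z + z⁻¹) / 2) (by rwa [hc])
  have hzz : z * z⁻¹ = 1 := mul_inv_cancel₀ hz0
  have hprod : 1 + 2 * arcRatio α a b * ((z + z⁻¹) / 2) + arcRatio α a b ^ 2 =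
      (1 + arcRatio α a b * z) * (1 + arcRatio α a b * z⁻¹) := by
    linear_combination (-arcRatio α a b ^ 2) * hzz
  have hq0 := h.ratio_nonneg
  have hq1 := h.ratio_lt_one
  have hsplit : α * Real.log (1 + 2 * arcRatio α a b * ((z + z⁻¹) / 2) + arcRatio α a b ^ 2) =
      α * (Real.log (1 + arcRatio α a b * z) + Real.log (1 + arcRatio α a b * z⁻¹)) := by
    rcases eq_or_ne α 0 with h0 | h0
    · simp [h0]
    · have h1 := Real.sqrt_pos.2 (h.pos.resolve_left h0)
      have h2 := Real.sqrt_nonneg b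
      have h3 : (1 + arcRatio α a b * z) * (1 + arcRatio α a b * z⁻¹) ≠ 0 := by
        rw [← hprod, h.ratio_denom h0, hc]
        exact mul_ne_zero (by positivity) (hpos.resolve_left h0)
      rw [hprod, Real.log_mul (left_ne_zero_of_mul h3) (right_ne_zero_of_mul h3)]
  rw [hsplit, hc] at hd
  rw [h.logPotential_nu (z := (z : ℂ)) (by exact_mod_cast hz0)
    (by rwa [Complex.norm_real, Real.norm_eq_abs]) (by rw [hy]; push_cast; rfl), hre,
    Complex.norm_real, Real.norm_eq_abs, Real.log_abs, arcConst]
  have hy2 : y ^ 2 = ((a + b) / 2) ^ 2 + (b - a) / 2 * ((a + b) / 2) * (z + z⁻¹) +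
      ((b - a) / 2) ^ 2 / 4 * (z ^ 2 + 2 + (z⁻¹) ^ 2) := by
    rw [hy]
    linear_combination (((b - a) / 2) ^ 2 / 2) * hzz
  rw [hy2]
  linear_combination 2 * hd

end IsArc

/-! ### Frostman's inequality off the support -/

/-- The excess of the total potential over its value on the support, in the coordinate `z` of the
Joukowski map. -/
def joukowskiExcess (A R α q z : ℝ) : ℝ :=
  2 * Real.log z - A * (z - z⁻¹) - R ^ 2 / 4 * (z ^ 2 - (z⁻¹) ^ 2) +
    2 * α * (Real.log (1 + q * z) - Real.log (1 + q * z⁻¹))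

/-- The derivative is `2/z` times the circle weight with `cos θ` continued to `(z + z⁻¹)/2`, so its
sign can be read off `weight_factor`. -/
lemma hasDerivAt_joukowskiExcess (A R α : ℝ) {q z : ℝ} (hz : z ≠ 0) (h1 : 1 + q * z ≠ 0)
    (h2 : 1 + q * z⁻¹ ≠ 0) :
    HasDerivAt (joukowskiExcess A R α q)
      (2 / z * (1 - A * ((z + z⁻¹) / 2) - R ^ 2 / 2 * (2 * ((z + z⁻¹) / 2) ^ 2 - 1) -
        α * ((1 - q ^ 2) / (1 + 2 * q * ((z + z⁻¹) / 2) + q ^ 2) - 1))) z := by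
  have d0 := hasDerivAt_id z
  have di := hasDerivAt_inv hz
  have dl := Real.hasDerivAt_log hz
  have e1 := ((d0.const_mul q).const_add 1).log h1
  have e2 := ((di.const_mul q).const_add 1).log h2
  have key := (((dl.const_mul 2).sub ((d0.sub di).const_mul A)).sub
    (((d0.pow 2).sub (di.pow 2)).const_mul (R ^ 2 / 4))).add ((e1.sub e2).const_mul (2 * α))
  refine HasDerivAt.congr_deriv key ?_
  have hden : 1 + 2 * q * ((z + z⁻¹) / 2) + q ^ 2 = (1 + q * z) * (1 + q * z⁻¹) := by
    field_simp
    ring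
  have hzw : z * z⁻¹ = 1 := mul_inv_cancel₀ hz
  have hα : q / (1 + q * z) + q * z⁻¹ ^ 2 / (1 + q * z⁻¹) =
      z⁻¹ * (1 - (1 - q ^ 2) / ((1 + q * z) * (1 + q * z⁻¹))) := by
    rw [div_add_div _ _ h1 h2, one_sub_div (mul_ne_zero h1 h2), mul_div_assoc']
    congr 1
    linear_combination (-(q ^ 2 * z⁻¹ + q) + q ^ 2 * z⁻¹) * hzw
  rw [hden, div_eq_mul_inv 2 z, ← inv_pow]
  simp only [id_eq]
  linear_combination (2 * α) * hα +
    (A + R ^ 2 / 2 * z + R ^ 2 * z⁻¹) * hzw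

lemma joukowskiExcess_one (A R α q : ℝ) : joukowskiExcess A R α q 1 = 0 := by
  simp [joukowskiExcess]

lemma joukowskiExcess_neg_one (A R α q : ℝ) : joukowskiExcess A R α q (-1) = 0 := by
  simp [joukowskiExcess, inv_neg]

lemma exists_joukowski {Y : ℝ} (hY : 1 < Y) : ∃ z : ℝ, 0 < z ∧ z < 1 ∧ z + z⁻¹ = 2 * Y := by
  have h0 : 0 < Y ^ 2 - 1 := by nlinarith
  have h1 := Real.sq_sqrt h0.le
  have h2 := Real.sqrt_pos.2 h0
  have h3 : (Y - √(Y ^ 2 - 1)) * (Y + √(Y ^ 2 - 1)) = 1 := by linear_combination -h1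
  have h4 : 0 < Y - √(Y ^ 2 - 1) := by
    by_contra hc
    nlinarith
  refine ⟨Y - √(Y ^ 2 - 1), h4, by nlinarith, ?_⟩
  rw [inv_eq_of_mul_eq_one_right h3]
  ring

namespace IsArc

variable {α a b : ℝ} (h : IsArc α a b)

include h

/-- For `y > b` the coordinate lies in `(0, 1)`, where `1 - c ≤ 0` and the force is nonnegative. The
excess therefore decreases to its value `0` at `z = 1`. -/
lemma arcConst_le_of_right {y : ℝ} (hy : b < y) :
    arcConst α a b ≤ 2 * logPotential (nu α a b) y + y ^ 2 - 2 * α * Real.log y := by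
  have hr := h.half_pos
  have hq0 := h.ratio_nonneg
  obtain ⟨z, hz0, hz1, hz⟩ := exists_joukowski (Y := (y - (a + b) / 2) / ((b - a) / 2)) (by
    rw [lt_div_iff₀ hr]
    linarith)
  have hyz : y = (a + b) / 2 + (b - a) / 4 * (z + z⁻¹) := by
    rw [hz]
    field_simp [(by linarith [h.lt] : b - a ≠ 0)]
    ring
  have hD := h.potential_sub_arcConst hz0.ne' (by rw [abs_of_pos hz0]; exact hz1.le) hyz (by
    rcases eq_or_ne α 0 with h0 | h0
    · exact Or.inl h0
    · exact Or.inr (((h.pos.resolve_left h0).trans h.lt).trans hy).ne')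
  have hder : ∀ x ∈ Set.Icc z 1, HasDerivAt
      (joukowskiExcess ((b - a) / 2 * ((a + b) / 2)) ((b - a) / 2) α (arcRatio α a b)) _ x :=
    fun x hx => by
      have hx0 : 0 < x := hz0.trans_le hx.1
      exact hasDerivAt_joukowskiExcess _ _ _ hx0.ne' (by positivity) (by positivity)
  have hanti : AntitoneOn (joukowskiExcess ((b - a) / 2 * ((a + b) / 2)) ((b - a) / 2) α
      (arcRatio α a b)) (Set.Icc z 1) := by
    refine antitoneOn_of_deriv_nonpos (convex_Icc _ _)
      (fun x hx => (hder x hx).continuousAt.continuousWithinAt)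
      (fun x hx => (hder x (interior_subset hx)).differentiableAt.differentiableWithinAt) ?_
    intro x hx
    have hx' := interior_subset hx
    have hx0 : 0 < x := hz0.trans_le hx'.1
    have hc : 1 ≤ (x + x⁻¹) / 2 := by
      have : x * x⁻¹ = 1 := mul_inv_cancel₀ hx0.ne'
      nlinarith [sq_nonneg (x - x⁻¹), inv_pos.2 hx0]
    have hy' : b ≤ (a + b) / 2 + (b - a) / 2 * ((x + x⁻¹) / 2) := by nlinarith
    rw [(hder x hx').deriv, h.weight_factor (by
      rcases eq_or_ne α 0 with h0 | h0
      · exact Or.inl h0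
      · exact Or.inr (((h.pos.resolve_left h0).trans h.lt).trans_le hy').ne')]
    have hf := h.force_nonneg (h.lt.le.trans hy')
    refine mul_nonpos_of_nonneg_of_nonpos (by positivity) ?_
    refine mul_nonpos_of_nonpos_of_nonneg ?_ hf
    exact mul_nonpos_of_nonneg_of_nonpos hr.le (by linarith)
  have := hanti ⟨le_rfl, hz1.le⟩ ⟨hz1.le, le_rfl⟩ hz1.le
  rw [joukowskiExcess_one, joukowskiExcess, ← hD] at this
  linarith

/-- For `y < a` the coordinate is `-s` with `0 < s < 1`. Now `1 - c > 0`, and `phi = 0` makes the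
force nonpositive left of `a`, so the excess increases from its value `0` at `z = -1`. -/
lemma arcConst_le_of_left (hphi : phi α b a = 0) {y : ℝ} (hy : y < a) (hpos : α = 0 ∨ 0 < y) :
    arcConst α a b ≤ 2 * logPotential (nu α a b) y + y ^ 2 - 2 * α * Real.log y := by
  have hr := h.half_pos
  have hq0 := h.ratio_nonneg
  have hq1 := h.ratio_lt_one
  obtain ⟨s, hs0, hs1, hs⟩ := exists_joukowski (Y := ((a + b) / 2 - y) / ((b - a) / 2)) (by
    rw [lt_div_iff₀ hr]
    linarith)
  have hyz : y = (a + b) / 2 + (b - a) / 4 * (-s + (-s)⁻¹) := by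
    rw [inv_neg, ← neg_add, hs]
    field_simp [(by linarith [h.lt] : b - a ≠ 0)]
    ring
  have hD := h.potential_sub_arcConst (neg_ne_zero.2 hs0.ne') (by
    rw [abs_neg, abs_of_pos hs0]; exact hs1.le) hyz (by
    rcases hpos with h0 | h0
    · exact Or.inl h0
    · exact Or.inr h0.ne')
  -- the pole lies outside the unit disc image of `[y, a]`
  have hqs : arcRatio α a b < s := by
    rcases hpos with h0 | h0
    · rwa [arcRatio, if_pos h0]
    · rcases eq_or_ne α 0 with h1 | h1
      · rwa [arcRatio, if_pos h1]
      have h2 := h.ratio_denom h1 ((-s + (-s)⁻¹) / 2)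
      have h3 : (a + b) / 2 + (b - a) / 2 * ((-s + (-s)⁻¹) / 2) = y := by rw [hyz]; ring
      have h4 := Real.sqrt_pos.2 (h.pos.resolve_left h1)
      have h5 := Real.sqrt_nonneg b
      have h6 : 0 < 4 / (√a + √b) ^ 2 * y := by positivity
      rw [h3] at h2
      rw [← h2] at h6
      -- Positivity of `y` makes this quotient positive; as `1 - q s > 0`, it follows that `q < s`.
      have h7 : 1 + 2 * arcRatio α a b * ((-s + (-s)⁻¹) / 2) + arcRatio α a b ^ 2 =
        (1 - arcRatio α a b * s) * (s - arcRatio α a b) / s := by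
        rw [inv_neg]
        field_simp
        ring
      rw [h7, div_pos_iff_of_pos_right hs0] at h6
      have h8 : 0 < 1 - arcRatio α a b * s := by nlinarith
      linarith [(pos_iff_pos_of_mul_pos h6).1 h8]
  have hder : ∀ x ∈ Set.Icc (-1) (-s), HasDerivAt
      (joukowskiExcess ((b - a) / 2 * ((a + b) / 2)) ((b - a) / 2) α (arcRatio α a b)) _ x :=
    fun x hx => by
      have hx0 : x < 0 := by linarith [hx.2]
      refine hasDerivAt_joukowskiExcess _ _ _ hx0.ne (by nlinarith [hx.1]) ?_
      intro h0
      have : x + arcRatio α a b = 0 := by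
        have h1 : x * (1 + arcRatio α a b * x⁻¹) = x + arcRatio α a b := by
          rw [mul_add, mul_left_comm, mul_inv_cancel₀ hx0.ne]
          ring
        rw [← h1, h0, mul_zero]
      linarith [hx.2]
  have hmono : MonotoneOn (joukowskiExcess ((b - a) / 2 * ((a + b) / 2)) ((b - a) / 2) α
      (arcRatio α a b)) (Set.Icc (-1) (-s)) := by
    refine monotoneOn_of_deriv_nonneg (convex_Icc _ _)
      (fun x hx => (hder x hx).continuousAt.continuousWithinAt)
      (fun x hx => (hder x (interior_subset hx)).differentiableAt.differentiableWithinAt) ?_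
    intro x hx
    have hx' := interior_subset hx
    have hx0 : x < 0 := by linarith [hx'.2]
    have hxi := inv_lt_zero.2 hx0
    have hxx : x * x⁻¹ = 1 := mul_inv_cancel₀ hx0.ne
    have hc : (x + x⁻¹) / 2 ≤ -1 := by
      nlinarith [sq_nonneg (x - x⁻¹)]
    -- Every point of `[-1, -s]` corresponds to a position in `[y, a]`, hence positive when `α > 0`.
    have hc2 : -s + (-s)⁻¹ ≤ x + x⁻¹ := by
      have hss : s * s⁻¹ = 1 := mul_inv_cancel₀ hs0.ne'
      have h1 : x + x⁻¹ - (-s + (-s)⁻¹) = (x + s) * (1 + x⁻¹ * s⁻¹) := by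
        rw [inv_neg]
        linear_combination (-s⁻¹) * hxx - x⁻¹ * hss
      have h2 : x⁻¹ ≤ -1 := by nlinarith [hx'.1]
      have h3 : 1 ≤ s⁻¹ := (one_le_inv₀ hs0).2 hs1.le
      have h4 : 0 ≤ (x + s) * (1 + x⁻¹ * s⁻¹) :=
        mul_nonneg_of_nonpos_of_nonpos (by linarith [hx'.2]) (by nlinarith)
      linarith
    have hy1 : (a + b) / 2 + (b - a) / 2 * ((x + x⁻¹) / 2) ≤ a := by nlinarith
    have hy2 : y ≤ (a + b) / 2 + (b - a) / 2 * ((x + x⁻¹) / 2) := by nlinarith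
    have hpos' : α = 0 ∨ 0 < (a + b) / 2 + (b - a) / 2 * ((x + x⁻¹) / 2) :=
      hpos.imp_right fun h0 => h0.trans_le hy2
    rw [(hder x hx').deriv, h.weight_factor (hpos'.imp_right ne_of_gt)]
    have hf := h.force_nonpos hphi hy1 hpos'
    refine mul_nonneg_of_nonpos_of_nonpos (div_nonpos_of_nonneg_of_nonpos zero_le_two hx0.le) ?_
    refine mul_nonpos_of_nonneg_of_nonpos ?_ hf
    exact mul_nonneg hr.le (by linarith)
  have h1s : (-1 : ℝ) ≤ -s := by linarith
  have := hmono ⟨le_rfl, h1s⟩ ⟨h1s, le_rfl⟩ h1s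
  rw [joukowskiExcess_neg_one, joukowskiExcess, ← hD] at this
  linarith

end IsArc

/-! ### Regularity of the arc measure and the equilibrium property -/

lemma lintegral_abs_rpow_lt_top (R : ℝ) (hR : 0 ≤ R) :
    ∫⁻ u in Set.Ioo (-R) R, ENNReal.ofReal (|u| ^ (-(1 / 2) : ℝ)) < ⊤ := by
  have h1 : IntervalIntegrable (fun u : ℝ => u ^ (-(1 / 2) : ℝ)) volume (-R) R :=
    intervalIntegral.intervalIntegrable_rpow' (by norm_num)
  have h2 : IntervalIntegrable (fun u : ℝ => (-u) ^ (-(1 / 2) : ℝ)) volume (-R) R := by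
    have h0 : IntervalIntegrable (fun u : ℝ => u ^ (-(1 / 2) : ℝ)) volume R (-R) :=
      intervalIntegral.intervalIntegrable_rpow' (by norm_num)
    simpa using (IntervalIntegrable.iff_comp_neg).1 h0
  have h3 := h1.add h2
  rw [intervalIntegrable_iff, Set.uIoc_of_le (by linarith)] at h3
  have h4 := (h3.mono_set Set.Ioo_subset_Ioc_self).lintegral_lt_top
  refine lt_of_le_of_lt (lintegral_mono fun u => ENNReal.ofReal_le_ofReal ?_) h4
  -- The real power of a negative base to the exponent `-1/2` is zero by convention, since `cos
  -- (π/2) = 0`. Hence `|u| ^ (-1/2)` is at most the sum of the powers of `u` and `-u`.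
  have key : ∀ v : ℝ, v ≤ 0 → 0 ≤ v ^ (-(1 / 2) : ℝ) := by
    intro v hv
    rcases hv.eq_or_lt with rfl | hv
    · rw [Real.zero_rpow (by norm_num)]
    · rw [Real.rpow_def_of_neg hv, neg_mul, Real.cos_neg, one_div_mul_eq_div,
        Real.cos_pi_div_two, mul_zero]
  rcases le_total 0 u with hu | hu
  · rw [abs_of_nonneg hu]
    linarith [key (-u) (by linarith)]
  · rw [abs_of_nonpos hu]
    linarith [key u hu]

lemma sq_le_abs_cos_sub_cos {θ φ : ℝ} (hθ : θ ∈ Set.Icc 0 Real.pi) (hφ : φ ∈ Set.Icc 0 Real.pi) :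
    2 / Real.pi ^ 2 * (θ - φ) ^ 2 ≤ |Real.cos θ - Real.cos φ| := by
  wlog hle : φ ≤ θ generalizing θ φ
  · have := this hφ hθ (by linarith)
    rw [abs_sub_comm]
    linarith
  have hπ := Real.pi_pos
  have h1 : 2 / Real.pi * ((θ - φ) / 2) ≤ Real.sin ((θ - φ) / 2) :=
    Real.mul_le_sin (by linarith) (by linarith [hφ.1, hθ.2])
  have h2 : Real.sin ((θ - φ) / 2) ≤ Real.sin ((θ + φ) / 2) := by
    rcases le_total ((θ + φ) / 2) (Real.pi / 2) with h | h
    · exact Real.sin_le_sin_of_le_of_le_pi_div_two (by linarith) h (by linarith [hφ.1])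
    · rw [← Real.sin_pi_sub ((θ + φ) / 2)]
      exact Real.sin_le_sin_of_le_of_le_pi_div_two (by linarith) (by linarith)
        (by linarith [hθ.2])
  have h3 : 0 ≤ 2 / Real.pi * ((θ - φ) / 2) := by
    have : 0 ≤ θ - φ := by linarith
    positivity
  rw [Real.cos_sub_cos, mul_assoc, neg_mul, abs_neg, abs_of_nonneg (by
    have := mul_nonneg (h3.trans (h1.trans h2)) (h3.trans h1)
    linarith)]
  have h4 := mul_le_mul (h1.trans h2) h1 h3 (h3.trans (h1.trans h2))
  have h5 : 2 / Real.pi ^ 2 * (θ - φ) ^ 2 =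
      2 * (2 / Real.pi * ((θ - φ) / 2) * (2 / Real.pi * ((θ - φ) / 2))) := by
    field_simp
  rw [h5]
  linarith

/-- A uniform lower bound for the distance to the points of the parametrized interval. -/
lemma exists_sq_le_abs_sub_arcPoint {a b : ℝ} (hab : a < b) (y : ℝ) : ∃ φ : ℝ,
    φ ∈ Set.Icc 0 Real.pi ∧ ∀ θ ∈ Set.Icc 0 Real.pi,
      (b - a) / 2 * (2 / Real.pi ^ 2) * (θ - φ) ^ 2 ≤ |y - arcPoint a b θ| := by
  have hr : 0 < (b - a) / 2 := by linarith
  set Y := (y - (a + b) / 2) / ((b - a) / 2) with hY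
  refine ⟨Real.arccos Y, ⟨Real.arccos_nonneg Y, Real.arccos_le_pi Y⟩, fun θ hθ => ?_⟩
  have h1 := sq_le_abs_cos_sub_cos hθ ⟨Real.arccos_nonneg Y, Real.arccos_le_pi Y⟩
  have h2 : y - arcPoint a b θ = (b - a) / 2 * (Y - Real.cos θ) := by
    rw [hY, arcPoint, mul_sub, mul_div_cancel₀ _ hr.ne']
    ring
  have h3 : |Real.cos θ - Real.cos (Real.arccos Y)| ≤ |Y - Real.cos θ| := by
    have c1 := Real.cos_le_one θ
    have c2 := Real.neg_one_le_cos θ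
    rcases le_total Y (-1) with h | h
    · rw [Real.arccos_of_le_neg_one h, Real.cos_pi, abs_of_nonneg (by linarith),
        abs_of_nonpos (by linarith)]
      linarith
    rcases le_total 1 Y with h' | h'
    · rw [Real.arccos_of_one_le h', Real.cos_zero, abs_of_nonpos (by linarith),
        abs_of_nonneg (by linarith)]
      linarith
    · rw [Real.cos_arccos h h', abs_sub_comm]
  rw [h2, abs_mul, abs_of_pos hr, mul_assoc]
  exact mul_le_mul_of_nonneg_left (h1.trans h3) hr.le

lemma nuShifted_eq_withDensity (σ α a b : ℝ) :
    nuShifted σ α a b = volume.withDensity fun t => ENNReal.ofReal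
      ((Set.Ioc a b).indicator (nuDensity α a b) (t + σ)) := by
  have hm : Measurable fun x : ℝ => x - σ := by fun_prop
  ext S hS
  rw [nuShifted, Measure.map_apply hm hS, nu, withDensity_apply _ (hm hS),
    withDensity_apply _ hS, Measure.restrict_restrict (hm hS),
    ← lintegral_indicator ((hm hS).inter measurableSet_Ioc), ← lintegral_indicator hS,
    ← lintegral_add_right_eq_self _ σ]
  refine lintegral_congr fun t => ?_
  by_cases h1 : t ∈ S
  · rw [Set.indicator_of_mem h1]
    by_cases h2 : t + σ ∈ Set.Ioc a b
    · rw [Set.indicator_of_mem h2, Set.indicator_of_mem]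
      exact ⟨by simpa using h1, h2⟩
    · rw [Set.indicator_of_notMem h2, Set.indicator_of_notMem (fun h => h2 h.2),
        ENNReal.ofReal_zero]
  · rw [Set.indicator_of_notMem h1, Set.indicator_of_notMem]
    exact fun h => h1 (by simpa using h.1)

lemma logPotential_nuShifted (σ α a b t : ℝ) :
    logPotential (nuShifted σ α a b) t = logPotential (nu α a b) (t + σ) := by
  rw [logPotential, nuShifted, integral_map (f := fun x => logKernel 0 (t - x)) (by fun_prop)
    (measurable_logKernel.comp (measurable_const.sub measurable_id)).aestronglyMeasurable,
    logPotential]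
  congr 1
  ext x
  congr 1
  ring

namespace IsArc

variable {α a b : ℝ} (h : IsArc α a b)

include h

lemma nuShifted_eq_map (σ : ℝ) :
    nuShifted σ α a b = (arcMeasure α a b).map fun θ => arcPoint a b θ - σ := by
  rw [nuShifted, h.nu_eq_map, Measure.map_map (by fun_prop) (arcPoint_measurable a b)]
  rfl

lemma isProbabilityMeasure_nuShifted (σ : ℝ) : IsProbabilityMeasure (nuShifted σ α a b) := by
  have := h.isProbabilityMeasure_nu
  exact Measure.isProbabilityMeasure_map (by fun_prop)

lemma ae_nuShifted_mem (σ : ℝ) :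
    ∀ᵐ t ∂(nuShifted σ α a b), t ∈ Set.Icc (a - σ) (b - σ) := by
  have := arcPoint_measurable a b
  rw [h.nuShifted_eq_map]
  refine (ae_map_iff (by fun_prop) measurableSet_Icc).2 (Eventually.of_forall fun θ => ?_)
  have := arcPoint_mem_Icc h.lt.le θ
  exact ⟨by linarith [this.1], by linarith [this.2]⟩

/-- Distances in `x` are at least `κ` times squared distances in `θ`, so the power `-1/4` becomes
the integrable power `-1/2` in the angle. The bounded weight and translation invariance make the
bound uniform in `t`. -/
lemma exists_riesz_bound (σ : ℝ) : ∃ M : ℝ, ∀ t,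
    ∫⁻ x, ENNReal.ofReal (|t - x| ^ (-(1 / 4) : ℝ)) ∂(nuShifted σ α a b) ≤ ENNReal.ofReal M := by
  have hc := h.continuous_arcWeight
  have hr := h.half_pos
  have hπ := Real.pi_pos
  have hm := arcPoint_measurable a b
  obtain ⟨W, hW⟩ := isCompact_Icc.exists_bound_of_continuousOn (s := Set.Icc 0 Real.pi)
    hc.continuousOn
  set κ := (b - a) / 2 * (2 / Real.pi ^ 2) with hκ
  have hκ0 : 0 < κ := by positivity
  set J := ∫⁻ u in Set.Ioo (-Real.pi) Real.pi, ENNReal.ofReal (|u| ^ (-(1 / 2) : ℝ)) with hJ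
  have hJt : J ≠ ⊤ := (lintegral_abs_rpow_lt_top Real.pi hπ.le).ne
  set c := W / Real.pi * κ ^ (-(1 / 4) : ℝ) with hcd
  refine ⟨(ENNReal.ofReal c * J).toReal, fun t => ?_⟩
  rw [ENNReal.ofReal_toReal (ENNReal.mul_ne_top ENNReal.ofReal_ne_top hJt)]
  obtain ⟨φ, hφ, hφθ⟩ := exists_sq_le_abs_sub_arcPoint h.lt (t + σ)
  have hmg : Measurable fun x : ℝ => ENNReal.ofReal (|t - x| ^ (-(1 / 4) : ℝ)) := by fun_prop
  have hms : Measurable fun θ => arcPoint a b θ - σ := by fun_prop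
  rw [h.nuShifted_eq_map, lintegral_map hmg hms, arcMeasure,
    lintegral_withDensity_eq_lintegral_mul (g := fun θ =>
      ENNReal.ofReal (|t - (arcPoint a b θ - σ)| ^ (-(1 / 4) : ℝ))) _
      (hc.div_const _).measurable.ennreal_ofReal (hmg.comp hms)]
  have hpt : ∀ θ ∈ Set.Ioo 0 Real.pi, θ ≠ φ →
      ENNReal.ofReal (arcWeight α a b θ / Real.pi) *
        ENNReal.ofReal (|t - (arcPoint a b θ - σ)| ^ (-(1 / 4) : ℝ)) ≤
      ENNReal.ofReal c * (Set.Ioo (-Real.pi) Real.pi).indicator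
        (fun u => ENNReal.ofReal (|u| ^ (-(1 / 2) : ℝ))) (θ - φ) := by
    intro θ hθ hne
    have hθ' := Set.Ioo_subset_Icc_self hθ
    have hmem : θ - φ ∈ Set.Ioo (-Real.pi) Real.pi :=
      ⟨by linarith [hθ.1, hφ.2], by linarith [hθ.2, hφ.1]⟩
    rw [Set.indicator_of_mem hmem,
      ← ENNReal.ofReal_mul (div_nonneg (h.arcWeight_nonneg θ) hπ.le)]
    have hW0 : 0 ≤ W := (norm_nonneg _).trans (hW θ hθ')
    rw [← ENNReal.ofReal_mul (by positivity)]
    refine ENNReal.ofReal_le_ofReal ?_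
    have h1 : arcWeight α a b θ / Real.pi ≤ W / Real.pi :=
      div_le_div_of_nonneg_right ((le_abs_self _).trans (hW θ hθ')) hπ.le
    have hd : 0 < |θ - φ| := abs_pos.2 (sub_ne_zero.2 hne)
    have h2 : κ * |θ - φ| ^ 2 ≤ |t - (arcPoint a b θ - σ)| := by
      have := hφθ θ hθ'
      rw [sq_abs]
      rwa [show t - (arcPoint a b θ - σ) = t + σ - arcPoint a b θ by ring]
    have h3 : |t - (arcPoint a b θ - σ)| ^ (-(1 / 4) : ℝ) ≤
        κ ^ (-(1 / 4) : ℝ) * |θ - φ| ^ (-(1 / 2) : ℝ) := by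
      refine (Real.rpow_le_rpow_of_nonpos (by positivity) h2 (by norm_num)).trans_eq ?_
      rw [Real.mul_rpow hκ0.le (by positivity), ← Real.rpow_natCast, ← Real.rpow_mul hd.le]
      norm_num
    rw [hcd, mul_assoc]
    exact mul_le_mul h1 h3 (by positivity) (by positivity)
  have hae : ∀ᵐ θ ∂(volume.restrict (Set.Ioo 0 Real.pi)),
      ENNReal.ofReal (arcWeight α a b θ / Real.pi) *
        ENNReal.ofReal (|t - (arcPoint a b θ - σ)| ^ (-(1 / 4) : ℝ)) ≤
      ENNReal.ofReal c * (Set.Ioo (-Real.pi) Real.pi).indicator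
        (fun u => ENNReal.ofReal (|u| ^ (-(1 / 2) : ℝ))) (θ - φ) := by
    filter_upwards [ae_restrict_mem measurableSet_Ioo, ae_restrict_of_ae (Measure.ae_ne volume φ)]
      with θ h1 h2
    exact hpt θ h1 h2
  refine (lintegral_mono_ae hae).trans ?_
  refine (lintegral_mono' Measure.restrict_le_self le_rfl).trans ?_
  rw [lintegral_const_mul' _ _ ENNReal.ofReal_ne_top, lintegral_sub_right_eq_self
    ((Set.Ioo (-Real.pi) Real.pi).indicator fun u => ENNReal.ofReal (|u| ^ (-(1 / 2) : ℝ))),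
    lintegral_indicator measurableSet_Ioo]

/-- In the angle, `w log f = w log w - w log (π (b-a)/2) - w log (sin θ)`: two continuous terms and
an integrable logarithm. -/
lemma integrable_log_density (σ : ℝ) :
    Integrable (fun t => Real.log ((Set.Ioc a b).indicator (nuDensity α a b) (t + σ)))
      (nuShifted σ α a b) := by
  have hc := h.continuous_arcWeight
  have hr := h.half_pos
  have hm := arcPoint_measurable a b
  have hms : Measurable fun θ => arcPoint a b θ - σ := by fun_prop
  have hmf : Measurable fun t =>
      Real.log ((Set.Ioc a b).indicator (nuDensity α a b) (t + σ)) :=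
    Real.measurable_log.comp (((measurable_nuDensity α a b).indicator measurableSet_Ioc).comp
      (measurable_id.add_const σ))
  rw [h.nuShifted_eq_map, integrable_map_measure hmf.aestronglyMeasurable hms.aemeasurable]
  refine h.integrable_arcMeasure ?_
  have h1 : IntervalIntegrable (fun θ => arcWeight α a b θ * Real.log (arcWeight α a b θ))
      volume 0 Real.pi := (Real.continuous_mul_log.comp hc).intervalIntegrable _ _
  have h2 : IntervalIntegrable (fun θ => arcWeight α a b θ * Real.log (Real.pi * ((b - a) / 2)))
      volume 0 Real.pi := (hc.mul continuous_const).intervalIntegrable _ _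
  have h3 : IntervalIntegrable (fun θ => arcWeight α a b θ * Real.log (Real.sin θ))
      volume 0 Real.pi := intervalIntegrable_log_sin.continuousOn_mul hc.continuousOn
  refine ((h1.sub h2).sub h3).congr_ae ?_
  rw [Set.uIoc_of_le Real.pi_pos.le, ← restrict_Ioo_eq_restrict_Ioc]
  filter_upwards [ae_restrict_mem measurableSet_Ioo] with θ hθ
  have hs := Real.sin_pos_of_mem_Ioo hθ
  have hmem : arcPoint a b θ ∈ Set.Ioc a b := by
    have : arcPoint a b θ ∈ Set.Ioo a b := by
      rw [← arcPoint_image h.lt]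
      exact ⟨θ, hθ, rfl⟩
    exact Set.Ioo_subset_Ioc_self this
  simp only [Function.comp, sub_add_cancel]
  rw [Set.indicator_of_mem hmem, h.nuDensity_arcPoint hθ, ← mul_assoc]
  rcases eq_or_ne (arcWeight α a b θ) 0 with h0 | h0
  · simp [h0]
  · rw [Real.log_div h0 (by have := Real.pi_pos; positivity),
      Real.log_mul (by have := Real.pi_pos; positivity) hs.ne']
    ring

/-- The measure `ν_α^a` in the shifted coordinate is the equilibrium measure of the half-line. -/
theorem isEquilibrium {σ : ℝ} (hσ : 0 < σ ∨ α = 0) (hleft : σ ≤ a)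
    (hphi : σ < a → phi α b a = 0) :
    IsEquilibrium α σ (nuShifted σ α a b) (arcConst α a b) where
  prob := h.isProbabilityMeasure_nuShifted σ
  support := by
    refine ⟨b - σ, ?_⟩
    have : ∀ᵐ t ∂(nuShifted σ α a b), t ∈ Set.Icc 0 (b - σ) := by
      filter_upwards [h.ae_nuShifted_mem σ] with t ht
      exact ⟨by linarith [ht.1], ht.2⟩
    exact this
  riesz := h.exists_riesz_bound σ
  le_potential t ht := by
    rw [logPotential_nuShifted, fieldReal]
    have : arcConst α a b ≤ 2 * logPotential (nu α a b) (t + σ) + (t + σ) ^ 2 -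
        2 * α * Real.log (t + σ) := by
      rcases lt_or_ge (t + σ) a with h1 | h1
      · refine h.arcConst_le_of_left (hphi (by linarith)) h1 ?_
        rcases hσ with h2 | h2
        · exact Or.inr (by linarith)
        · exact Or.inl h2
      rcases le_or_gt (t + σ) b with h2 | h2
      · exact (h.potential_eq_arcConst ⟨h1, h2⟩).ge
      · exact h.arcConst_le_of_right h2
    linarith
  potential_eq := by
    filter_upwards [h.ae_nuShifted_mem σ] with t ht
    have := h.potential_eq_arcConst (y := t + σ) ⟨by linarith [ht.1], by linarith [ht.2]⟩
    rw [logPotential_nuShifted, fieldReal]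
    linarith
  density := by
    refine ⟨fun t => (Set.Ioc a b).indicator (nuDensity α a b) (t + σ),
      ((measurable_nuDensity α a b).indicator measurableSet_Ioc).comp
        (measurable_id.add_const σ), fun t => ?_, nuShifted_eq_withDensity σ α a b,
      h.integrable_log_density σ⟩
    exact Set.indicator_nonneg (fun x hx => h.nuDensity_nonneg hx.1.le) _

end IsArc

/-! ### The set of admissible left end points -/

lemma continuousAt_phi {α : ℝ} {p : ℝ × ℝ} (h : α = 0 ∨ (0 < p.1 ∧ 0 < p.2)) :
    ContinuousAt (fun p : ℝ × ℝ => phi α p.1 p.2) p := by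
  unfold phi
  rcases h with rfl | ⟨h1, h2⟩
  · simp only [mul_zero, zero_div, sub_zero]
    fun_prop
  · refine ContinuousAt.sub (by fun_prop) (ContinuousAt.div (by fun_prop) (by fun_prop) ?_)
    exact (Real.sqrt_pos.2 (mul_pos h2 h1)).ne'

lemma continuousAt_psi {α : ℝ} {p : ℝ × ℝ} (h : α = 0 ∨ (0 < p.1 ∧ 0 < p.2)) :
    ContinuousAt (fun p : ℝ × ℝ => psi α p.1 p.2) p := by
  unfold psi
  rcases h with rfl | ⟨h1, h2⟩
  · simp only [mul_zero, zero_mul, sub_zero]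
    fun_prop
  · have h3 : ContinuousAt (fun p : ℝ × ℝ => √p.2 / √p.1) p :=
      ContinuousAt.div (by fun_prop) (by fun_prop) (Real.sqrt_pos.2 h1).ne'
    fun_prop

lemma psi_self {α a : ℝ} (h : α = 0 ∨ 0 < a) : psi α a a = -2 := by
  unfold psi
  rcases h with rfl | h
  · ring
  · rw [div_self (Real.sqrt_pos.2 h).ne']
    ring

lemma phi_mono {α a a' x x' : ℝ} (hα : 0 ≤ α) (hpos : α = 0 ∨ (0 < a ∧ 0 < x)) (ha : a ≤ a')
    (hx : x ≤ x') : phi α x a ≤ phi α x' a' := by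
  unfold phi
  rcases hpos with rfl | ⟨h1, h2⟩
  · simp only [mul_zero, zero_div, sub_zero]
    linarith
  · have h3 : √(a * x) ≤ √(a' * x') := Real.sqrt_le_sqrt (by nlinarith)
    have h4 := Real.sqrt_pos.2 (mul_pos h1 h2)
    have : 2 * α / √(a' * x') ≤ 2 * α / √(a * x) := by gcongr
    linarith

/-- The inequality `phi α x a ≥ 0` without denominators. -/
lemma two_mul_le_of_phi_nonneg {α x a : ℝ} (ha : 0 < a) (hx : 0 < x) (h : 0 ≤ phi α x a) :
    2 * α ≤ (x + a) * (√a * √x) := by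
  unfold phi at h
  rw [Real.sqrt_mul ha.le] at h
  have h1 := Real.sqrt_pos.2 ha
  have h2 := Real.sqrt_pos.2 hx
  rw [← div_le_iff₀ (by positivity)]
  linarith

/-- The derivative of `psi` in `a` is `-phi / 2`, and `phi` stays nonnegative as `a` grows. Square
roots as variables turn this into an algebraic inequality. -/
lemma psi_antitone_left {α a a' x : ℝ} (hα : 0 ≤ α) (hpos : α = 0 ∨ (0 < a ∧ 0 < x))
    (ha : a ≤ a') (hphi : 0 ≤ phi α x a) : psi α x a' ≤ psi α x a := by
  rcases hpos with rfl | ⟨h1, h2⟩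
  · unfold phi at hphi
    unfold psi
    simp only [mul_zero, zero_mul, zero_div, sub_zero, add_zero] at *
    nlinarith
  · have h3 := two_mul_le_of_phi_nonneg h1 h2 hphi
    have h4 := h1.trans_le ha
    have e1 := Real.sq_sqrt h1.le
    have e2 := Real.sq_sqrt h2.le
    have e3 := Real.sq_sqrt h4.le
    have p1 := Real.sqrt_pos.2 h1
    have p2 := Real.sqrt_pos.2 h2
    have p3 := Real.sqrt_pos.2 h4
    have hle := Real.sqrt_le_sqrt ha
    unfold psi
    generalize √a = s at *
    generalize √a' = s' at *
    generalize √x = t at *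
    subst e1 e2 e3
    have k1 : 2 * α * (s' / t) - 2 * α * (s / t) = 2 * α / (s * t) * (s * (s' - s)) := by
      field_simp
    have k2 : 2 * α / (s * t) ≤ t ^ 2 + s ^ 2 := by
      rwa [div_le_iff₀ (by positivity)]
    have k3 : 2 * α / (s * t) * (s * (s' - s)) ≤ (t ^ 2 + s ^ 2) * (s * (s' - s)) :=
      mul_le_mul_of_nonneg_right k2 (mul_nonneg p1.le (by linarith))
    have k4 : (t ^ 2 + s ^ 2) * (s * (s' - s)) ≤
        (s' ^ 2 - s ^ 2) * (2 * t ^ 2 + s ^ 2 + s' ^ 2) / 4 := by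
      have h5 : 2 * (s * (s' - s)) ≤ s' ^ 2 - s ^ 2 := by nlinarith
      have h6 : 0 ≤ s' ^ 2 - s ^ 2 := by linarith
      nlinarith [mul_le_mul_of_nonneg_left h5 (by positivity : 0 ≤ t ^ 2 + s ^ 2)]
    linarith

/-- Where `phi ≥ 0`, the `α` term of the derivative in `x` is at most `a (x + a) / (2x) ≤ a` for `a
> 0`, so the derivative is at least `3(x - a)/2`. -/
lemma psi_lt_psi {α a x y : ℝ} (hpos : α = 0 ∨ 0 < a) (hax : a < x) (hxy : x < y)
    (hphi : 0 ≤ phi α x a) : psi α x a < psi α y a := by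
  rcases hpos with rfl | h1
  · unfold phi at hphi
    unfold psi
    simp only [mul_zero, zero_mul, zero_div, sub_zero, add_zero] at *
    nlinarith
  · have h2 := h1.trans hax
    have h3 := two_mul_le_of_phi_nonneg h1 h2 hphi
    have h4 := h2.trans hxy
    have e1 := Real.sq_sqrt h1.le
    have e2 := Real.sq_sqrt h2.le
    have e3 := Real.sq_sqrt h4.le
    have p1 := Real.sqrt_pos.2 h1
    have p2 := Real.sqrt_pos.2 h2
    have p3 := Real.sqrt_pos.2 h4
    have hle := Real.sqrt_lt_sqrt h1.le hax
    have hle' := Real.sqrt_lt_sqrt h2.le hxy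
    unfold psi
    generalize √a = s at *
    generalize √x = t at *
    generalize √y = u at *
    subst e1 e2 e3
    have k1 : 2 * α * (s / t) - 2 * α * (s / u) = 2 * α * (s * (u - t) / (t * u)) := by
      field_simp
    have k2 : 2 * α * (s * (u - t) / (t * u)) ≤
        (t ^ 2 + s ^ 2) * (s * t) * (s * (u - t) / (t * u)) := by
      refine mul_le_mul_of_nonneg_right h3 ?_
      have : 0 ≤ u - t := by linarith
      positivity
    have k3 : (t ^ 2 + s ^ 2) * (s * t) * (s * (u - t) / (t * u)) =
        (t ^ 2 + s ^ 2) * s ^ 2 * (u - t) / u := by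
      field_simp
    have k4 : (t ^ 2 + s ^ 2) * s ^ 2 * (u - t) / u ≤ s ^ 2 * (u ^ 2 - t ^ 2) := by
      rw [div_le_iff₀ p3]
      have h5 : t ^ 2 + s ^ 2 ≤ (u + t) * u := by nlinarith
      have h6 : 0 ≤ s ^ 2 * (u - t) := mul_nonneg (by positivity) (by linarith)
      nlinarith
    have k5 : 0 < (u ^ 2 - t ^ 2) * (3 * (u ^ 2 + t ^ 2) - 6 * s ^ 2) :=
      mul_pos (by linarith) (by linarith)
    nlinarith

/-- Relaxes the equation to an inequality: `psi` becomes positive for large `x` while `phi` only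
grows, so the intermediate value theorem supplies a root. It lies strictly right of `a` because `psi
α a a = -2`. -/
lemma mem_leftEnds_of_psi_nonpos {α a x : ℝ} (hα : 0 ≤ α) (hpos : α = 0 ∨ 0 < a) (hax : a ≤ x)
    (hphi : 0 ≤ phi α x a) (hpsi : psi α x a ≤ 0) : a ∈ leftEnds α := by
  refine ⟨hpos, ?_⟩
  have hpos' : ∀ y, x ≤ y → α = 0 ∨ (0 < y ∧ 0 < a) := fun y hy =>
    hpos.imp_right fun h => ⟨by linarith, h⟩
  set y := x + 2 * |a| + 2 * α + 4 with hy
  have hxy : x ≤ y := by linarith [abs_nonneg a]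
  have hpsiy : 0 ≤ psi α y a := by
    have h1 : 0 ≤ 2 * α * (√a / √y) := by positivity
    have h2 : 2 * α + 4 ≤ y - a := by linarith [abs_nonneg a]
    have h3 : 4 ≤ 3 * y + a := by linarith [abs_nonneg a, neg_abs_le a]
    have h4 : psi α y a = (3 * y + a) * (y - a) / 4 + 2 * α * (√a / √y) - 2 * α - 2 := by
      unfold psi
      ring
    nlinarith
  have hcont : ContinuousOn (fun z => psi α z a) (Set.Icc x y) := fun z hz =>
    (ContinuousAt.comp (f := fun z : ℝ => (z, a)) (continuousAt_psi (p := (z, a))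
      (hpos' z hz.1)) (by fun_prop)).continuousWithinAt
  obtain ⟨z, hz, hz0⟩ := intermediate_value_Icc hxy hcont ⟨hpsi, hpsiy⟩
  refine ⟨z, lt_of_le_of_ne (hax.trans hz.1) ?_, hphi.trans (phi_mono hα
    ((hpos' x le_rfl).imp_right And.symm) le_rfl hz.1), hz0⟩
  rintro rfl
  simp only [psi_self hpos] at hz0
  norm_num at hz0

lemma leftEnds_upward {α a a' : ℝ} (hα : 0 ≤ α) (ha : a ∈ leftEnds α) (haa : a ≤ a') :
    a' ∈ leftEnds α := by
  obtain ⟨hpos, x, hax, hphi, hpsi⟩ := ha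
  have hpos' : α = 0 ∨ 0 < a' := hpos.imp_right fun h => h.trans_le haa
  have hposx : α = 0 ∨ (0 < a ∧ 0 < x) := hpos.imp_right fun h => ⟨h, h.trans hax⟩
  rcases le_total a' x with h | h
  -- While `a' ≤ x` the old `x` still works; beyond it, the search starts on the diagonal, where
  -- `psi = -2`.
  · exact mem_leftEnds_of_psi_nonpos hα hpos' h (hphi.trans (phi_mono hα hposx haa le_rfl))
      ((psi_antitone_left hα hposx haa hphi).trans hpsi.le)
  · exact mem_leftEnds_of_psi_nonpos hα hpos' le_rfl (hphi.trans (phi_mono hα hposx haa h))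
      (by rw [psi_self hpos']; norm_num)

/-- If `phi` were positive, a slight decrease of `b` would make `psi` negative with `phi` still
positive. Both strict inequalities would survive a slight decrease of `a`, giving a smaller element.
-/
lemma phi_eq_zero_of_isLeast {α a b : ℝ} (hα : 0 ≤ α) (ha : IsLeast (leftEnds α) a)
    (hab : a < b) (hphi : 0 ≤ phi α b a) (hpsi : psi α b a = 0) : phi α b a = 0 := by
  by_contra hne
  have hlt : 0 < phi α b a := lt_of_le_of_ne hphi (Ne.symm hne)
  have hpos : α = 0 ∨ 0 < a := ha.1.1
  have hposx : ∀ x, a < x → α = 0 ∨ (0 < x ∧ 0 < a) := fun x hx =>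
    hpos.imp_right fun h => ⟨h.trans hx, h⟩
  have c1 : ContinuousAt (fun x => phi α x a) b := ContinuousAt.comp (f := fun x : ℝ => (x, a))
    (continuousAt_phi (p := (b, a)) (hposx b hab)) (by fun_prop)
  obtain ⟨x, hxphi, hax, hxb⟩ : ∃ x, 0 < phi α x a ∧ a < x ∧ x < b := by
    have e1 : ∀ᶠ x in 𝓝[<] b, 0 < phi α x a :=
      (c1.tendsto.eventually_const_lt hlt).filter_mono nhdsWithin_le_nhds
    obtain ⟨x, hx, hx2⟩ := (e1.and (Ioo_mem_nhdsLT hab)).exists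
    exact ⟨x, hx, hx2.1, hx2.2⟩
  have hxpsi : psi α x a < 0 := hpsi ▸ psi_lt_psi hpos hax hxb hxphi.le
  have c2 : ContinuousAt (fun a => phi α x a) a := ContinuousAt.comp (f := fun a : ℝ => (x, a))
    (continuousAt_phi (p := (x, a)) (hposx x hax)) (by fun_prop)
  have c3 : ContinuousAt (fun a => psi α x a) a := ContinuousAt.comp (f := fun a : ℝ => (x, a))
    (continuousAt_psi (p := (x, a)) (hposx x hax)) (by fun_prop)
  have e1 : ∀ᶠ a' in 𝓝[<] a, 0 < phi α x a' :=
    (c2.tendsto.eventually_const_lt hxphi).filter_mono nhdsWithin_le_nhds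
  have e2 : ∀ᶠ a' in 𝓝[<] a, psi α x a' < 0 :=
    (c3.tendsto.eventually_lt_const hxpsi).filter_mono nhdsWithin_le_nhds
  have e3 : ∀ᶠ a' in 𝓝[<] a, α = 0 ∨ 0 < a' := by
    rcases hpos with h | h
    · exact Eventually.of_forall fun _ => Or.inl h
    · exact ((eventually_gt_nhds h).filter_mono nhdsWithin_le_nhds).mono fun _ h => Or.inr h
  obtain ⟨a', ⟨⟨h1, h2⟩, h3⟩, h4⟩ :=
    (((e1.and e2).and e3).and (self_mem_nhdsWithin : Set.Iio a ∈ 𝓝[<] a)).exists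
  have hmem := mem_leftEnds_of_psi_nonpos hα h3 (le_of_lt (lt_trans h4 hax)) h1.le h2.le
  exact absurd (ha.2 hmem) (not_le.2 h4)

lemma isLeast_leftEnds_zero : IsLeast (leftEnds 0) (-√2) := by
  have h2 : √2 ^ 2 = (2 : ℝ) := Real.sq_sqrt zero_le_two
  have h0 : 0 < √(2 : ℝ) := Real.sqrt_pos.2 two_pos
  constructor
  · refine ⟨Or.inl rfl, √2, by linarith, ?_, ?_⟩
    · simp [phi]
    · unfold psi
      linear_combination h2
  · rintro a ⟨-, x, hax, hphi, hpsi⟩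
    by_contra hlt
    unfold phi at hphi
    unfold psi at hpsi
    simp only [mul_zero, zero_mul, zero_div, sub_zero, add_zero] at *
    have h3 : 2 * √2 < 3 * x + a := by linarith
    have h4 : 2 * √2 < x - a := by linarith
    nlinarith [mul_lt_mul'' h3 h4 (by positivity) (by positivity)]

lemma sub_le_of_psi_eq {α a x : ℝ} (hα : 0 ≤ α) (ha : 0 < a) (hax : a ≤ x)
    (hpsi : psi α x a = 0) : x - a ≤ 2 + 2 * α := by
  unfold psi at hpsi
  have h1 : 0 ≤ 2 * α * (√a / √x) := by positivity
  have h2 : 0 ≤ a * (x - a) := mul_nonneg ha.le (by linarith)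
  by_contra hlt
  nlinarith

/-- As `a → 0` the root `x` stays bounded, whereas `phi ≥ 0` requires `2α ≤ (x + a) √(a x)`.
Squaring this for `a ≤ 1`, with `x ≤ D + 1`, gives the constant. -/
lemma exists_pos_le_leftEnds {α : ℝ} (hα : 0 < α) :
    ∃ c : ℝ, 0 < c ∧ ∀ a ∈ leftEnds α, c ≤ a := by
  set D := 2 + 2 * α with hD
  have hD0 : 0 < D := by positivity
  refine ⟨min 1 (4 * α ^ 2 / ((D + 2) ^ 2 * (D + 1))), by positivity, ?_⟩
  rintro a ⟨hpos, x, hax, hphi, hpsi⟩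
  have ha := hpos.resolve_left hα.ne'
  have hx := ha.trans hax
  have hd := sub_le_of_psi_eq hα.le ha hax.le hpsi
  rcases le_total 1 a with h1 | h1
  · exact (min_le_left _ _).trans h1
  refine (min_le_right _ _).trans ?_
  rw [div_le_iff₀ (by positivity)]
  have h2 := two_mul_le_of_phi_nonneg ha hx hphi
  have h3 : (2 * α) ^ 2 ≤ ((x + a) * (√a * √x)) ^ 2 := by gcongr
  have h4 : ((x + a) * (√a * √x)) ^ 2 = (x + a) ^ 2 * (a * x) := by
    rw [mul_pow, mul_pow, Real.sq_sqrt ha.le, Real.sq_sqrt hx.le]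
  have h5 : (x + a) ^ 2 * (a * x) ≤ (D + 2) ^ 2 * (a * (D + 1)) := by
    have h6 : x ≤ D + 1 := by linarith
    have h7 : x + a ≤ D + 2 := by linarith
    gcongr
  nlinarith

lemma exists_isLeast_leftEnds {α : ℝ} (hα : 0 ≤ α) : ∃ a, IsLeast (leftEnds α) a := by
  rcases hα.eq_or_lt with rfl | hα
  · exact ⟨_, isLeast_leftEnds_zero⟩
  obtain ⟨c, hc, hcle⟩ := exists_pos_le_leftEnds hα
  set A := α + 1 with hA
  have hA0 : 0 < A := by positivity
  have hAmem : A ∈ leftEnds α := by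
    refine mem_leftEnds_of_psi_nonpos hα.le (Or.inr hA0) le_rfl ?_ (by
      rw [psi_self (Or.inr hA0)]; norm_num)
    rw [phi, Real.sqrt_mul_self hA0.le, sub_nonneg, div_le_iff₀ hA0]
    nlinarith
  -- The end points up to `A` are the projection of a compact set of pairs; the closed condition `a
  -- ≤ x` loses nothing, since `psi` is nonzero on the diagonal.
  set box : Set (ℝ × ℝ) := Set.Icc c (A + (2 + 2 * α)) ×ˢ Set.Icc c A with hbox
  have hboxc : IsClosed box := isClosed_Icc.prod isClosed_Icc
  have hposb : ∀ p ∈ box, α = 0 ∨ (0 < p.1 ∧ 0 < p.2) := fun p hp =>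
    Or.inr ⟨hc.trans_le hp.1.1, hc.trans_le hp.2.1⟩
  have hclosed : IsClosed ((box ∩ (fun p : ℝ × ℝ => phi α p.1 p.2) ⁻¹' Set.Ici 0) ∩
      ((box ∩ (fun p : ℝ × ℝ => psi α p.1 p.2) ⁻¹' {0}) ∩ {p : ℝ × ℝ | p.2 ≤ p.1})) := by
    refine IsClosed.inter ?_ (IsClosed.inter ?_ (isClosed_le continuous_snd continuous_fst))
    · exact ContinuousOn.preimage_isClosed_of_isClosed
        (fun p hp => (continuousAt_phi (hposb p hp)).continuousWithinAt) hboxc isClosed_Ici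
    · exact ContinuousOn.preimage_isClosed_of_isClosed
        (fun p hp => (continuousAt_psi (hposb p hp)).continuousWithinAt) hboxc isClosed_singleton
  have hcompact := (isCompact_Icc.prod isCompact_Icc : IsCompact box).of_isClosed_subset hclosed
    fun p hp => hp.1.1
  have hmem : ∀ a ∈ leftEnds α, a ≤ A → ∃ x, (x, a) ∈
      (box ∩ (fun p : ℝ × ℝ => phi α p.1 p.2) ⁻¹' Set.Ici 0) ∩
      ((box ∩ (fun p : ℝ × ℝ => psi α p.1 p.2) ⁻¹' {0}) ∩ {p : ℝ × ℝ | p.2 ≤ p.1}) := by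
    intro a ha haA
    have hca := hcle a ha
    obtain ⟨-, x, hax, hphi, hpsi⟩ := ha
    have hd := sub_le_of_psi_eq hα.le (hc.trans_le hca) hax.le hpsi
    have hb : (x, a) ∈ box := ⟨⟨hca.trans hax.le, by linarith⟩, hca, haA⟩
    exact ⟨x, ⟨hb, hphi⟩, ⟨hb, hpsi⟩, hax.le⟩
  obtain ⟨x₀, hx₀⟩ := hmem A hAmem le_rfl
  obtain ⟨⟨x, a⟩, hp, hmin⟩ := hcompact.exists_isMinOn ⟨_, hx₀⟩ continuous_snd.continuousOn
  have ha0 : 0 < a := hc.trans_le hp.1.1.2.1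
  refine ⟨a, ⟨mem_leftEnds_of_psi_nonpos hα.le (Or.inr ha0) hp.2.2 hp.1.2
    (le_of_eq hp.2.1.2), fun a' ha' => ?_⟩⟩
  rcases le_total a' A with h | h
  · obtain ⟨x', hx'⟩ := hmem a' ha' h
    exact hmin hx'
  · exact hp.1.1.2.2.trans h

end

end RestrictedEnsemble

theorem proposition5p2 (α σ : ℝ) (hα : 0 ≤ α) (hσ : 0 < σ ∨ α = 0) :
    -- the end points depend on `α` and `σ` only
    ∃ ac a b : ℝ,
      IsLeast (RestrictedEnsemble.leftEnds α) ac ∧ a = max σ ac ∧ a < b ∧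
      0 ≤ RestrictedEnsemble.phi α b a ∧ RestrictedEnsemble.psi α b a = 0 ∧
      IsProbabilityMeasure (RestrictedEnsemble.nu α a b) ∧
      RestrictedEnsemble.minEnergy α σ ≠ ⊤ ∧ RestrictedEnsemble.minEnergy α σ ≠ ⊥ ∧
      ∀ μ : ℕ → ℝ, (∀ n, 0 ≤ μ n) → Tendsto (fun n => μ n / n) atTop (𝓝 α) →
        -- (1)
        (Tendsto (fun n => RestrictedEnsemble.tau (μ n / n) σ n) atTop
            (𝓝 (RestrictedEnsemble.minEnergy α σ)) ∧
          RestrictedEnsemble.minEnergy α σ =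
            RestrictedEnsemble.energy α σ (RestrictedEnsemble.nuShifted σ α a b)) ∧
        -- (2)
        ((∀ n, 2 ≤ n → ∃ x, RestrictedEnsemble.IsMinimizingConfig (μ n / n) σ n x) ∧
          ∀ x : (n : ℕ) → Fin n → ℝ,
            (∀ n, 2 ≤ n → RestrictedEnsemble.IsMinimizingConfig (μ n / n) σ n (x n)) →
            ∀ f : BoundedContinuousFunction ℝ ℝ,
              Tendsto (fun n => ∫ t, f t ∂(RestrictedEnsemble.empirical n (x n))) atTop
                (𝓝 (∫ t, f t ∂(RestrictedEnsemble.nuShifted σ α a b)))) ∧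
        -- (3)
        ∀ β : ℝ, 0 < β →
          Tendsto
            (fun n : ℕ => -(((1 / (n : ℝ) ^ 2 : ℝ) : EReal) *
              ENNReal.log (RestrictedEnsemble.partitionFunction β σ (μ n) n))) atTop
            (𝓝 (((β / 2 : ℝ) : EReal) * RestrictedEnsemble.minEnergy α σ)) := by
  obtain ⟨ac, hac⟩ := RestrictedEnsemble.exists_isLeast_leftEnds hα
  obtain ⟨hpos, b, hab, hphi, hpsi⟩ :=
    RestrictedEnsemble.leftEnds_upward hα hac.1 (le_max_right σ ac)
  have harc : RestrictedEnsemble.IsArc α (max σ ac) b := ⟨hα, hab, hpos, hphi, hpsi⟩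
  -- If `σ < a` then `a` is the minimum of `leftEnds` and `phi` vanishes; if `a = σ`, no point of
  -- the half-line lies left of `a`.
  have heq := harc.isEquilibrium hσ (le_max_left σ ac) fun hlt => by
    have hmax : max σ ac = ac := max_eq_right (le_of_lt ((lt_max_iff.1 hlt).resolve_left
      (lt_irrefl σ)))
    rw [hmax] at hab hphi hpsi ⊢
    exact RestrictedEnsemble.phi_eq_zero_of_isLeast hα hac hab hphi hpsi
  have hmin := heq.minEnergy_eq hα hσ
  refine ⟨ac, max σ ac, b, hac, rfl, hab, hphi, hpsi, harc.isProbabilityMeasure_nu, ?_, ?_,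
    fun μ hμ hlim => ?_⟩
  · rw [hmin]
    exact EReal.coe_ne_top _
  · rw [hmin]
    exact EReal.coe_ne_bot _
  have hδ : ∀ n : ℕ, 0 ≤ μ n / n := fun n => div_nonneg (hμ n) n.cast_nonneg
  refine ⟨⟨?_, ?_⟩, ⟨fun n hn => RestrictedEnsemble.exists_isMinimizingConfig (hδ n) σ hn,
    fun x hx f => heq.tendsto_integral_empirical hσ hδ hlim x hx f⟩, fun β hβ => ?_⟩
  · rw [hmin]
    exact heq.tendsto_tau hσ hδ hlim
  · rw [hmin, heq.energy_eq]
  · rw [hmin]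
    exact heq.tendsto_partitionFunction hσ hμ hlim hβ
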